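/- Let $n=k+m$ and let $v_1,\dots,v_k,w_1,\dots,w_m\in(\mathbb Z^n)^\vee$ be linearly independent integer linear forms. Put $T_1=\max(0,v_1,\dots,v_k)$ and $T_2=\max(0,w_1,\dots,w_m)$, as functions on $\mathbb R^n$. An (affine tropical) $d$-cycle in $\mathbb R^n$ is a balanced rational fan of pure dimension $d$ (with strongly convex cones) whose $d$-dimensional cones carry weights in $\mathbb Z_{\ge0}$, taken modulo common refinement; its support is the union of the $d$-dimensional cones of nonzero weight. For a piecewise linear function $T$ and a $d$-cycle $[F]$, represented by a fan $F$ on whose cones $T$ is linear, $T\cdot[F]$ is the tropical intersection product, that is, the $(d-1)$-cycle in which a $(d-1)$-dimensional cone $\tau$ of $F$ has weight $\sum_{\sigma\supset\tau}T_\sigma(\omega(\sigma)v_{\sigma/\tau})-T_\tau\big(\sum_{\sigma\supset\tau}\omega(\sigma)v_{\sigma/\tau}\big)$, where $\sigma$ runs over the $d$-dimensional cones of $F$ containing $\tau$, $v_{\sigma/\tau}$ is the primitive generator from $\tau$ to $\sigma$, and $T_\sigma$ is the linear extension of $T|_\sigma$ to the span of $\sigma$. A $0$-cycle is identified with its weight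 at the origin. Then there are only finitely many $2$-cycles $[L]$ in $\mathbb R^n$ whose support $|L|$ is a $2$-dimensional linear subspace (necessarily rational) and which satisfy $$T_1\cdot T_2\cdot[L]=1,\qquad T_1\cdot T_1\cdot[L]\le 1,\qquad T_2\cdot T_2\cdot[L]\le 1.$$ Moreover, let $R$ be the set of all $r\in\mathbb Z^n$ with $v_i(r)\in\{-1,0,1\}$ for all $i$ and $w_j(r)\in\{-1,0,1\}$ for all $j$. This set is finite, and for each such $[L]$ at least one of the following holds. 1. Both products are lines: there are primitive vectors $\rho_1,\rho_2\in R$ such that, for $i=1,2$, $T_i\cdot[L]$ is the line $\mathbb R\rho_i$ with weight $1$, and $|L|=\langle\rho_1,\rho_2\rangle$. 2. One of the products is a one-dimensional Bergman fan: for some $i\in\{1,2\}$, $T_i\cdot[L]$ consists of three distinct rays of weight $1$ with primitive generators $r_0,r_1,r_2\in R$ such that $r_0+r_1+r_2=0$, the vectors $r_1,r_2$ form a basis of the lattice $\mathbb Z^n\cap\langle r_0,r_1,r_2\rangle$, and $|L|=\langle r_0,r_1,r_2\rangle$. -/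

import Mathlib

/-! Rational fans in `ℝⁿ`, tropical fans, affine tropical cycles and their intersection products
with tropical regular functions. The lattice is `ℤⁿ ⊆ ℝⁿ`. -/

noncomputable section

namespace Tropical4

/-- A lattice vector, seen in `ℝⁿ`. -/
def latVec {n : ℕ} (z : Fin n → ℤ) : Fin n → ℝ := fun i => (z i : ℝ)

/-- Cones in `ℝⁿ` (with apex `0`). -/
abbrev Cone (n : ℕ) := PointedCone ℝ (Fin n → ℝ)

/-- The linear span `⟨σ⟩` of a cone. -/
def Cone.linSpan {n : ℕ} (σ : Cone n) : Submodule ℝ (Fin n → ℝ) :=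
  Submodule.span ℝ (σ : Set (Fin n → ℝ))

/-- The dimension of a cone. -/
def Cone.dim {n : ℕ} (σ : Cone n) : ℕ := Module.finrank ℝ σ.linSpan

/-- A rational polyhedral cone: generated by finitely many lattice vectors. -/
def Cone.IsRational {n : ℕ} (σ : Cone n) : Prop :=
  ∃ S : Finset (Fin n → ℤ), σ = PointedCone.hull ℝ (latVec '' (S : Set (Fin n → ℤ)))

/-- Strong convexity: `σ ∩ (-σ) = {0}`. -/
def Cone.IsStronglyConvex {n : ℕ} (σ : Cone n) : Prop := ∀ x ∈ σ, -x ∈ σ → x = 0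

/-- A (nonempty) fan: a finite set of strongly convex rational cones, closed under taking faces,
any two of which meet in a common face. -/
structure Fan (n : ℕ) where
  cones : Finset (Cone n)
  bot_mem : ⊥ ∈ cones
  rational : ∀ σ ∈ cones, σ.IsRational
  stronglyConvex : ∀ σ ∈ cones, σ.IsStronglyConvex
  face_mem : ∀ σ ∈ cones, ∀ τ : Cone n, τ.IsFaceOf σ → τ ∈ cones
  inter_face : ∀ σ ∈ cones, ∀ τ ∈ cones, (σ ⊓ τ).IsFaceOf σ ∧ (σ ⊓ τ).IsFaceOf τ

/-- `u` represents the primitive generator `v_{σ/τ}` of `ℤ_σ / ℤ_τ ≅ ℤ` pointing from `τ`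
towards `σ`, where `τ` is a facet of the cone `σ`. -/
structure IsPrimitiveNormal {n : ℕ} (σ τ : Cone n) (u : Fin n → ℤ) : Prop where
  mem_span : latVec u ∈ σ.linSpan
  generates : ∀ z : Fin n → ℤ, latVec z ∈ σ.linSpan → ∃ c : ℤ, latVec (z - c • u) ∈ τ.linSpan
  pointing : ∃ t ∈ τ.linSpan, latVec u + t ∈ σ

open Classical in
/-- The `k`-dimensional cones of a fan that contain the cone `τ`. -/
def Fan.star {n : ℕ} (X : Fan n) (k : ℕ) (τ : Cone n) : Finset (Cone n) :=
  X.cones.filter fun σ => σ.dim = k ∧ τ ≤ σ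

/-- A tropical fan of dimension `k`: a fan of pure dimension `k` whose `k`-dimensional cones carry
weights in `ℤ_{≥ 0}` that are balanced around each cone of dimension `k - 1`. (The values of
`weight` away from the `k`-dimensional cones of the fan play no role.) -/
structure TropicalFan (n k : ℕ) extends Fan n where
  pure : ∀ σ ∈ cones, ∃ σ' ∈ cones, σ ≤ σ' ∧ σ'.dim = k
  weight : Cone n → ℕ
  balanced : ∀ τ ∈ cones, τ.dim + 1 = k → ∃ u : Cone n → Fin n → ℤ,
    (∀ σ ∈ toFan.star k τ, IsPrimitiveNormal σ τ (u σ)) ∧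
      latVec (∑ σ ∈ toFan.star k τ, weight σ • u σ) ∈ τ.linSpan

/-- The facets of nonzero weight. -/
def TropicalFan.facets {n k : ℕ} (X : TropicalFan n k) : Set (Cone n) :=
  {σ | σ ∈ X.cones ∧ σ.dim = k ∧ X.weight σ ≠ 0}

/-- The support of a weighted fan; as usual, cones of weight zero do not count. -/
def TropicalFan.support {n k : ℕ} (X : TropicalFan n k) : Set (Fin n → ℝ) :=
  ⋃ σ ∈ X.facets, (σ : Set (Fin n → ℝ))

/-- `X` is a refinement of `Y`: the two have the same support, every cone (of the nonzero part)
of `X` lies in a cone of `Y`, and the weights of `X` are induced from those of `Y`. -/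
def TropicalFan.Refines {n k : ℕ} (X Y : TropicalFan n k) : Prop :=
  X.support = Y.support ∧
    ∀ σ ∈ X.facets, ∃ σ' ∈ Y.facets, σ ≤ σ' ∧ X.weight σ = Y.weight σ'

/-- Two tropical fans are equivalent if they have a common refinement. -/
def TropicalFan.Equiv {n k : ℕ} (X Y : TropicalFan n k) : Prop :=
  ∃ Z : TropicalFan n k, Z.Refines X ∧ Z.Refines Y

/-- Affine tropical `k`-cycles in `ℝⁿ`: tropical fans of dimension `k` modulo equivalence. -/
def Cycle (n k : ℕ) := Quot (TropicalFan.Equiv (n := n) (k := k))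

/-- The class `[X]` of a tropical fan. -/
def TropicalFan.toCycle {n k : ℕ} (X : TropicalFan n k) : Cycle n k := Quot.mk _ X

/-- The support `|C|` of a cycle. -/
def Cycle.support {n k : ℕ} (C : Cycle n k) : Set (Fin n → ℝ) :=
  Quot.lift TropicalFan.support (by
    rintro X Y ⟨Z, hX, hY⟩
    exact hX.1.symm.trans hY.1) C

theorem Cone.dim_bot {n : ℕ} : (⊥ : Cone n).dim = 0 := by
  have h : (⊥ : Cone n).linSpan = ⊥ := by
    simp [Cone.linSpan, Submodule.span_eq_bot]
  rw [Cone.dim, h, finrank_bot]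

theorem Cone.eq_bot_of_dim {n : ℕ} {σ : Cone n} (h : σ.dim = 0) : σ = ⊥ := by
  have h' : σ.linSpan = ⊥ := Submodule.finrank_eq_zero.mp h
  rw [eq_bot_iff]
  intro x hx
  have : x ∈ σ.linSpan := Submodule.subset_span hx
  rw [h'] at this
  simpa using this

theorem TropicalFan.Refines.weight_bot {n : ℕ} {Z X : TropicalFan n 0} (h : Z.Refines X) :
    Z.weight ⊥ = X.weight ⊥ := by
  by_cases hZ : Z.weight ⊥ = 0
  · by_contra hX
    rw [hZ] at hX
    have h0 : (0 : Fin n → ℝ) ∈ X.support :=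
      Set.mem_biUnion (x := (⊥ : Cone n)) ⟨X.bot_mem, Cone.dim_bot, fun e => hX e.symm⟩
        (zero_mem (⊥ : Cone n))
    rw [← h.1] at h0
    simp only [TropicalFan.support, Set.mem_iUnion] at h0
    obtain ⟨σ, hσ, -⟩ := h0
    exact hσ.2.2 (by rw [Cone.eq_bot_of_dim hσ.2.1, hZ])
  · obtain ⟨σ', hσ', -, e⟩ := h.2 ⊥ ⟨Z.bot_mem, Cone.dim_bot, hZ⟩
    rwa [Cone.eq_bot_of_dim hσ'.2.1] at e

/-- The degree of a `0`-cycle: the weight of the origin. -/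
def Cycle.degree {n : ℕ} (C : Cycle n 0) : ℕ :=
  Quot.lift (fun X : TropicalFan n 0 => X.weight ⊥) (by
    rintro X Y ⟨Z, hX, hY⟩
    exact hX.weight_bot.symm.trans hY.weight_bot) C

/-- The linear form on `ℝⁿ` with integer coefficients `l`. -/
def intForm {n : ℕ} (l : Fin n → ℤ) (x : Fin n → ℝ) : ℝ := ∑ i, (l i : ℝ) * x i

/-- The tropical regular function `max(l_0, …, l_m)`. -/
def trFunction {n m : ℕ} (l : Fin (m + 1) → Fin n → ℤ) (x : Fin n → ℝ) : ℝ :=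
  Finset.univ.sup' Finset.univ_nonempty fun i => intForm (l i) x

/-- `G` is the tropical fan `T · F` for a function `T` that is linear on each cone of `F`: its
cones are the cones of `F` of dimension at most `k`, and the weight of a `k`-dimensional cone `τ` is
`∑ T_σ(ω(σ) v_{σ/τ}) - T_τ(∑ ω(σ) v_{σ/τ})`, both sums over the facets `σ` of `F` containing `τ`.
Here `φ σ` restricts to the linear extension `T_σ` of `T|σ` to `⟨σ⟩`. -/
def IsFanProduct {n k : ℕ} (T : (Fin n → ℝ) → ℝ) (F : TropicalFan n (k + 1))
    (G : TropicalFan n k) : Prop :=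
  (∀ τ : Cone n, τ ∈ G.cones ↔ τ ∈ F.cones ∧ τ.dim ≤ k) ∧
  ∃ φ : Cone n → ((Fin n → ℝ) →ₗ[ℝ] ℝ),
    (∀ σ ∈ F.cones, ∀ x ∈ σ, T x = φ σ x) ∧
    ∀ τ ∈ F.cones, τ.dim = k → ∃ u : Cone n → Fin n → ℤ,
      (∀ σ ∈ F.star (k + 1) τ, IsPrimitiveNormal σ τ (u σ)) ∧
      (G.weight τ : ℝ) =
        ∑ σ ∈ F.star (k + 1) τ, φ σ (latVec (F.weight σ • u σ)) -
          φ τ (latVec (∑ σ ∈ F.star (k + 1) τ, F.weight σ • u σ))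

/-- `D = T · C`: the cycle `D` is the tropical intersection product of the function `T` with the
cycle `C`, computed on a representative on whose cones `T` is linear. -/
def IsProduct {n k : ℕ} (T : (Fin n → ℝ) → ℝ) (C : Cycle n (k + 1)) (D : Cycle n k) : Prop :=
  ∃ (F : TropicalFan n (k + 1)) (G : TropicalFan n k),
    F.toCycle = C ∧ G.toCycle = D ∧ IsFanProduct T F G

/-- `S · T · [L] = d`, for a `2`-cycle `[L]`. -/
def IntersectionNumberEq {n : ℕ} (S T : (Fin n → ℝ) → ℝ) (L : Cycle n 2) (d : ℕ) : Prop :=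
  ∃ (C : Cycle n 1) (D : Cycle n 0), IsProduct T L C ∧ IsProduct S C D ∧ D.degree = d

/-- `T₁ · T₂ · [L] = 1`, `T₁ · T₁ · [L] ≤ 1` and `T₂ · T₂ · [L] ≤ 1`. -/
def IsStronglyRegular {n : ℕ} (T₁ T₂ : (Fin n → ℝ) → ℝ) (L : Cycle n 2) : Prop :=
  IntersectionNumberEq T₁ T₂ L 1 ∧
    (∃ d ≤ 1, IntersectionNumberEq T₁ T₁ L d) ∧ (∃ d ≤ 1, IntersectionNumberEq T₂ T₂ L d)

/-- The support of the cycle is a `2`-dimensional linear subspace (which is then rational, since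
it is a finite union of rational cones). -/
def HasPlaneSupport {n : ℕ} (L : Cycle n 2) : Prop :=
  ∃ P : Submodule ℝ (Fin n → ℝ), Module.finrank ℝ P = 2 ∧ L.support = (P : Set (Fin n → ℝ))

/-- A primitive lattice vector. -/
def IsPrimitiveVec {n : ℕ} (r : Fin n → ℤ) : Prop :=
  ∀ (d : ℤ) (z : Fin n → ℤ), r = d • z → IsUnit d

/-- The `1`-cycle `C` is represented by the fan with the pairwise different rays `ℝ_{≥ 0} r_i`,
all of weight `1`, and with primitive generators `r_i`. -/
def IsRayCycle {n q : ℕ} (C : Cycle n 1) (r : Fin q → Fin n → ℤ) : Prop :=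
  Function.Injective r ∧ (∀ i, IsPrimitiveVec (r i)) ∧
  ∃ F : TropicalFan n 1, F.toCycle = C ∧
    (∀ σ : Cone n, σ ∈ F.cones ↔ σ = ⊥ ∨ ∃ i, σ = PointedCone.hull ℝ {latVec (r i)}) ∧
    ∀ i, F.weight (PointedCone.hull ℝ {latVec (r i)}) = 1

/-- `C` is the line `ℝ ρ` with weight `1` and primitive generator `ρ`. -/
def IsLine {n : ℕ} (C : Cycle n 1) (ρ : Fin n → ℤ) : Prop := IsRayCycle C ![ρ, -ρ]

/-- `C` is a one-dimensional Bergman fan with three rays spanning a plane: the rays have weight `1`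
and primitive generators `r₀, r₁, r₂` with `r₀ + r₁ + r₂ = 0`, and `r₁, r₂` is a basis of the
lattice `ℤⁿ ∩ ⟨r₀, r₁, r₂⟩`. Up to a lattice isomorphism of that plane with `ℝ²` this is the fan
with rays `(1,0)`, `(0,1)`, `(-1,-1)`, the Bergman fan of the uniform matroid of rank two on three
elements modulo its lineality space. -/
def IsBergmanFan {n : ℕ} (C : Cycle n 1) (r : Fin 3 → Fin n → ℤ) : Prop :=
  IsRayCycle C r ∧ ∑ i, r i = 0 ∧ LinearIndependent ℤ ![r 1, r 2] ∧
    ∀ z : Fin n → ℤ, latVec z ∈ Submodule.span ℝ (Set.range fun i => latVec (r i)) →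
      ∃ a b : ℤ, z = a • r 1 + b • r 2

/-- The lattice vectors on which all forms `v_i` and `w_j` take values in `{-1, 0, 1}`. -/
def smallVectors {n k m : ℕ} (v : Fin k → Fin n → ℤ) (w : Fin m → Fin n → ℤ) :
    Set (Fin n → ℤ) :=
  {r | (∀ i, v i ⬝ᵥ r ∈ ({-1, 0, 1} : Set ℤ)) ∧ ∀ j, w j ⬝ᵥ r ∈ ({-1, 0, 1} : Set ℤ)}

/-- The real span of a family of lattice vectors. -/
def realSpan {n q : ℕ} (r : Fin q → Fin n → ℤ) : Submodule ℝ (Fin n → ℝ) :=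
  Submodule.span ℝ (Set.range fun i => latVec (r i))

end Tropical4

end

/-! Everything happens in the plane P = |L|. Balancing makes the two facets at a ray of a fan
supported on P equally heavy, and P without the origin is connected, so all facets have one weight
ω. For a basis (r, e) of the lattice M = P ∩ ℤⁿ, the ray of r has weight ω (T(N r + e) + T(N r - e)
- 2 T(N r)), N large, in T · [L] (`TropicalFan.rayWeight_eq_bend`). Hence ω divides T₁ · T₂ · [L] =
1, and ω = 1.

What remains is elementary and takes place in M, of rank two. The product T · [L] becomes a balanced
weight function c on primitive vectors (`IsDivisor`), and T · T · [L] is the sum of all c(r) T(r).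
Suppose that the rays of c span the plane. A self-intersection of at most 1 leaves exactly one ray ρ
with T(ρ) ≠ 0, and T(ρ) = c(ρ) = 1. Pairing the balancing condition with one of the forms l ≤ T
shows that l is zero, or that l is 1 at ρ, -1 at one further ray of weight 1 and 0 at all others.
Since T bends at ρ, two different further rays occur; up to sign they are dual to their forms, hence
a basis of M (`IsDivisor.exists_three_rays`). If instead all rays lie on a line ℝρ, then T(ρ) =
T(-ρ) = 0, because otherwise T would bend somewhere off that line; so all forms vanish at ρ
(`IsDivisor.form_eq_zero_of_line`). In each combination of these two shapes the mixed number 1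
bounds the values of the forms at the rays (`classification`).

For finiteness, n independent forms are injective on ℤⁿ, so R is finite, and P is spanned by two or
three members of R. Finally P determines [L]: two fans on P with the same constant weight are both
refined by the fan of cells of a line arrangement (`Cycle.IsPlane.eq`). -/

open Filter Topology

namespace Tropical4

/-! ### Divisors of maxima of linear forms on a lattice of rank two -/

section Planar

variable {M : Type*} [AddCommGroup M]

/-- `(r, e)` is a `ℤ`-basis of `M`. -/
structure IsBasisPair (r e : M) : Prop where
  indep : ∀ a b : ℤ, a • r + b • e = 0 → a = 0 ∧ b = 0
  gen : ∀ z : M, ∃ a b : ℤ, z = a • r + b • e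

namespace IsBasisPair

variable {r e : M}

theorem swap (h : IsBasisPair r e) : IsBasisPair e r where
  indep a b hab := (h.indep b a (by rw [add_comm]; exact hab)).symm
  gen z := by
    obtain ⟨a, b, rfl⟩ := h.gen z
    exact ⟨b, a, add_comm _ _⟩

theorem neg_left (h : IsBasisPair r e) : IsBasisPair (-r) e where
  indep a b hab := by
    have := h.indep (-a) b (by rw [← hab]; module)
    omega
  gen z := by
    obtain ⟨a, b, rfl⟩ := h.gen z
    exact ⟨-a, b, by module⟩

theorem add_zsmul_left (h : IsBasisPair r e) (y : ℤ) : IsBasisPair (r + y • e) e where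
  indep a b hab := by
    have := h.indep a (a * y + b) (by rw [← hab]; module)
    obtain ⟨rfl, h2⟩ := this
    simpa using h2
  gen z := by
    obtain ⟨a, b, rfl⟩ := h.gen z
    exact ⟨a, b - a * y, by module⟩

theorem left_ne_zero (h : IsBasisPair r e) : r ≠ 0 := by
  rintro rfl
  have := h.indep 1 0 (by simp)
  omega

theorem ne_neg (h : IsBasisPair r e) : r ≠ -r := by
  intro hr
  have : (2 : ℤ) • r + (0 : ℤ) • e = 0 := by
    rw [zero_smul, add_zero, two_smul]
    nth_rewrite 1 [hr]
    simp
  have := h.indep 2 0 this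
  omega

/-- Basis vectors are primitive: if p is the s-coordinate of r, then s = a r gives a p = 1, so a is
a unit. -/
theorem eq_or_eq_neg {s f : M} (hs : IsBasisPair s f) {a : ℤ}
    (hsa : s = a • r) : s = r ∨ s = -r := by
  obtain ⟨p, q, hr⟩ := hs.gen r
  have h1 : (a * p - 1) • s + (a * q) • f = 0 := by
    have : a • r = a • (p • s + q • f) := by rw [← hr]
    rw [← hsa] at this
    have h2 : (a * p - 1) • s + (a * q) • f = a • (p • s + q • f) - s := by module
    rw [h2, ← this, sub_self]
  have h3 : a * p = 1 := by have := (hs.indep _ _ h1).1; omega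
  rcases Int.eq_one_or_neg_one_of_mul_eq_one h3 with rfl | rfl
  · left; simpa using hsa
  · right; simpa using hsa

theorem ext_hom (h : IsBasisPair r e) {l l' : M →+ ℤ} (h1 : l r = l' r) (h2 : l e = l' e) :
    l = l' := by
  ext z
  obtain ⟨a, b, rfl⟩ := h.gen z
  simp [h1, h2]

/-- A homomorphism to `ℤ` is determined by its values at two independent elements. -/
theorem ext_hom_of_indep (h : IsBasisPair r e) {s : M}
    (hs : ∀ a b : ℤ, a • r + b • s = 0 → a = 0 ∧ b = 0)
    {l l' : M →+ ℤ} (h1 : l r = l' r) (h2 : l s = l' s) : l = l' := by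
  obtain ⟨a, b, rfl⟩ := h.gen s
  refine h.ext_hom h1 ?_
  have hb : b ≠ 0 := by
    rintro rfl
    have := hs (-a) 1 (by module)
    omega
  simp only [map_add, map_zsmul, smul_eq_mul, h1] at h2
  exact mul_left_cancel₀ hb (by linarith)

/-- The matrix of values of the two forms on (r, e), times the coordinate matrix of r₁, r₂, is minus
the identity. So its determinant is nonzero, and Cramer's rule kills the coordinates of z. -/
theorem eq_zero_of_dual (h : IsBasisPair r e) {l l' : M →+ ℤ} {r₁ r₂ : M}
    (h11 : l r₁ = -1) (h12 : l r₂ = 0) (h21 : l' r₁ = 0) (h22 : l' r₂ = -1) {z : M}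
    (hz : l z = 0) (hz' : l' z = 0) : z = 0 := by
  obtain ⟨x, y, rfl⟩ := h.gen z
  obtain ⟨p, q, rfl⟩ := h.gen r₁
  obtain ⟨p', q', rfl⟩ := h.gen r₂
  simp only [map_add, map_zsmul, smul_eq_mul] at *
  have hdet : (l r * l' e - l e * l' r) * (p * q' - p' * q) = 1 := by
    linear_combination (p' * l' r + q' * l' e) * h11 - h22 - (p * l' r + q * l' e) * h12
  have hd : l r * l' e - l e * l' r ≠ 0 := by
    intro h0
    rw [h0] at hdet
    simp at hdet
  have hx : x = 0 := by
    apply mul_left_cancel₀ hd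
    linear_combination l' e * hz - l e * hz'
  have hy : y = 0 := by
    apply mul_left_cancel₀ hd
    linear_combination l r * hz' - l' r * hz
  simp [hx, hy]

end IsBasisPair

/-- `T` is the maximum of the linear forms `l i`, one of which vanishes. -/
structure IsMaxForm {ι : Type*} (l : ι → M →+ ℤ) (T : M → ℤ) : Prop where
  zero : ∃ i, l i = 0
  le : ∀ i z, l i z ≤ T z
  attained : ∀ z, ∃ i, T z = l i z

namespace IsMaxForm

variable {ι : Type*} {l : ι → M →+ ℤ} {T : M → ℤ}

theorem nonneg (h : IsMaxForm l T) (z : M) : 0 ≤ T z := by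
  obtain ⟨i, hi⟩ := h.zero
  simpa [hi] using h.le i z

theorem eq_zero_of_zero (h : IsMaxForm l T) (h0 : ∀ i, l i = 0) (z : M) : T z = 0 := by
  obtain ⟨i, hi⟩ := h.attained z
  simp [hi, h0 i]

theorem nsmul (h : IsMaxForm l T) (N : ℕ) (z : M) : T (N • z) = N * T z := by
  apply le_antisymm
  · obtain ⟨i, hi⟩ := h.attained (N • z)
    rw [hi, map_nsmul, nsmul_eq_mul]
    exact mul_le_mul_of_nonneg_left (h.le i z) (by positivity)
  · obtain ⟨i, hi⟩ := h.attained z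
    have := h.le i (N • z)
    rwa [map_nsmul, nsmul_eq_mul, ← hi] at this

theorem add_invariant (h : IsMaxForm l T) {r : M} (hr : ∀ i, l i r = 0) (N : ℕ) (z : M) :
    T (N • r + z) = T z := by
  apply le_antisymm
  · obtain ⟨i, hi⟩ := h.attained (N • r + z)
    rw [hi]
    simpa [hr i] using h.le i z
  · obtain ⟨i, hi⟩ := h.attained z
    rw [hi]
    simpa [hr i] using h.le i (N • r + z)

end IsMaxForm

/-- The weights `c` of the rays are those of the intersection product of `T` with the plane `M`
of weight `ω`. -/
structure IsDivisor (T : M → ℤ) (ω : ℕ) (c : M →₀ ℕ) : Prop where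
  prim : ∀ r, c r ≠ 0 → ∃ e, IsBasisPair r e
  balanced : ∑ r ∈ c.support, c r • r = 0
  bend : ∀ r e, IsBasisPair r e → ∃ N₀ : ℕ, ∀ N ≥ N₀,
    (c r : ℤ) = ω * (T (N • r + e) + T (N • r - e) - 2 * T (N • r))

theorem exists_unique_one {α : Type*} {B : Finset α} {f : α → ℤ} (h0 : ∀ s ∈ B, 0 ≤ f s)
    (h1 : ∑ s ∈ B, f s = 1) : ∃ s ∈ B, f s = 1 ∧ ∀ t ∈ B, t ≠ s → f t = 0 := by
  classical
  have : ∃ s ∈ B, f s ≠ 0 := by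
    by_contra! h
    rw [Finset.sum_eq_zero h] at h1
    omega
  obtain ⟨s, hs, hs0⟩ := this
  have e := Finset.add_sum_erase B f hs
  have hnn : ∀ t ∈ B.erase s, 0 ≤ f t := fun t ht => h0 t (Finset.mem_of_mem_erase ht)
  have h2 := Finset.sum_nonneg hnn
  have h3 := h0 s hs
  have h4 : ∑ t ∈ B.erase s, f t = 0 := by omega
  refine ⟨s, hs, by omega, fun t ht hts => ?_⟩
  exact (Finset.sum_eq_zero_iff_of_nonneg hnn).1 h4 t (Finset.mem_erase.2 ⟨hts, ht⟩)

section Divisor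

variable {ι : Type*} {l : ι → M →+ ℤ} {T : M → ℤ} {c : M →₀ ℕ}

/-- The balancing condition paired with a form. Together with `IsMaxForm.le` it lets the
self-intersection number control each single form. -/
theorem IsDivisor.sum_hom {ω : ℕ} (hc : IsDivisor T ω c) (f : M →+ ℤ) :
    ∑ r ∈ c.support, (c r : ℤ) * f r = 0 := by
  have := congrArg f hc.balanced
  simpa using this

theorem eq_one_of_mul_eq_one {a : ℕ} {b : ℤ} (h : (a : ℤ) * b = 1) :
    a = 1 ∧ b = 1 := by
  rcases Int.eq_one_or_neg_one_of_mul_eq_one h with h1 | h1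
  · rw [h1] at h
    exact ⟨by exact_mod_cast h1, by omega⟩
  · omega

/-- A divisor of self-intersection at most one whose rays are not contained in a line consists of
three unimodular rays of weight one. -/
theorem IsDivisor.exists_three_rays (hT : IsMaxForm l T) (hc : IsDivisor T 1 c)
    (hle : ∑ r ∈ c.support, (c r : ℤ) * T r ≤ 1)
    (hli : ∃ r s, c r ≠ 0 ∧ c s ≠ 0 ∧ ∀ a b : ℤ, a • r + b • s = 0 → a = 0 ∧ b = 0) :
    ∃ r₀ r₁ r₂ : M, IsBasisPair r₁ r₂ ∧ r₀ + r₁ + r₂ = 0 ∧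
      (c r₀ = 1 ∧ c r₁ = 1 ∧ c r₂ = 1) ∧ (∀ z, c z ≠ 0 → z = r₀ ∨ z = r₁ ∨ z = r₂) ∧
      (∃ i, l i r₁ = -1 ∧ l i r₂ = 0) ∧ (∃ i, l i r₁ = 0 ∧ l i r₂ = -1) ∧
      ∀ i, (l i r₁ = 0 ∧ l i r₂ = 0) ∨ (l i r₁ = -1 ∧ l i r₂ = 0) ∨
        (l i r₁ = 0 ∧ l i r₂ = -1) := by
  classical
  obtain ⟨a, b, ha, hb, hab⟩ := hli
  obtain ⟨a', haa⟩ := hc.prim a ha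
  have hpos : ∀ r ∈ c.support, (0 : ℤ) < c r := fun r hr => by
    have := Finsupp.mem_support_iff.1 hr
    positivity
  have hT0 : ∀ z, 0 ≤ T z := hT.nonneg
  have hterm : ∀ r ∈ c.support, 0 ≤ (c r : ℤ) * T r := fun r hr =>
    mul_nonneg (hpos r hr).le (hT0 r)
  -- forms agreeing on the support agree
  have hext : ∀ f g : M →+ ℤ, (∀ r ∈ c.support, f r = g r) → f = g := fun f g h =>
    haa.ext_hom_of_indep hab (h a (by simpa using ha)) (h b (by simpa using hb))
  -- A form that is nonpositive on all rays vanishes: its weighted values add up to zero by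
  -- balancing, hence are all zero, and the rays span.
  have key : ∀ i, (∀ r ∈ c.support, l i r ≤ 0) → l i = 0 := by
    intro i hi
    refine hext _ _ fun r hr => ?_
    have h1 := hc.sum_hom (l i)
    have h2 := (Finset.sum_eq_zero_iff_of_nonpos (fun s hs =>
      mul_nonpos_of_nonneg_of_nonpos (hpos s hs).le (hi s hs))).1 h1 r hr
    rcases mul_eq_zero.1 h2 with h | h
    · have := hpos r hr
      omega
    · simpa using h
  -- If T vanished on all rays, every form would vanish by `key` and T would bend nowhere.
  have hex : ∃ ρ ∈ c.support, T ρ ≠ 0 := by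
    by_contra! h
    have hl : ∀ i, l i = 0 := fun i => key i fun r hr => (hT.le i r).trans (h r hr).le
    obtain ⟨N, hN⟩ := hc.bend a a' haa
    have := hN N le_rfl
    simp only [hT.eq_zero_of_zero hl] at this
    simp at this
    exact ha this
  obtain ⟨ρ, hρ, hTρ⟩ := hex
  have hsplit := Finset.add_sum_erase c.support (fun r => (c r : ℤ) * T r) hρ
  have hnn : ∀ t ∈ c.support.erase ρ, 0 ≤ (c t : ℤ) * T t := fun t ht =>
    hterm t (Finset.mem_of_mem_erase ht)
  have h2 := Finset.sum_nonneg hnn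
  have h3 : 0 < (c ρ : ℤ) * T ρ :=
    mul_pos (hpos ρ hρ) (lt_of_le_of_ne (hT0 ρ) (Ne.symm hTρ))
  have h4 : (c ρ : ℤ) * T ρ = 1 := by omega
  have h5 : ∑ t ∈ c.support.erase ρ, (c t : ℤ) * T t = 0 := by omega
  obtain ⟨hcρ, hTρ1⟩ := eq_one_of_mul_eq_one h4
  have hT' : ∀ s ∈ c.support.erase ρ, T s = 0 := fun s hs => by
    have h6 := (Finset.sum_eq_zero_iff_of_nonneg hnn).1 h5 s hs
    rcases mul_eq_zero.1 h6 with h | h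
    · have := hpos s (Finset.mem_of_mem_erase hs)
      omega
    · exact h
  have hneg : ∀ i, ∀ s ∈ c.support.erase ρ, l i s ≤ 0 := fun i s hs =>
    (hT.le i s).trans (hT' s hs).le
  -- A nonzero form is positive at ρ and bounded there by T ρ = 1. Balancing leaves the total -1 for
  -- the other rays, where the form is nonpositive, so a single ray of weight one carries it.
  have hdich : ∀ i, l i = 0 ∨ (l i ρ = 1 ∧ ∃ s ∈ c.support.erase ρ, c s = 1 ∧ l i s = -1 ∧
      ∀ t ∈ c.support.erase ρ, t ≠ s → l i t = 0) := by
    intro i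
    by_cases hi : l i ρ ≤ 0
    · left
      refine key i fun r hr => ?_
      by_cases hrρ : r = ρ
      · rwa [hrρ]
      · exact hneg i r (Finset.mem_erase.2 ⟨hrρ, hr⟩)
    · right
      have h1 : l i ρ = 1 := by
        have := hT.le i ρ
        omega
      have h6 := hc.sum_hom (l i)
      rw [← Finset.add_sum_erase c.support _ hρ, hcρ, h1] at h6
      obtain ⟨s, hs, hs1, hs2⟩ := exists_unique_one (B := c.support.erase ρ)
        (f := fun s => (c s : ℤ) * (-l i s))
        (fun s hs => mul_nonneg (hpos s (Finset.mem_of_mem_erase hs)).le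
          (by have := hneg i s hs; omega))
        (by simp only [mul_neg, Finset.sum_neg_distrib]; push_cast at h6; omega)
      have h7 := eq_one_of_mul_eq_one hs1
      refine ⟨h1, s, hs, h7.1, by omega, fun t ht hts => ?_⟩
      rcases mul_eq_zero.1 (hs2 t ht hts) with h | h
      · have := hpos t (Finset.mem_of_mem_erase ht)
        omega
      · omega
  obtain ⟨i₁, hi₁⟩ := hT.attained ρ
  rw [hTρ1] at hi₁
  obtain h | ⟨-, r₁, hr₁, hc₁, hl₁, ho₁⟩ := hdich i₁
  · simp [h] at hi₁
  -- Otherwise every nonzero form has its value -1 at r₁, so it agrees with l i₁ on all rays. Then T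
  -- = max(0, l i₁) is linear near ρ and does not bend there, contrary to c ρ = 1.
  have hi₂ : ∃ i₂, l i₂ ρ = 1 ∧ l i₂ r₁ ≠ -1 := by
    by_contra! hall
    have hsame : ∀ i, l i = 0 ∨ l i = l i₁ := by
      intro i
      obtain h | ⟨h1, s, hs, hcs, hls, hos⟩ := hdich i
      · exact Or.inl h
      · right
        have hs1 : s = r₁ := by
          by_contra hne
          have := hos r₁ hr₁ (Ne.symm hne)
          have := hall i h1
          omega
        subst hs1
        refine hext _ _ fun r hr => ?_
        by_cases hrρ : r = ρ
        · rw [hrρ, h1, ← hi₁]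
        · by_cases hrs : r = s
          · rw [hrs, hls, hl₁]
          · rw [hos r (Finset.mem_erase.2 ⟨hrρ, hr⟩) hrs, ho₁ r (Finset.mem_erase.2 ⟨hrρ, hr⟩) hrs]
    have hTmax : ∀ z, 0 ≤ l i₁ z → T z = l i₁ z := by
      intro z hz
      obtain ⟨i, hi⟩ := hT.attained z
      have := hT.le i₁ z
      rcases hsame i with h | h
      · rw [h] at hi
        simp at hi
        omega
      · rw [hi, h]
    obtain ⟨e, he⟩ := hc.prim ρ (by omega)
    obtain ⟨N₀, hN₀⟩ := hc.bend ρ e he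
    -- The summand |l i₁ e| keeps N ρ ± e in the half plane l i₁ ≥ 0, where T is linear.
    have h8 := hN₀ (N₀ + (l i₁ e).natAbs) (by omega)
    rw [hTmax, hTmax, hTmax, hcρ] at h8
    · simp [← hi₁] at h8
      omega
    all_goals simp [← hi₁]
    · positivity
    · linarith [le_abs_self (l i₁ e), Int.natCast_nonneg N₀]
    · linarith [neg_abs_le (l i₁ e), Int.natCast_nonneg N₀]
  obtain ⟨i₂, hi₂, hne⟩ := hi₂
  obtain h | ⟨-, r₂, hr₂, hc₂, hl₂, ho₂⟩ := hdich i₂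
  · simp [h] at hi₂
  have hr12 : r₁ ≠ r₂ := by
    rintro rfl
    exact hne hl₂
  have h12 := ho₁ r₂ hr₂ hr12.symm
  have h21 := ho₂ r₁ hr₁ hr12
  -- The forms -l i₁ and -l i₂ are dual to r₁ and r₂, so they are the coordinates that make r₁, r₂ a
  -- basis.
  have hzero : ∀ z, l i₁ z = 0 → l i₂ z = 0 → z = 0 := fun z hz hz' =>
    haa.eq_zero_of_dual hl₁ h12 h21 hl₂ hz hz'
  have hcoord : ∀ z, z = (-l i₁ z) • r₁ + (-l i₂ z) • r₂ := by
    intro z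
    rw [← sub_eq_zero]
    apply hzero <;> simp [hl₁, hl₂, h12, h21]
  have hsupp : ∀ z ∈ c.support.erase ρ, z = r₁ ∨ z = r₂ := by
    intro z hz
    by_contra! h
    have h0 := hzero z (ho₁ z hz h.1) (ho₂ z hz h.2)
    obtain ⟨e, he⟩ := hc.prim z (Finsupp.mem_support_iff.1 (Finset.mem_of_mem_erase hz))
    exact he.left_ne_zero h0
  refine ⟨ρ, r₁, r₂, ⟨fun x y hxy => ?_, fun z => ⟨_, _, hcoord z⟩⟩, ?_, ⟨hcρ, hc₁, hc₂⟩,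
    fun z hz => ?_, ⟨i₁, hl₁, h12⟩, ⟨i₂, h21, hl₂⟩, fun i => ?_⟩
  · have e1 := congrArg (l i₁) hxy
    have e2 := congrArg (l i₂) hxy
    simp [hl₁, hl₂, h12, h21] at e1 e2
    exact ⟨e1, e2⟩
  · nth_rewrite 1 [hcoord ρ]
    rw [← hi₁, hi₂]
    module
  · by_cases h : z = ρ
    · exact Or.inl h
    · exact Or.inr (hsupp z (Finset.mem_erase.2 ⟨h, Finsupp.mem_support_iff.2 hz⟩))
  · obtain h | ⟨-, s, hs, -, hls, hos⟩ := hdich i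
    · simp [h]
    · rcases hsupp s hs with rfl | rfl
      · exact Or.inr (Or.inl ⟨hls, hos _ hr₂ hr12.symm⟩)
      · exact Or.inr (Or.inr ⟨hos _ hr₁ hr12, hls⟩)

/-- If `T` is `1` at `ρ` and `0` at `-ρ`, the divisor of `T` has a ray off the line of `ρ`. -/
theorem IsDivisor.exists_transversal_ray [Fintype ι] (hT : IsMaxForm l T) (hc : IsDivisor T 1 c)
    {ρ e : M} (hb : IsBasisPair ρ e) (h1 : T ρ = 1) (h0 : T (-ρ) = 0) :
    ∃ y : ℤ, c (e + y • ρ) ≠ 0 := by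
  classical
  have hv : ∀ i, l i ρ = 0 ∨ l i ρ = 1 := by
    intro i
    have := hT.le i ρ
    have h2 := hT.le i (-ρ)
    rw [map_neg] at h2
    omega
  obtain ⟨j₁, hj₁⟩ := hT.attained ρ
  obtain ⟨j₀, hj₀⟩ := hT.zero
  -- All forms have slope 0 or 1 along ρ. Of each slope take the form that is largest at e; on the
  -- line through e these two make up T, and they meet at y = l i₀ e - l i₁ e, where T has its
  -- corner.
  obtain ⟨i₁, hi₁, hm₁⟩ := Finset.exists_max_image (Finset.univ.filter fun i => l i ρ = 1)
    (fun i => l i e) ⟨j₁, by simp [← hj₁, h1]⟩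
  obtain ⟨i₀, hi₀, hm₀⟩ := Finset.exists_max_image (Finset.univ.filter fun i => l i ρ = 0)
    (fun i => l i e) ⟨j₀, by simp [hj₀]⟩
  simp only [Finset.mem_filter, Finset.mem_univ, true_and] at hi₁ hm₁ hi₀ hm₀
  set y := l i₀ e - l i₁ e with hy
  refine ⟨y, ?_⟩
  set r := e + y • ρ with hr
  have hTr : T r = l i₀ e := by
    apply le_antisymm
    · obtain ⟨i, hi⟩ := hT.attained r
      rw [hi, hr]
      rcases hv i with h | h
      · have := hm₀ i h
        simp [h]
        omega
      · have := hm₁ i h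
        simp [h]
        omega
    · have := hT.le i₀ r
      rw [hr] at this
      simpa [hi₀] using this
  have hbr : IsBasisPair r ρ := hb.swap.add_zsmul_left y
  obtain ⟨N, hN⟩ := hc.bend r ρ hbr
  have h2 := hN N le_rfl
  rw [hT.nsmul, hTr] at h2
  have h3 := hT.le i₁ (N • r + ρ)
  have h4 := hT.le i₀ (N • r - ρ)
  have e1 : l i₁ r = l i₀ e := by simp [hr, hi₁, hy]
  have e0 : l i₀ r = l i₀ e := by simp [hr, hi₀]
  rw [map_add, map_nsmul, e1, hi₁, nsmul_eq_mul] at h3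
  rw [map_sub, map_nsmul, e0, hi₀, nsmul_eq_mul] at h4
  -- Weight zero at r would mean T(N r + ρ) + T(N r - ρ) = 2 T(N r), but the forms i₁ and i₀ bound
  -- the left side below by 2 T(N r) + 1.
  intro hc0
  rw [hc0] at h2
  push_cast at h2
  linarith

/-- A nonzero divisor whose rays lie in a line is a line. -/
theorem IsDivisor.neg_mem_of_line {ω : ℕ} (hc : IsDivisor T ω c)
    (hli : ¬ ∃ r s, c r ≠ 0 ∧ c s ≠ 0 ∧ ∀ a b : ℤ, a • r + b • s = 0 → a = 0 ∧ b = 0)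
    {ρ e : M} (hb : IsBasisPair ρ e) (hρ : c ρ ≠ 0) :
    c (-ρ) = c ρ ∧ ∀ z, c z ≠ 0 → z = ρ ∨ z = -ρ := by
  classical
  have hz : ∀ z, c z ≠ 0 → z = ρ ∨ z = -ρ := by
    intro z hz
    obtain ⟨f, hf⟩ := hc.prim z hz
    obtain ⟨a, b, hab⟩ := hb.gen z
    have hb0 : b = 0 := by
      by_contra hb0
      refine hli ⟨ρ, z, hρ, hz, fun p q hpq => ?_⟩
      have h1 := hb.indep (p + q * a) (q * b) (by rw [← hpq, hab]; module)
      have hq : q = 0 := by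
        rcases mul_eq_zero.1 h1.2 with h | h
        · exact h
        · exact absurd h hb0
      subst hq
      simpa using h1.1
    exact hf.eq_or_eq_neg (a := a) (by simpa [hb0] using hab)
  refine ⟨?_, hz⟩
  have hbal := hc.balanced
  rw [Finset.sum_subset (s₂ := {ρ, -ρ}) (fun z h => by
    simpa using hz z (Finsupp.mem_support_iff.1 h)) (fun z _ h => by
    rw [Finsupp.notMem_support_iff.1 h, zero_smul]), Finset.sum_pair hb.ne_neg] at hbal
  have h1 := hb.indep (c ρ - c (-ρ)) 0 (by rw [← hbal]; simp [sub_smul]; abel)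
  omega

theorem line_sum {S : M → ℤ} {ρ e : M} (hb : IsBasisPair ρ e)
    (hneg : c (-ρ) = c ρ) (hz : ∀ z, c z ≠ 0 → z = ρ ∨ z = -ρ) :
    ∑ r ∈ c.support, (c r : ℤ) * S r = c ρ * (S ρ + S (-ρ)) := by
  classical
  rw [Finset.sum_subset (s₂ := {ρ, -ρ}) (fun z h => by
    simpa using hz z (Finsupp.mem_support_iff.1 h)) (fun z _ h => by
    rw [Finsupp.notMem_support_iff.1 h]; simp), Finset.sum_pair hb.ne_neg, hneg, mul_add]

/-- On the line carrying a divisor of self-intersection at most one all forms vanish. -/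
theorem IsDivisor.form_eq_zero_of_line [Fintype ι] (hT : IsMaxForm l T) (hc : IsDivisor T 1 c)
    (hle : ∑ r ∈ c.support, (c r : ℤ) * T r ≤ 1) {ρ e : M} (hb : IsBasisPair ρ e)
    (hρ : c ρ ≠ 0) (hneg : c (-ρ) = c ρ) (hz : ∀ z, c z ≠ 0 → z = ρ ∨ z = -ρ) :
    (∀ i, l i ρ = 0) ∧ (c ρ : ℤ) = T e + T (-e) := by
  have hno : ∀ y : ℤ, c (e + y • ρ) = 0 := by
    intro y
    by_contra h
    rcases hz _ h with h | h
    · have := hb.indep (y - 1) 1 (by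
        rw [sub_smul, one_smul, one_smul, sub_add_eq_add_sub, add_comm, h, sub_self])
      omega
    · have := hb.indep (y + 1) 1 (by
        have h2 : (y + 1) • ρ + (1 : ℤ) • e = (e + y • ρ) + ρ := by module
        rw [h2, h, neg_add_cancel])
      omega
  rw [line_sum hb hneg hz] at hle
  have hp := hT.nonneg ρ
  have hn := hT.nonneg (-ρ)
  have hle1 : T ρ + T (-ρ) ≤ 1 := by
    have : (1 : ℤ) ≤ c ρ := by omega
    nlinarith
  -- The values 1 and 0 at the two ends of the line would produce a ray e + y ρ off the line.
  have h00 : T ρ = 0 ∧ T (-ρ) = 0 := by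
    by_contra hne
    have : (T ρ = 1 ∧ T (-ρ) = 0) ∨ (T (-ρ) = 1 ∧ T ρ = 0) := by omega
    rcases this with ⟨h1, h0⟩ | ⟨h1, h0⟩
    · obtain ⟨y, hy⟩ := hc.exists_transversal_ray hT hb h1 h0
      exact hy (hno y)
    · obtain ⟨y, hy⟩ := hc.exists_transversal_ray hT hb.neg_left h1 (by rwa [neg_neg])
      exact hy (by simpa using hno (-y))
  have hl : ∀ i, l i ρ = 0 := by
    intro i
    have h1 := hT.le i ρ
    have h2 := hT.le i (-ρ)
    rw [map_neg] at h2
    omega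
  refine ⟨hl, ?_⟩
  obtain ⟨N, hN⟩ := hc.bend ρ e hb
  have h1 := hN N le_rfl
  rw [sub_eq_add_neg (N • ρ), hT.add_invariant hl, hT.add_invariant hl, hT.nsmul, h00.1] at h1
  simpa using h1

end Divisor

end Planar

/-! ### Pairs of divisors with small intersection numbers -/

section Classification

variable {M : Type*} [AddCommGroup M]

/-- The rays of nonzero weight are the `r i`, and their weights are `1`. -/
def HasUnitRays (c : M →₀ ℕ) {q : ℕ} (r : Fin q → M) : Prop :=
  (∀ i, c (r i) = 1) ∧ ∀ z, c z ≠ 0 → ∃ i, z = r i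

/-- All the forms `v i` and `w j` take values in `{-1, 0, 1}` at `r`. -/
def IsSmall {ι κ : Type*} (v : ι → M →+ ℤ) (w : κ → M →+ ℤ) (r : M) : Prop :=
  (∀ i, v i r ∈ ({-1, 0, 1} : Set ℤ)) ∧ ∀ j, w j r ∈ ({-1, 0, 1} : Set ℤ)

theorem mem_small_iff {a : ℤ} : a ∈ ({-1, 0, 1} : Set ℤ) ↔ -1 ≤ a ∧ a ≤ 1 := by
  simp only [Set.mem_insert_iff, Set.mem_singleton_iff]
  omega

variable {ι κ : Type*} {v : ι → M →+ ℤ} {w : κ → M →+ ℤ} {T S : M → ℤ} {c d : M →₀ ℕ}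

/-- The weights `c` are those of a one-dimensional Bergman fan with small rays. -/
def IsSmallTripod (v : ι → M →+ ℤ) (w : κ → M →+ ℤ) (c : M →₀ ℕ) (r : Fin 3 → M) : Prop :=
  IsBasisPair (r 1) (r 2) ∧ r 0 + r 1 + r 2 = 0 ∧ HasUnitRays c r ∧ ∀ i, IsSmall v w (r i)

theorem tripod_sum {r₀ r₁ r₂ : M} (hb : IsBasisPair r₁ r₂) (hsum : r₀ + r₁ + r₂ = 0)
    (h1 : c r₀ = 1 ∧ c r₁ = 1 ∧ c r₂ = 1) (hz : ∀ z, c z ≠ 0 → z = r₀ ∨ z = r₁ ∨ z = r₂)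
    (F : M → ℤ) : ∑ r ∈ c.support, (c r : ℤ) * F r = F r₀ + F r₁ + F r₂ := by
  classical
  have h12 : r₁ ≠ r₂ := by
    intro h
    have := hb.indep 1 (-1) (by rw [h]; module)
    omega
  have h01 : r₀ ≠ r₁ := by
    intro h
    have := hb.indep 2 1 (by rw [← hsum, h]; module)
    omega
  have h02 : r₀ ≠ r₂ := by
    intro h
    have := hb.indep 1 2 (by rw [← hsum, h]; module)
    omega
  rw [Finset.sum_subset (s₂ := {r₀, r₁, r₂}) (fun z h => by
    simpa using hz z (Finsupp.mem_support_iff.1 h)) (fun z _ h => by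
    rw [Finsupp.notMem_support_iff.1 h]; simp),
    Finset.sum_insert (by simp [h01, h02]), Finset.sum_pair h12]
  simp [h1, add_assoc]

/-- If `S · T · M = 1` and the divisor of `T` has three rays, then they are small. -/
theorem tripod_small_of_sum (hS : IsMaxForm v S) {r₀ r₁ r₂ : M} (hsum : r₀ + r₁ + r₂ = 0)
    (h : S r₀ + S r₁ + S r₂ = 1) (i : ι) :
    (-1 ≤ v i r₀ ∧ v i r₀ ≤ 1) ∧ (-1 ≤ v i r₁ ∧ v i r₁ ≤ 1) ∧ (-1 ≤ v i r₂ ∧ v i r₂ ≤ 1) := by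
  -- From above each value is bounded by S ≤ 1. From below it is minus the sum of the other two
  -- values, and that sum is at most 1.
  have e := congrArg (v i) hsum
  simp only [map_add, map_zero] at e
  have := hS.nonneg r₀
  have := hS.nonneg r₁
  have := hS.nonneg r₂
  have := hS.le i r₀
  have := hS.le i r₁
  have := hS.le i r₂
  omega

/-- The classification of pairs of divisors with small intersection numbers in a plane. -/
theorem classification [Fintype ι] [Fintype κ] (hS : IsMaxForm v S) (hT : IsMaxForm w T)
    (hc : IsDivisor S 1 c) (hd : IsDivisor T 1 d)
    (hST : ∑ r ∈ d.support, (d r : ℤ) * S r = 1)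
    (hSS : ∑ r ∈ c.support, (c r : ℤ) * S r ≤ 1) (hTT : ∑ r ∈ d.support, (d r : ℤ) * T r ≤ 1) :
    (∃ ρ₁ ρ₂, IsBasisPair ρ₁ ρ₂ ∧ IsSmall v w ρ₁ ∧ IsSmall v w ρ₂ ∧
      HasUnitRays c ![ρ₁, -ρ₁] ∧ HasUnitRays d ![ρ₂, -ρ₂]) ∨
    ∃ r : Fin 3 → M, IsSmallTripod v w c r ∨ IsSmallTripod v w d r := by
  by_cases hld : ∃ r s, d r ≠ 0 ∧ d s ≠ 0 ∧ ∀ a b : ℤ, a • r + b • s = 0 → a = 0 ∧ b = 0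
  · right
    obtain ⟨r₀, r₁, r₂, hb, hsum, h1, hz, -, -, hl⟩ := hd.exists_three_rays hT hTT hld
    rw [tripod_sum hb hsum h1 hz] at hST
    have hw : ∀ j, w j r₀ = - w j r₁ - w j r₂ := by
      intro j
      have e := congrArg (w j) hsum
      simp only [map_add, map_zero] at e
      omega
    refine ⟨![r₀, r₁, r₂], Or.inr ⟨hb, hsum, ⟨?_, ?_⟩, ?_⟩⟩
    · simp [Fin.forall_fin_succ, h1]
    · intro z hz0
      rcases hz z hz0 with h | h | h
      · exact ⟨0, h⟩
      · exact ⟨1, h⟩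
      · exact ⟨2, h⟩
    · simp only [Fin.forall_fin_succ, IsSmall, mem_small_iff]
      refine ⟨⟨fun i => (tripod_small_of_sum hS hsum hST i).1, fun j => ?_⟩,
        ⟨fun i => (tripod_small_of_sum hS hsum hST i).2.1, fun j => ?_⟩,
        ⟨fun i => (tripod_small_of_sum hS hsum hST i).2.2, fun j => ?_⟩, by simp⟩ <;>
      · have := hl j
        have := hw j
        simp
        omega
  have hne : ∃ ρ, d ρ ≠ 0 := by
    by_contra! h
    rw [Finset.sum_eq_zero (by simp [h])] at hST
    omega
  obtain ⟨ρ, hρ⟩ := hne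
  obtain ⟨e, hb⟩ := hd.prim ρ hρ
  obtain ⟨hneg, hz⟩ := hd.neg_mem_of_line hld hb hρ
  obtain ⟨hw0, hdρ⟩ := hd.form_eq_zero_of_line hT hTT hb hρ hneg hz
  rw [line_sum hb hneg hz] at hST
  obtain ⟨hd1, hS1⟩ := eq_one_of_mul_eq_one hST
  rw [hd1] at hdρ hneg
  have hwe : ∀ j, -1 ≤ w j e ∧ w j e ≤ 1 := by
    intro j
    have h1 := hT.le j e
    have h2 := hT.le j (-e)
    have := hT.nonneg e
    have := hT.nonneg (-e)
    rw [map_neg] at h2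
    push_cast at hdρ
    omega
  have hunit : HasUnitRays d ![ρ, -ρ] := by
    refine ⟨by simp [Fin.forall_fin_succ, hd1, hneg], fun z hz0 => ?_⟩
    rcases hz z hz0 with h | h
    · exact ⟨0, h⟩
    · exact ⟨1, h⟩
  have hSρ : ∀ i, -1 ≤ v i ρ ∧ v i ρ ≤ 1 := by
    intro i
    have h1 := hS.le i ρ
    have h2 := hS.le i (-ρ)
    have := hS.nonneg ρ
    have := hS.nonneg (-ρ)
    rw [map_neg] at h2
    omega
  by_cases hlc : ∃ r s, c r ≠ 0 ∧ c s ≠ 0 ∧ ∀ a b : ℤ, a • r + b • s = 0 → a = 0 ∧ b = 0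
  · right
    obtain ⟨r₀, r₁, r₂, hb', hsum, h1, hz', ⟨i₁, hi₁⟩, ⟨i₂, hi₂⟩, hl⟩ :=
      hc.exists_three_rays hS hSS hlc
    have hv : ∀ i, v i r₀ = - v i r₁ - v i r₂ := by
      intro i
      have e := congrArg (v i) hsum
      simp only [map_add, map_zero] at e
      omega
    have hwsum : ∀ j, w j r₀ = - w j r₁ - w j r₂ := by
      intro j
      have e := congrArg (w j) hsum
      simp only [map_add, map_zero] at e
      omega
    obtain ⟨x, y, hxy⟩ := hb'.gen ρ
    obtain ⟨p, q, hpq⟩ := hb'.gen e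
    obtain ⟨a, b, hr₁⟩ := hb.gen r₁
    obtain ⟨a', b', hr₂⟩ := hb.gen r₂
    -- The forms i₁ and i₂ give -x, -y ≤ S ρ and x, y ≤ S(-ρ), and S ρ + S(-ρ) = 1.
    have hcoef : (-1 ≤ x ∧ x ≤ 1) ∧ (-1 ≤ y ∧ y ≤ 1) ∧ -1 ≤ x - y ∧ x - y ≤ 1 := by
      have e1 : v i₁ ρ = -x := by simp [hxy, hi₁]
      have e2 : v i₂ ρ = -y := by simp [hxy, hi₂]
      have f1 := hS.le i₁ ρ
      have f2 := hS.le i₂ ρ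
      have f3 := hS.le i₁ (-ρ)
      have f4 := hS.le i₂ (-ρ)
      have := hS.nonneg ρ
      have := hS.nonneg (-ρ)
      rw [map_neg] at f3 f4
      omega
    -- In the basis (ρ, e) the vectors r₁ and r₂ have e-coordinates b and b'. Comparing
    -- e-coordinates in ρ = x r₁ + y r₂ gives this equation, and in e = p r₁ + q r₂ the next one.
    have hdet1 : x * b + y * b' = 0 := by
      refine (hb.indep (x * a + y * a' - 1) _ ?_).2
      have h3 : x • r₁ + y • r₂ - ρ = 0 := by rw [← hxy, sub_self]
      rw [← h3, hr₁, hr₂]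
      module
    have hdet2 : p * b + q * b' = 1 := by
      have h3 : p • r₁ + q • r₂ - e = 0 := by rw [← hpq, sub_self]
      have h4 := (hb.indep (p * a + q * a') (p * b + q * b' - 1) (by
        rw [← h3, hr₁, hr₂]; module)).2
      omega
    have hxy0 : x ≠ 0 ∨ y ≠ 0 := by
      by_contra! h
      apply hb.left_ne_zero
      rw [hxy, h.1, h.2]
      simp
    -- All w j vanish at ρ, so at r₁, r₂, r₀ they take the values b, b', -(b + b') times w j e.
    -- These factors have to be bounded by one.
    have hbb : (-1 ≤ b ∧ b ≤ 1) ∧ (-1 ≤ b' ∧ b' ≤ 1) ∧ -1 ≤ b + b' ∧ b + b' ≤ 1 := by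
      have hx : x = -1 ∨ x = 0 ∨ x = 1 := by omega
      have hy : y = -1 ∨ y = 0 ∨ y = 1 := by omega
      -- The bounds leave (x, y) = ±(1, 0), ±(0, 1) or ±(1, 1). In each case `hdet1` gives one of
      -- the alternatives, and `hdet2` then makes the surviving coordinate a unit.
      have hcase : b = 0 ∨ b' = 0 ∨ b = -b' := by
        rcases hx with rfl | rfl | rfl <;> rcases hy with rfl | rfl | rfl <;> omega
      rcases hcase with rfl | rfl | rfl
      · have := Int.eq_one_or_neg_one_of_mul_eq_one (show b' * q = 1 by linarith)
        omega
      · have := Int.eq_one_or_neg_one_of_mul_eq_one (show b * p = 1 by linarith)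
        omega
      · have := Int.eq_one_or_neg_one_of_mul_eq_one (show b' * (q - p) = 1 by linarith)
        omega
    have hmul : ∀ j (t : ℤ), -1 ≤ t ∧ t ≤ 1 → -1 ≤ t * w j e ∧ t * w j e ≤ 1 := by
      intro j t ht
      have h3 := hwe j
      have : t = -1 ∨ t = 0 ∨ t = 1 := by omega
      rcases this with rfl | rfl | rfl <;> omega
    have hw1 : ∀ j, w j r₁ = b * w j e := fun j => by simp [hr₁, hw0 j]
    have hw2 : ∀ j, w j r₂ = b' * w j e := fun j => by simp [hr₂, hw0 j]
    have hw3 : ∀ j, w j r₀ = (-(b + b')) * w j e := fun j => by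
      rw [hwsum, hw1, hw2]; ring
    refine ⟨![r₀, r₁, r₂], Or.inl ⟨hb', hsum, ⟨?_, ?_⟩, ?_⟩⟩
    · simp [Fin.forall_fin_succ, h1]
    · intro z hz0
      rcases hz' z hz0 with h | h | h
      · exact ⟨0, h⟩
      · exact ⟨1, h⟩
      · exact ⟨2, h⟩
    · simp only [Fin.forall_fin_succ, IsSmall, mem_small_iff]
      refine ⟨⟨fun i => ?_, fun j => ?_⟩, ⟨fun i => ?_, fun j => ?_⟩, ⟨fun i => ?_, fun j => ?_⟩,
        by simp⟩
      · have := hl i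
        have := hv i
        simp
        omega
      · simpa [hw3 j] using hmul j (-(b + b')) (by omega)
      · have := hl i
        simp
        omega
      · simpa [hw1 j] using hmul j b hbb.1
      · have := hl i
        simp
        omega
      · simpa [hw2 j] using hmul j b' hbb.2.1
  left
  -- S takes the values 1 and 0 at the two ends of ℝρ, so its divisor has a ray off this line. That
  -- ray complements ρ, and it has the same w-values as e because these forms vanish at ρ.
  have hne : ∃ ρ₁, c ρ₁ ≠ 0 ∧ IsBasisPair ρ₁ ρ ∧ ∀ j, w j ρ₁ = w j e := by
    have : (S ρ = 1 ∧ S (-ρ) = 0) ∨ (S (-ρ) = 1 ∧ S ρ = 0) := by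
      have := hS.nonneg ρ
      have := hS.nonneg (-ρ)
      omega
    rcases this with ⟨h1, h0⟩ | ⟨h1, h0⟩
    · obtain ⟨y, hy⟩ := hc.exists_transversal_ray hS hb h1 h0
      exact ⟨_, hy, hb.swap.add_zsmul_left y, fun j => by simp [hw0]⟩
    · obtain ⟨y, hy⟩ := hc.exists_transversal_ray hS hb.neg_left h1 (by rwa [neg_neg])
      refine ⟨_, hy, ?_, fun j => by simp [hw0]⟩
      rw [smul_neg, ← neg_smul]
      exact hb.swap.add_zsmul_left (-y)
  obtain ⟨ρ₁, hρ₁, hb₁, hwρ₁⟩ := hne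
  obtain ⟨hneg₁, hz₁⟩ := hc.neg_mem_of_line hlc hb₁ hρ₁
  obtain ⟨hv0, hcρ⟩ := hc.form_eq_zero_of_line hS hSS hb₁ hρ₁ hneg₁ hz₁
  have hc1 : c ρ₁ = 1 := by omega
  refine ⟨ρ₁, ρ, hb₁, ?_, ?_, ⟨?_, fun z hz0 => ?_⟩, hunit⟩
  · simp only [IsSmall, mem_small_iff, hv0, hwρ₁]
    exact ⟨fun _ => by norm_num, hwe⟩
  · simp only [IsSmall, mem_small_iff, hw0]
    exact ⟨hSρ, fun _ => by norm_num⟩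
  · simp [Fin.forall_fin_succ, hneg₁, hc1]
  · rcases hz₁ z hz0 with h | h
    · exact ⟨0, h⟩
    · exact ⟨1, h⟩

end Classification

/-! ### Lattice vectors, cones and directions inside a cone -/

section

variable {n : ℕ}

theorem latVec_add (y z : Fin n → ℤ) : latVec (y + z) = latVec y + latVec z := by
  ext i
  simp [latVec]

theorem latVec_sub (y z : Fin n → ℤ) : latVec (y - z) = latVec y - latVec z := by
  ext i
  simp [latVec]

theorem latVec_neg (z : Fin n → ℤ) : latVec (-z) = -latVec z := by
  ext i
  simp [latVec]

theorem latVec_zero : latVec (0 : Fin n → ℤ) = 0 := by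
  ext i
  simp [latVec]

theorem latVec_zsmul (a : ℤ) (z : Fin n → ℤ) : latVec (a • z) = (a : ℝ) • latVec z := by
  ext i
  simp [latVec]

theorem latVec_nsmul (a : ℕ) (z : Fin n → ℤ) : latVec (a • z) = (a : ℝ) • latVec z := by
  ext i
  simp [latVec]

theorem latVec_injective : Function.Injective (latVec : (Fin n → ℤ) → Fin n → ℝ) := by
  intro y z h
  ext i
  have := congrFun h i
  simpa [latVec] using this

theorem latVec_eq_zero {z : Fin n → ℤ} (h : latVec z = 0) : z = 0 :=
  latVec_injective (h.trans latVec_zero.symm)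

namespace Cone

variable {σ τ : Cone n}

theorem mem_linSpan {x : Fin n → ℝ} (hx : x ∈ σ) : x ∈ σ.linSpan := Submodule.subset_span hx

theorem mem_hull_singleton {x y : Fin n → ℝ} :
    y ∈ PointedCone.hull ℝ {x} ↔ ∃ t : ℝ, 0 ≤ t ∧ y = t • x := by
  rw [Submodule.mem_span_singleton]
  constructor
  · rintro ⟨⟨t, ht⟩, rfl⟩
    exact ⟨t, ht, rfl⟩
  · rintro ⟨t, ht, rfl⟩
    exact ⟨⟨t, ht⟩, rfl⟩

theorem self_mem_hull (x : Fin n → ℝ) : x ∈ PointedCone.hull ℝ {x} :=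
  Submodule.subset_span rfl

theorem hull_singleton_le {x : Fin n → ℝ} (h : x ∈ σ) : PointedCone.hull ℝ {x} ≤ σ :=
  Submodule.span_le.2 (Set.singleton_subset_iff.2 h)

theorem linSpan_hull_singleton (x : Fin n → ℝ) :
    linSpan (PointedCone.hull ℝ {x}) = Submodule.span ℝ {x} := by
  apply le_antisymm
  · refine Submodule.span_le.2 fun y hy => ?_
    obtain ⟨t, -, rfl⟩ := mem_hull_singleton.1 hy
    exact Submodule.smul_mem _ _ (Submodule.mem_span_singleton_self x)
  · exact Submodule.span_le.2 (Set.singleton_subset_iff.2 (mem_linSpan (self_mem_hull x)))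

theorem mem_linSpan_hull_singleton {x y : Fin n → ℝ} :
    y ∈ linSpan (PointedCone.hull ℝ {x}) ↔ ∃ t : ℝ, y = t • x := by
  rw [linSpan_hull_singleton, Submodule.mem_span_singleton]
  simp only [eq_comm]

theorem dim_hull_singleton {x : Fin n → ℝ} (hx : x ≠ 0) : dim (PointedCone.hull ℝ {x}) = 1 := by
  rw [dim, linSpan_hull_singleton, finrank_span_singleton hx]

theorem exists_smul_of_dim_one (hd : σ.dim = 1) {x y : Fin n → ℝ} (hx : x ∈ σ.linSpan)
    (hx0 : x ≠ 0) (hy : y ∈ σ.linSpan) : ∃ t : ℝ, y = t • x := by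
  obtain ⟨t, ht⟩ := (finrank_eq_one_iff_of_nonzero' (⟨x, hx⟩ : σ.linSpan)
    (by simpa using hx0)).1 hd ⟨y, hy⟩
  exact ⟨t, by simpa using (congrArg Subtype.val ht).symm⟩

theorem exists_mem_ne_zero (hd : σ.dim ≠ 0) : ∃ x ∈ σ, x ≠ 0 := by
  by_contra! h
  apply hd
  have : σ = ⊥ := by
    rw [eq_bot_iff]
    intro x hx
    simpa using h x hx
  rw [this, dim_bot]

theorem eq_hull_singleton (hd : σ.dim = 1) (hs : σ.IsStronglyConvex) {x : Fin n → ℝ}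
    (hx : x ∈ σ) (hx0 : x ≠ 0) : σ = PointedCone.hull ℝ {x} := by
  apply le_antisymm
  · intro y hy
    obtain ⟨t, rfl⟩ := exists_smul_of_dim_one hd (mem_linSpan hx) hx0 (mem_linSpan hy)
    rw [mem_hull_singleton]
    rcases le_or_gt 0 t with ht | ht
    · exact ⟨t, ht, rfl⟩
    · have : t • x = 0 := by
        refine hs _ hy ?_
        rw [← neg_smul]
        exact PointedCone.smul_mem σ (by linarith) hx
      exact ⟨0, le_rfl, by simpa using this⟩
  · exact hull_singleton_le hx

/-- A rational cone whose lattice points lie in a subspace lies in that subspace. -/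
theorem IsRational.exists_latVec_notMem (hr : σ.IsRational) {Q : Submodule ℝ (Fin n → ℝ)}
    (h : ¬ (σ : Set (Fin n → ℝ)) ⊆ Q) : ∃ z : Fin n → ℤ, latVec z ∈ σ ∧ latVec z ∉ Q := by
  obtain ⟨S, rfl⟩ := hr
  by_contra! hc
  apply h
  have : PointedCone.hull ℝ (latVec '' (S : Set (Fin n → ℤ))) ≤ PointedCone.ofSubmodule Q := by
    refine Submodule.span_le.2 ?_
    rintro _ ⟨z, hz, rfl⟩
    exact hc z (Submodule.subset_span ⟨z, hz, rfl⟩)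
  exact this

/-- The directions into which one can move from `x` inside `σ`. -/
def dirs (σ : Cone n) (x : Fin n → ℝ) : Set (Fin n → ℝ) := {d | ∃ ε : ℝ, 0 < ε ∧ x + ε • d ∈ σ}

variable {x d e : Fin n → ℝ}

theorem dirs_add (hd : d ∈ σ.dirs x) (he : e ∈ σ.dirs x) : d + e ∈ σ.dirs x := by
  obtain ⟨a, ha, hda⟩ := hd
  obtain ⟨b, hb, heb⟩ := he
  -- With this ε, x + ε (d + e) is the convex combination of x + a d and x + b e with weights b / (a
  -- + b) and a / (a + b).
  refine ⟨a * b / (a + b), by positivity, ?_⟩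
  have h := σ.add_mem (PointedCone.smul_mem σ (show 0 ≤ b / (a + b) by positivity) hda)
    (PointedCone.smul_mem σ (show 0 ≤ a / (a + b) by positivity) heb)
  convert h using 1
  have hab : a + b ≠ 0 := by positivity
  ext i
  simp
  field_simp
  ring

theorem dirs_smul (hd : d ∈ σ.dirs x) {t : ℝ} (ht : 0 < t) : t • d ∈ σ.dirs x := by
  obtain ⟨a, ha, hda⟩ := hd
  refine ⟨a / t, by positivity, ?_⟩
  rwa [smul_smul, div_mul_cancel₀ _ ht.ne']

theorem dirs_of_mem (hx : x ∈ σ) (hd : d ∈ σ) : d ∈ σ.dirs x :=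
  ⟨1, one_pos, σ.add_mem hx (by simpa using hd)⟩

theorem neg_self_mem_dirs : -x ∈ σ.dirs x :=
  ⟨1, one_pos, by simp⟩

theorem dirs_smul_self (hx : x ∈ σ) (t : ℝ) : t • x ∈ σ.dirs x := by
  rcases le_or_gt 0 t with ht | ht
  · exact dirs_of_mem hx (PointedCone.smul_mem σ ht hx)
  · have := dirs_smul (neg_self_mem_dirs (σ := σ) (x := x)) (neg_pos.2 ht)
    rwa [smul_neg, neg_smul, neg_neg] at this

theorem mem_of_dirs (hx : x ∈ σ) {ε δ : ℝ} (hδ : 0 ≤ δ) (hδε : δ ≤ ε)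
    (h : x + ε • d ∈ σ) : x + δ • d ∈ σ := by
  rcases eq_or_lt_of_le hδ with rfl | hδ0
  · simpa using hx
  have hε : 0 < ε := hδ0.trans_le hδε
  have h1 := σ.add_mem (PointedCone.smul_mem σ (show 0 ≤ 1 - δ / ε by
    rw [sub_nonneg, div_le_one hε]; exact hδε) hx)
    (PointedCone.smul_mem σ (show 0 ≤ δ / ε by positivity) h)
  convert h1 using 1
  ext i
  simp
  field_simp
  ring

/-- For N ≥ 1/ε one has N x + d = N (x + d/N). This turns directions at x into the large multiples
of x by which the bend of a function is expressed. -/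
theorem smul_add_mem_of_dirs (hx : x ∈ σ) (h : d ∈ σ.dirs x) :
    ∃ N₀ : ℕ, ∀ N ≥ N₀, (N : ℝ) • x + d ∈ σ := by
  obtain ⟨ε, hε, h⟩ := h
  obtain ⟨N₀, hN₀⟩ := exists_nat_gt (1 / ε)
  refine ⟨N₀, fun N hN => ?_⟩
  have hN' : 1 / ε < N := hN₀.trans_le (by exact_mod_cast hN)
  have hN0 : (0 : ℝ) < N := lt_trans (by positivity) hN'
  have h1 := mem_of_dirs hx (δ := 1 / N) (by positivity)
    ((div_le_iff₀ hN0).2 (by rw [div_lt_iff₀ hε] at hN'; linarith)) h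
  have h2 := PointedCone.smul_mem σ hN0.le h1
  convert h2 using 1
  rw [smul_add, smul_smul, mul_one_div_cancel hN0.ne', one_smul]

/-- The smallest face of `σ` containing `x`. -/
def minFace (σ : Cone n) (x : Fin n → ℝ) (hx : x ∈ σ) : Cone n where
  carrier := {y | y ∈ σ ∧ -y ∈ σ.dirs x}
  add_mem' := by
    rintro a b ⟨ha, ha'⟩ ⟨hb, hb'⟩
    refine ⟨σ.add_mem ha hb, ?_⟩
    rw [neg_add]
    exact dirs_add ha' hb'
  zero_mem' := ⟨σ.zero_mem, 1, one_pos, by simpa using hx⟩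
  smul_mem' := by
    rintro ⟨t, ht⟩ y ⟨hy, hy'⟩
    refine ⟨PointedCone.smul_mem σ (r := t) ht hy, ?_⟩
    have ht' : (0 : ℝ) ≤ t := ht
    rcases eq_or_lt_of_le ht' with h0 | ht0
    · subst h0
      refine ⟨1, one_pos, ?_⟩
      have : (⟨0, ht⟩ : {c : ℝ // 0 ≤ c}) • y = 0 := by
        change (0 : ℝ) • y = 0
        simp
      rw [this]
      simpa using hx
    · have := dirs_smul hy' ht0
      rwa [smul_neg] at this

theorem self_mem_minFace (hx : x ∈ σ) : x ∈ minFace σ x hx := ⟨hx, neg_self_mem_dirs⟩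

theorem minFace_isFaceOf (hx : x ∈ σ) : (minFace σ x hx).IsFaceOf σ where
  le _ hy := hy.1
  mem_of_smul_add_mem := by
    rintro y z a hy hz ha ⟨-, ε, hε, h⟩
    refine ⟨hy, ε * a, by positivity, ?_⟩
    have h1 := σ.add_mem h (PointedCone.smul_mem σ hε.le hz)
    convert h1 using 1
    module

end Cone

/-! ### Planes and two coordinates that determine their points -/

section Chart

variable {P : Submodule ℝ (Fin n → ℝ)} {i j : Fin n}

/-- The `2 × 2` minor of `x` and `y` with rows `i` and `j`, as a linear form in `y`. -/
def minor (i j : Fin n) (x : Fin n → ℝ) : (Fin n → ℝ) →ₗ[ℝ] ℝ :=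
  x i • LinearMap.proj j - x j • LinearMap.proj i

theorem minor_apply (x y : Fin n → ℝ) : minor i j x y = x i * y j - x j * y i := rfl

theorem minor_self (x : Fin n → ℝ) : minor i j x x = 0 := by
  rw [minor_apply]
  ring

theorem minor_swap (x y : Fin n → ℝ) : minor i j x y = -minor i j y x := by
  rw [minor_apply, minor_apply]
  ring

/-- The coordinates `i` and `j` are coordinates on the plane `P`. -/
structure IsChart (P : Submodule ℝ (Fin n → ℝ)) (i j : Fin n) : Prop where
  finrank : Module.finrank ℝ P = 2
  inj : ∀ z ∈ P, z i = 0 → z j = 0 → z = 0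

/-- A basis of P has a nonzero 2 × 2 minor; its rows are the required coordinates. -/
theorem exists_isChart (hP : Module.finrank ℝ P = 2) : ∃ i j, IsChart P i j := by
  have b := Module.finBasisOfFinrankEq ℝ P hP
  have hli := b.linearIndependent
  have hx0 : (b 0 : Fin n → ℝ) ≠ 0 := fun h => b.ne_zero 0 (Subtype.ext h)
  obtain ⟨i, hi⟩ := Function.ne_iff.1 hx0
  simp only [Pi.zero_apply] at hi
  have : ∃ j, minor i j (b 0) (b 1) ≠ 0 := by
    by_contra! h
    have h1 : ((b 1 : P) : Fin n → ℝ) = ((b 1 : Fin n → ℝ) i / (b 0 : Fin n → ℝ) i) •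
        (b 0 : Fin n → ℝ) := by
      ext j
      have := h j
      rw [minor_apply] at this
      simp only [Pi.smul_apply, smul_eq_mul]
      field_simp
      linarith
    have h2 := Fintype.linearIndependent_iff.1 hli
      ![(b 1 : Fin n → ℝ) i / (b 0 : Fin n → ℝ) i, -1] (by
        rw [Fin.sum_univ_two]
        apply Subtype.ext
        simp only [Matrix.cons_val_zero, Matrix.cons_val_one, Submodule.coe_add,
          Submodule.coe_smul, ZeroMemClass.coe_zero]
        rw [← h1]
        simp) 1
    simp at h2
  obtain ⟨j, hj⟩ := this
  refine ⟨i, j, hP, fun z hz hzi hzj => ?_⟩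
  have hrep := b.sum_repr ⟨z, hz⟩
  rw [Fin.sum_univ_two] at hrep
  have hz' : z = b.repr ⟨z, hz⟩ 0 • (b 0 : Fin n → ℝ) + b.repr ⟨z, hz⟩ 1 • (b 1 : Fin n → ℝ) := by
    simpa using (congrArg Subtype.val hrep).symm
  generalize b.repr ⟨z, hz⟩ 0 = s at hz'
  generalize b.repr ⟨z, hz⟩ 1 = t at hz'
  have e1 := congrFun hz' i
  have e2 := congrFun hz' j
  simp only [Pi.add_apply, Pi.smul_apply, smul_eq_mul, hzi, hzj] at e1 e2
  rw [minor_apply] at hj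
  have hs : s = 0 := by
    apply mul_left_cancel₀ hj
    linear_combination (b 1 : Fin n → ℝ) i * e2 - (b 1 : Fin n → ℝ) j * e1
  have ht : t = 0 := by
    apply mul_left_cancel₀ hj
    linear_combination (b 0 : Fin n → ℝ) j * e1 - (b 0 : Fin n → ℝ) i * e2
  rw [hz', hs, ht]
  simp

namespace IsChart

variable (hP : IsChart P i j) {x y z : Fin n → ℝ}

include hP

/-- In the coordinates i and j this is a polynomial identity, and a point of P is determined by
these two coordinates. -/
theorem plucker (hx : x ∈ P) (hy : y ∈ P) (hz : z ∈ P) :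
    minor i j x y • z = minor i j z y • x + minor i j x z • y := by
  rw [← sub_eq_zero]
  apply hP.inj
  · exact P.sub_mem (P.smul_mem _ hz) (P.add_mem (P.smul_mem _ hx) (P.smul_mem _ hy))
  · simp [minor_apply]
    ring
  · simp [minor_apply]
    ring

theorem exists_coord (hx : x ∈ P) (hy : y ∈ P) (hxy : minor i j x y ≠ 0) (hz : z ∈ P) :
    z = (minor i j z y / minor i j x y) • x + (minor i j x z / minor i j x y) • y := by
  have := hP.plucker hx hy hz
  rw [div_eq_inv_mul, div_eq_inv_mul, mul_smul, mul_smul, ← smul_add, ← this,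
    inv_smul_smul₀ hxy]

theorem exists_smul (hx : x ∈ P) (hy : y ∈ P) (hx0 : x ≠ 0) (hxy : minor i j x y = 0) :
    ∃ t : ℝ, y = t • x := by
  rw [minor_apply] at hxy
  have : x i ≠ 0 ∨ x j ≠ 0 := by
    by_contra! h
    exact hx0 (hP.inj x hx h.1 h.2)
  rcases this with h | h
  · refine ⟨y i / x i, ?_⟩
    rw [← sub_eq_zero]
    apply hP.inj _ (P.sub_mem hy (P.smul_mem _ hx)) <;> simp <;> field_simp <;> linarith
  · refine ⟨y j / x j, ?_⟩
    rw [← sub_eq_zero]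
    apply hP.inj _ (P.sub_mem hy (P.smul_mem _ hx)) <;> simp <;> field_simp <;> linarith

theorem exists_minor_ne_zero (hx : x ∈ P) (hx0 : x ≠ 0) : ∃ y ∈ P, minor i j x y ≠ 0 := by
  by_contra! h
  have hle : P ≤ Submodule.span ℝ {x} := by
    intro y hy
    obtain ⟨t, rfl⟩ := hP.exists_smul hx hy hx0 (h y hy)
    exact Submodule.smul_mem _ _ (Submodule.mem_span_singleton_self x)
  have := Submodule.finrank_mono hle
  rw [hP.finrank, finrank_span_singleton hx0] at this
  omega

theorem span_eq (hx : x ∈ P) (hy : y ∈ P) (hxy : minor i j x y ≠ 0) {Q : Submodule ℝ (Fin n → ℝ)}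
    (hxQ : x ∈ Q) (hyQ : y ∈ Q) : P ≤ Q := by
  intro z hz
  rw [hP.exists_coord hx hy hxy hz]
  exact Q.add_mem (Q.smul_mem _ hxQ) (Q.smul_mem _ hyQ)

end IsChart

/-- The cone `σ` lies in `P` and spans it. -/
def Cone.IsFull (σ : Cone n) (P : Submodule ℝ (Fin n → ℝ)) : Prop :=
  (σ : Set (Fin n → ℝ)) ⊆ P ∧ σ.linSpan = P

theorem Cone.isFull_of_dim {σ : Cone n} (hP : Module.finrank ℝ P = 2)
    (hσ : (σ : Set (Fin n → ℝ)) ⊆ P) (hd : σ.dim = 2) : σ.IsFull P :=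
  ⟨hσ, Submodule.eq_of_le_of_finrank_eq (Submodule.span_le.2 hσ) (hd.trans hP.symm)⟩

theorem Cone.IsFull.dim {σ : Cone n} (h : σ.IsFull P) (hP : Module.finrank ℝ P = 2) :
    σ.dim = 2 := by
  rw [Cone.dim, h.2, hP]

theorem Cone.IsFull.exists_minor_ne_zero {σ : Cone n} (h : σ.IsFull P) (hP : IsChart P i j)
    {x : Fin n → ℝ} (hx : x ∈ P) (hx0 : x ≠ 0) : ∃ y ∈ σ, minor i j x y ≠ 0 := by
  by_contra! hc
  obtain ⟨y, hy, hxy⟩ := hP.exists_minor_ne_zero hx hx0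
  have hle : σ.linSpan ≤ LinearMap.ker (minor i j x) := Submodule.span_le.2 fun z hz => by
    simpa using hc z hz
  rw [h.2] at hle
  exact hxy (by simpa using hle hy)

theorem Cone.isFull_of_pair {σ : Cone n} (hP : IsChart P i j) (hσ : (σ : Set (Fin n → ℝ)) ⊆ P)
    {x y : Fin n → ℝ} (hx : x ∈ σ) (hy : y ∈ σ) (hxy : minor i j x y ≠ 0) : σ.IsFull P :=
  ⟨hσ, le_antisymm (Submodule.span_le.2 hσ)
    (hP.span_eq (hσ hx) (hσ hy) hxy (Cone.mem_linSpan hx) (Cone.mem_linSpan hy))⟩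

end Chart

end

/-! ### Carathéodory's theorem in a plane, and fans near a point -/

section

variable {n : ℕ} {P : Submodule ℝ (Fin n → ℝ)} {i j : Fin n}

/-- `x` is a nonnegative combination of two independent elements of `S`. -/
def IsSimplicialComb (i j : Fin n) (S : Set (Fin n → ℝ)) (x : Fin n → ℝ) : Prop :=
  ∃ s ∈ S, ∃ t ∈ S, minor i j s t ≠ 0 ∧ ∃ a b : ℝ, 0 ≤ a ∧ 0 ≤ b ∧ x = a • s + b • t

theorem IsSimplicialComb.smul {S : Set (Fin n → ℝ)} {x : Fin n → ℝ}
    (h : IsSimplicialComb i j S x) {c : ℝ} (hc : 0 ≤ c) : IsSimplicialComb i j S (c • x) := by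
  obtain ⟨s, hs, t, ht, hst, a, b, ha, hb, rfl⟩ := h
  exact ⟨s, hs, t, ht, hst, c * a, c * b, by positivity, by positivity, by module⟩

/-- With u = p s + q t and p < 0, eliminating s gives a s + b t + u = (b - a q / p) t + (1 + a / p)
u. The sign hypotheses make both coefficients nonnegative. -/
theorem IsSimplicialComb.exchange {S : Set (Fin n → ℝ)} {s t : Fin n → ℝ}
    (ht : t ∈ S) (hst : minor i j s t ≠ 0) {a b p q : ℝ}
    (hu : p • s + q • t ∈ S) (hp : p < 0) (hap : a + p < 0) (hle : b * p - a * q ≤ 0) :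
    IsSimplicialComb i j S (a • s + b • t + (p • s + q • t)) := by
  have hp0 := hp.ne
  refine ⟨t, ht, _, hu, ?_, b + (-a / p) * q, 1 - -a / p, ?_, ?_, ?_⟩
  · rw [map_add, map_smul, map_smul, minor_self, minor_swap t s]
    simp only [smul_eq_mul, mul_zero, add_zero, mul_neg, ne_eq, neg_eq_zero, mul_eq_zero, not_or]
    exact ⟨hp.ne, hst⟩
  · have h : b + (-a / p) * q = (b * p - a * q) / p := by
      field_simp
      ring
    rw [h]
    exact div_nonneg_of_nonpos hle hp.le
  · rw [sub_nonneg, div_le_one_of_neg hp]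
    linarith
  · ext k
    simp
    field_simp
    ring

/-- If a + p and b + q are nonnegative, the pair s, t can be kept. Otherwise u replaces s or t; if
both coefficients become negative, the sign of b p - a q decides which. -/
theorem IsSimplicialComb.add (hP : IsChart P i j) {S : Set (Fin n → ℝ)} (hS : S ⊆ P)
    {x u : Fin n → ℝ} (h : IsSimplicialComb i j S x) (hu : u ∈ S) :
    IsSimplicialComb i j S (x + u) := by
  obtain ⟨s, hs, t, ht, hst, a, b, ha, hb, rfl⟩ := h
  have hu' := hP.exists_coord (hS hs) (hS ht) hst (hS hu)
  generalize minor i j u t / minor i j s t = p at hu'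
  generalize minor i j s u / minor i j s t = q at hu'
  have hts : minor i j t s ≠ 0 := by rwa [minor_swap, neg_ne_zero]
  have swap : b * p - a * q ≥ 0 → q < 0 → b + q < 0 →
      IsSimplicialComb i j S (a • s + b • t + u) := by
    intro h1 h2 h3
    have := IsSimplicialComb.exchange (a := b) (b := a) (p := q) (q := p) hs hts
      (by rwa [add_comm, ← hu']) h2 h3 (by linarith)
    rwa [add_comm (b • t), add_comm (q • t), ← hu'] at this
  rcases lt_or_ge (a + p) 0 with h1 | h1
  · have hp : p < 0 := by linarith
    rcases le_or_gt (b * p - a * q) 0 with h2 | h2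
    · rw [hu'] at hu ⊢
      exact IsSimplicialComb.exchange ht hst hu hp h1 h2
    · have hq : q < 0 := by
        by_contra hq
        nlinarith [mul_nonneg ha (not_lt.1 hq), mul_nonpos_of_nonneg_of_nonpos hb hp.le]
      refine swap h2.le hq ?_
      by_contra h3
      nlinarith [mul_pos_of_neg_of_neg hq h1,
        mul_nonneg_of_nonpos_of_nonpos hp.le (sub_nonpos.2 (not_lt.1 h3))]
  · rcases lt_or_ge (b + q) 0 with h2 | h2
    · have hq : q < 0 := by linarith
      refine swap ?_ hq h2
      rcases le_or_gt 0 p with hp | hp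
      · nlinarith [mul_nonneg hb hp, mul_nonneg ha (neg_nonneg.2 hq.le)]
      · nlinarith [mul_pos_of_neg_of_neg hp h2, mul_nonneg (neg_nonneg.2 hq.le) h1]
    · refine ⟨s, hs, t, ht, hst, a + p, b + q, h1, h2, ?_⟩
      rw [hu']
      module

/-- Carathéodory's theorem for cones in a plane. -/
theorem exists_simplicial (hP : IsChart P i j) {S : Set (Fin n → ℝ)} (hS : S ⊆ P)
    (hfull : ∃ s ∈ S, ∃ t ∈ S, minor i j s t ≠ 0) {x : Fin n → ℝ}
    (hx : x ∈ PointedCone.hull ℝ S) :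
    ∃ s ∈ S, ∃ t ∈ S, 0 < minor i j s t ∧ ∃ a b : ℝ, 0 ≤ a ∧ 0 ≤ b ∧ x = a • s + b • t := by
  -- The induction needs a combination to add to, so it proves the passage from any y to y + x. The
  -- claim is the case y = 0.
  have key : ∀ y, IsSimplicialComb i j S y → IsSimplicialComb i j S (y + x) := by
    induction hx using Submodule.span_induction with
    | mem u hu => exact fun y hy => hy.add hP hS hu
    | zero => simp
    | add u v _ _ hu hv =>
      intro y hy
      rw [← add_assoc]
      exact hv _ (hu _ hy)
    | smul c u _ hu =>
      intro y hy
      obtain ⟨c, hc⟩ := c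
      have hc' : (0 : ℝ) ≤ c := hc
      change IsSimplicialComb i j S (y + c • u)
      rcases eq_or_lt_of_le hc' with h0 | h0
      · simpa [← h0] using hy
      · have := (hu _ (hy.smul (inv_nonneg.2 hc'))).smul hc'
        rwa [smul_add, smul_inv_smul₀ h0.ne'] at this
  obtain ⟨s, hs, t, ht, hst⟩ := hfull
  obtain ⟨s, hs, t, ht, hst, a, b, ha, hb, hx⟩ := key 0 ⟨s, hs, t, ht, hst, 0, 0, by simp⟩
  rw [zero_add] at hx
  rcases lt_or_gt_of_ne hst with h | h
  · exact ⟨t, ht, s, hs, by rw [minor_swap]; linarith, b, a, hb, ha, by rw [hx, add_comm]⟩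
  · exact ⟨s, hs, t, ht, h, a, b, ha, hb, hx⟩

theorem exists_minor_ne_zero_of_span (hP : IsChart P i j) {S : Set (Fin n → ℝ)}
    (hS : P ≤ Submodule.span ℝ S) (hSP : S ⊆ P) : ∃ s ∈ S, ∃ t ∈ S, minor i j s t ≠ 0 := by
  by_contra! h
  have h0 : ∀ s ∈ S, s = 0 := by
    intro s hs
    by_contra hs0
    obtain ⟨y, hy, hsy⟩ := hP.exists_minor_ne_zero (hSP hs) hs0
    have : Submodule.span ℝ S ≤ LinearMap.ker (minor i j s) :=
      Submodule.span_le.2 fun t ht => by simpa using h s hs t ht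
    exact hsy (by simpa using this (hS hy))
  have h1 : Submodule.span ℝ S = ⊥ := by rwa [Submodule.span_eq_bot]
  rw [h1] at hS
  have := Submodule.finrank_mono hS
  rw [hP.finrank, finrank_bot] at this
  omega

theorem IsChart.mem_cone (hP : IsChart P i j) {σ : Cone n} {s t z : Fin n → ℝ} (hs : s ∈ σ)
    (ht : t ∈ σ) (hsP : s ∈ P) (htP : t ∈ P) (hst : 0 < minor i j s t) (hz : z ∈ P)
    (h1 : 0 ≤ minor i j s z) (h2 : 0 ≤ minor i j z t) : z ∈ σ := by
  rw [hP.exists_coord hsP htP hst.ne' hz]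
  exact σ.add_mem (PointedCone.smul_mem σ (by positivity) hs)
    (PointedCone.smul_mem σ (by positivity) ht)

namespace Cone

variable {σ : Cone n}

/-- Generators of a full rational cone in a plane. -/
theorem IsFull.exists_generators (hσ : σ.IsFull P) (hr : σ.IsRational) (hP : IsChart P i j) :
    ∃ S : Finset (Fin n → ℤ), (∀ s ∈ S, latVec s ∈ σ) ∧
      ∀ x ∈ σ, ∃ s ∈ S, ∃ t ∈ S, 0 < minor i j (latVec s) (latVec t) ∧
        0 ≤ minor i j (latVec s) x ∧ 0 ≤ minor i j x (latVec t) := by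
  obtain ⟨S, rfl⟩ := hr
  have hSσ : ∀ s ∈ S, latVec s ∈ PointedCone.hull ℝ (latVec '' (S : Set (Fin n → ℤ))) :=
    fun s hs => Submodule.subset_span ⟨s, hs, rfl⟩
  have hSP : latVec '' (S : Set (Fin n → ℤ)) ⊆ P := by
    rintro _ ⟨s, hs, rfl⟩
    exact hσ.1 (hSσ s hs)
  refine ⟨S, hSσ, fun x hx => ?_⟩
  have hspan : P ≤ Submodule.span ℝ (latVec '' (S : Set (Fin n → ℤ))) := by
    conv_lhs => rw [← hσ.2]
    exact Submodule.span_le.2 fun _ h => PointedCone.hull_le_span ℝ _ h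
  obtain ⟨_, ⟨s, hs, rfl⟩, _, ⟨t, ht, rfl⟩, hst, a, b, ha, hb, rfl⟩ :=
    exists_simplicial hP hSP (exists_minor_ne_zero_of_span hP hspan hSP) hx
  refine ⟨s, hs, t, ht, hst, ?_, ?_⟩
  · rw [map_add, map_smul, map_smul, minor_self, smul_zero, zero_add]
    exact mul_nonneg hb hst.le
  · rw [minor_swap, map_add, map_smul, map_smul, minor_self, minor_swap (latVec t)]
    simp
    positivity

/-- By `exists_generators` the cone is a finite union of simplicial cones spanned by pairs of
generators, each cut out of P by two weak inequalities. -/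
theorem IsFull.isClosed (hσ : σ.IsFull P) (hr : σ.IsRational) (hP : IsChart P i j) :
    IsClosed (σ : Set (Fin n → ℝ)) := by
  classical
  obtain ⟨S, hS, hS'⟩ := hσ.exists_generators hr hP
  have : (σ : Set (Fin n → ℝ)) = ⋃ p ∈ (S ×ˢ S).filter
      (fun p => 0 < minor i j (latVec p.1) (latVec p.2)),
      ((P : Set (Fin n → ℝ)) ∩ {x | 0 ≤ minor i j (latVec p.1) x} ∩
        {x | minor i j (latVec p.2) x ≤ 0}) := by
    ext x
    simp only [Set.mem_iUnion, Finset.mem_filter, Finset.mem_product, Set.mem_inter_iff,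
      Set.mem_ofPred_eq, SetLike.mem_coe, exists_prop, Prod.exists]
    constructor
    · intro hx
      obtain ⟨s, hs, t, ht, h1, h2, h3⟩ := hS' x hx
      rw [minor_swap] at h3
      exact ⟨s, t, ⟨⟨hs, ht⟩, h1⟩, ⟨hσ.1 hx, h2⟩, by linarith⟩
    · rintro ⟨s, t, ⟨⟨hs, ht⟩, h1⟩, ⟨hx, h2⟩, h3⟩
      refine hP.mem_cone (hS s hs) (hS t ht) (hσ.1 (hS s hs)) (hσ.1 (hS t ht)) h1 hx h2 ?_
      rw [minor_swap]
      linarith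
  rw [this]
  refine isClosed_biUnion_finset fun p _ => ?_
  have hc : ∀ x : Fin n → ℝ, Continuous (minor i j x) := fun x =>
    LinearMap.continuous_of_finiteDimensional _
  exact ((Submodule.closed_of_finiteDimensional P).inter
    (isClosed_le continuous_const (hc _))).inter (isClosed_le (hc _) continuous_const)

/-- If one can move from `x` inside `σ` in all directions of `P`. -/
def IsInner (σ : Cone n) (P : Submodule ℝ (Fin n → ℝ)) (x : Fin n → ℝ) : Prop :=
  ∀ d ∈ P, d ∈ σ.dirs x

variable {x d : Fin n → ℝ}

theorem isInner_of_dirs (hP : IsChart P i j) {y z : Fin n → ℝ} (hx : x ∈ σ) (hy : y ∈ P)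
    (hz : z ∈ P)
    (hyz : minor i j y z ≠ 0) (h1 : y ∈ σ.dirs x) (h2 : -y ∈ σ.dirs x) (h3 : z ∈ σ.dirs x)
    (h4 : -z ∈ σ.dirs x) : σ.IsInner P x := by
  intro d hd
  have aux : ∀ (t : ℝ) (v : Fin n → ℝ), v ∈ σ.dirs x → -v ∈ σ.dirs x → t • v ∈ σ.dirs x := by
    intro t v hv hv'
    rcases lt_trichotomy t 0 with h | h | h
    · have := dirs_smul hv' (neg_pos.2 h)
      rwa [smul_neg, neg_smul, neg_neg] at this
    · exact ⟨1, one_pos, by simpa [h] using hx⟩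
    · exact dirs_smul hv h
  rw [hP.exists_coord hy hz hyz hd]
  exact dirs_add (aux _ _ h1 h2) (aux _ _ h3 h4)

/-- For z in σ and small ε, x = ε z + (x - ε z) is a sum of two points of σ, so a face through x
contains z. -/
theorem IsInner.le (h : σ.IsInner P x) {τ : Cone n} (hσP : (σ : Set (Fin n → ℝ)) ⊆ P)
    (hτ : τ.IsFaceOf σ) (hx : x ∈ τ) : σ ≤ τ := by
  intro z hz
  obtain ⟨ε, hε, hz'⟩ := h (-z) (P.neg_mem (hσP hz))
  refine hτ.mem_of_smul_add_mem hz hz' hε ?_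
  convert hx using 1
  module

theorem IsInner.mono (h : σ.IsInner P x) {τ : Cone n} (hτ : σ ≤ τ) : τ.IsInner P x := by
  intro d hd
  obtain ⟨ε, hε, hz⟩ := h d hd
  exact ⟨ε, hε, hτ hz⟩

/-- A full cone contains, near each of its points, points on one side of it. -/
theorem IsFull.mem_dirs_or (hP : IsChart P i j) (hσ : σ.IsFull P) (hx : x ∈ σ)
    (hd : d ∈ P) (hxd : minor i j x d ≠ 0) : d ∈ σ.dirs x ∨ -d ∈ σ.dirs x := by
  have hx0 : x ≠ 0 := by
    rintro rfl
    simp [minor_apply] at hxd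
  obtain ⟨z, hz, hxz⟩ := hσ.exists_minor_ne_zero hP (hσ.1 hx) hx0
  have hdc := hP.exists_coord (hσ.1 hx) (hσ.1 hz) hxz hd
  have hne : minor i j x d / minor i j x z ≠ 0 := div_ne_zero hxd hxz
  generalize minor i j d z / minor i j x z = a at hdc
  generalize minor i j x d / minor i j x z = b at hdc hne
  rcases lt_or_gt_of_ne hne with h | h
  · right
    rw [hdc, neg_add, ← neg_smul, ← neg_smul]
    exact dirs_add (dirs_smul_self hx _) (dirs_smul (dirs_of_mem hx hz) (neg_pos.2 h))
  · left
    rw [hdc]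
    exact dirs_add (dirs_smul_self hx _) (dirs_smul (dirs_of_mem hx hz) h)

end Cone

namespace Fan

/-- A point of a full cone of a fan spans a ray of the fan or is an inner point. -/
theorem ray_mem_or_isInner (F : Fan n) (hP : IsChart P i j) {σ : Cone n} (hσ : σ ∈ F.cones)
    (hσP : (σ : Set (Fin n → ℝ)) ⊆ P) {x : Fin n → ℝ} (hx : x ∈ σ) (hx0 : x ≠ 0) :
    PointedCone.hull ℝ {x} ∈ F.cones ∨ σ.IsInner P x := by
  have hface := Cone.minFace_isFaceOf hx
  have hmem := F.face_mem σ hσ _ hface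
  -- The minimal face of x is the ray of x, or it contains a transversal y; in the second case ±x
  -- and ±y are all directions at x.
  by_cases h : ∃ y ∈ Cone.minFace σ x hx, minor i j x y ≠ 0
  · right
    obtain ⟨y, hy, hxy⟩ := h
    exact Cone.isInner_of_dirs hP hx (hσP hx) (hσP hy.1) hxy (Cone.dirs_of_mem hx hx)
      Cone.neg_self_mem_dirs (Cone.dirs_of_mem hx hy.1) hy.2
  · left
    push Not at h
    have hdim : (Cone.minFace σ x hx).dim = 1 := by
      have hle : (Cone.minFace σ x hx).linSpan ≤ Submodule.span ℝ {x} := by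
        refine Submodule.span_le.2 fun y hy => ?_
        obtain ⟨t, rfl⟩ := hP.exists_smul (hσP hx) (hσP hy.1) hx0 (h y hy)
        exact Submodule.smul_mem _ _ (Submodule.mem_span_singleton_self x)
      have hge : Submodule.span ℝ {x} ≤ (Cone.minFace σ x hx).linSpan :=
        Submodule.span_le.2 (Set.singleton_subset_iff.2
          (Cone.mem_linSpan (Cone.self_mem_minFace hx)))
      rw [Cone.dim, le_antisymm hle hge, finrank_span_singleton hx0]
    rwa [← Cone.eq_hull_singleton hdim (F.stronglyConvex _ hmem) (Cone.self_mem_minFace hx) hx0]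

/-- The common face contains the inner point x, so it is all of σ. Then x is inner for τ too, and
the same argument applies there. -/
theorem eq_of_isInner (F : Fan n) {σ τ : Cone n} (hσ : σ ∈ F.cones) (hτ : τ ∈ F.cones)
    (hσP : (σ : Set (Fin n → ℝ)) ⊆ P) (hτP : (τ : Set (Fin n → ℝ)) ⊆ P) {x : Fin n → ℝ}
    (h : σ.IsInner P x) (hxσ : x ∈ σ) (hxτ : x ∈ τ) : σ = τ := by
  obtain ⟨h1, h2⟩ := F.inter_face σ hσ τ hτ
  have hle : σ ≤ τ := (h.le hσP h1 ⟨hxσ, hxτ⟩).trans inf_le_right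
  exact le_antisymm hle (((h.mono hle).le hτP h2 ⟨hxσ, hxτ⟩).trans inf_le_left)

/-- Two full cones of a fan lying on the same side of a point agree. -/
theorem eq_of_dirs (F : Fan n) (hP : IsChart P i j) {σ τ : Cone n} (hσ : σ ∈ F.cones)
    (hτ : τ ∈ F.cones)
    (hσP : (σ : Set (Fin n → ℝ)) ⊆ P) (hτP : (τ : Set (Fin n → ℝ)) ⊆ P) {x d : Fin n → ℝ}
    (hxσ : x ∈ σ) (hxτ : x ∈ τ) (hd : d ∈ P) (hxd : minor i j x d ≠ 0) (h1 : d ∈ σ.dirs x)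
    (h2 : d ∈ τ.dirs x) : σ = τ := by
  obtain ⟨a, ha, h1⟩ := h1
  obtain ⟨b, hb, h2⟩ := h2
  set m := min a b with hm
  have hm0 : 0 < m := lt_min ha hb
  have hyσ := Cone.mem_of_dirs hxσ hm0.le (min_le_left a b) h1
  have hmid : ∀ ρ : Cone n, x ∈ ρ → x + m • d ∈ ρ → x + (m / 2) • d ∈ ρ := fun ρ hρ h =>
    Cone.mem_of_dirs hρ (by positivity) (by linarith) h
  have hyτ := hmid τ hxτ (Cone.mem_of_dirs hxτ hm0.le (min_le_right a b) h2)
  -- The midpoint of x and x + m d is inner for σ: there is room along ±d, and moving by -x/2 leads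
  -- to half of x + m d.
  refine F.eq_of_isInner hσ hτ hσP hτP (x := x + (m / 2) • d) ?_ (hmid σ hxσ hyσ) hyτ
  refine Cone.isInner_of_dirs hP (hmid σ hxσ hyσ) (hσP hxσ) hd hxd
    (Cone.dirs_of_mem (hmid σ hxσ hyσ) hxσ) ⟨1 / 2, by norm_num, ?_⟩
    ⟨m / 2, by positivity, ?_⟩ ⟨m / 2, by positivity, ?_⟩
  · have := PointedCone.smul_mem σ (show (0 : ℝ) ≤ 1 / 2 by norm_num) hyσ
    convert this using 1
    module
  · convert hyσ using 1
    module
  · convert hxσ using 1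
    module

/-- If `x` spans a ray of the fan, then no cone of the fan contains points on both sides of `x`. -/
theorem not_both_dirs (F : Fan n) {σ : Cone n} (hσ : σ ∈ F.cones) {x d : Fin n → ℝ}
    (hray : PointedCone.hull ℝ {x} ∈ F.cones) (hx : x ∈ σ) (hxd : minor i j x d ≠ 0)
    (h1 : d ∈ σ.dirs x) (h2 : -d ∈ σ.dirs x) : False := by
  obtain ⟨h, -⟩ := F.inter_face σ hσ _ hray
  rw [inf_eq_right.2 (Cone.hull_singleton_le hx)] at h
  obtain ⟨a, ha, h1⟩ := h1
  obtain ⟨b, hb, h2⟩ := h2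
  -- The point (a + b) x = b (x + a d) + a (x - b d) is on the ray. The ray is a face of σ, so x + a
  -- d would be on it as well, but d is transversal.
  have h3 := h.mem_of_smul_add_smul_mem_left h1 h2 hb ha (by
    rw [Cone.mem_hull_singleton]
    refine ⟨a + b, by positivity, ?_⟩
    module)
  obtain ⟨t, -, ht⟩ := Cone.mem_hull_singleton.1 h3
  have h4 := congrArg (minor i j x) ht
  rw [map_add, map_smul, map_smul, minor_self] at h4
  simp [ha.ne', hxd] at h4

end Fan

end

/-! ### Fans supported on a plane have constant weight -/

section

variable {n : ℕ} {P : Submodule ℝ (Fin n → ℝ)} {i j : Fin n}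

theorem Fan.mem_star {F : Fan n} {k : ℕ} {σ τ : Cone n} :
    σ ∈ F.star k τ ↔ σ ∈ F.cones ∧ σ.dim = k ∧ τ ≤ σ := by
  simp [Fan.star]

namespace TropicalFan

variable {F : TropicalFan n 2} {σ τ : Cone n} {x d : Fin n → ℝ}

theorem subset_of_support (hF : F.support = P) (hσ : σ ∈ F.facets) :
    (σ : Set (Fin n → ℝ)) ⊆ P := by
  rw [← hF]
  exact Set.subset_biUnion_of_mem (u := fun σ : Cone n => (σ : Set (Fin n → ℝ))) hσ

theorem isFull_of_support (hP : IsChart P i j) (hF : F.support = P) (hσ : σ ∈ F.facets) :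
    σ.IsFull P :=
  Cone.isFull_of_dim hP.finrank (subset_of_support hF hσ) hσ.2.1

theorem exists_facet_of_mem (hF : F.support = P) (hx : x ∈ P) : ∃ σ ∈ F.facets, x ∈ σ := by
  have : x ∈ F.support := by
    rw [hF]
    exact hx
  simpa [TropicalFan.support] using this

theorem finite_facets {k : ℕ} (F : TropicalFan n k) : F.facets.Finite :=
  F.cones.finite_toSet.subset fun _ h => h.1

theorem isClosed_facet (hP : IsChart P i j) (hF : F.support = P) (hσ : σ ∈ F.facets) :
    IsClosed (σ : Set (Fin n → ℝ)) :=
  (isFull_of_support hP hF hσ).isClosed (F.rational _ hσ.1) hP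

/-- By the pigeonhole principle one facet contains infinitely many of the points x + d/(m + 1). It
is closed, so it contains their limit x. -/
theorem exists_facet_of_dir (hP : IsChart P i j) (hF : F.support = P) (hx : x ∈ P) (hd : d ∈ P) :
    ∃ σ ∈ F.facets, x ∈ σ ∧ d ∈ σ.dirs x := by
  have : ∀ m : ℕ, ∃ σ : F.facets, x + (1 / ((m : ℝ) + 1)) • d ∈ σ.1 := by
    intro m
    obtain ⟨σ, hσ, h⟩ := exists_facet_of_mem hF (P.add_mem hx (P.smul_mem (1 / ((m : ℝ) + 1)) hd))
    exact ⟨⟨σ, hσ⟩, h⟩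
  choose f hf using this
  have := F.finite_facets.to_subtype
  obtain ⟨⟨σ, hσ⟩, hinf⟩ := Finite.exists_infinite_fiber f
  rw [Set.infinite_coe_iff] at hinf
  have hfreq : ∃ᶠ m : ℕ in atTop, x + (1 / ((m : ℝ) + 1)) • d ∈ (σ : Set (Fin n → ℝ)) := by
    rw [Nat.frequently_atTop_iff_infinite]
    refine hinf.mono fun m hm => ?_
    have h1 : f m = ⟨σ, hσ⟩ := hm
    have h2 := hf m
    rw [h1] at h2
    exact h2
  have hlim : Tendsto (fun m : ℕ => x + (1 / ((m : ℝ) + 1)) • d) atTop (𝓝 x) := by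
    have := (tendsto_one_div_add_atTop_nhds_zero_nat (𝕜 := ℝ)).smul_const d
    simpa using this.const_add x
  obtain ⟨m, hm⟩ := hfreq.exists
  exact ⟨σ, hσ, (isClosed_facet hP hF hσ).mem_of_frequently_of_tendsto hfreq hlim,
    _, by positivity, hm⟩

/-- The two facets at a ray of a fan supported on a plane. -/
theorem exists_star_pair (hP : IsChart P i j) (hF : F.support = P)
    (hray : PointedCone.hull ℝ {x} ∈ F.cones) (hx : x ∈ P) (hd : d ∈ P)
    (hxd : minor i j x d ≠ 0) :
    ∃ σ ∈ F.facets, ∃ τ ∈ F.facets, σ ≠ τ ∧ x ∈ σ ∧ x ∈ τ ∧ d ∈ σ.dirs x ∧ -d ∈ τ.dirs x ∧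
      ∀ ρ ∈ F.facets, x ∈ ρ → ρ = σ ∨ ρ = τ := by
  obtain ⟨σ, hσ, hxσ, hdσ⟩ := exists_facet_of_dir hP hF hx hd
  obtain ⟨τ, hτ, hxτ, hdτ⟩ := exists_facet_of_dir hP hF hx (P.neg_mem hd)
  have hxd' : minor i j x (-d) ≠ 0 := by rwa [map_neg, neg_ne_zero]
  refine ⟨σ, hσ, τ, hτ, ?_, hxσ, hxτ, hdσ, hdτ, fun ρ hρ hxρ => ?_⟩
  · rintro rfl
    exact F.not_both_dirs hσ.1 hray hxσ hxd hdσ hdτ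
  · have hsub := fun {ρ} (hρ : ρ ∈ F.facets) => subset_of_support hF hρ
    rcases (isFull_of_support hP hF hρ).mem_dirs_or hP hxρ hd hxd with h | h
    · exact Or.inl (F.eq_of_dirs hP hρ.1 hσ.1 (hsub hρ) (hsub hσ) hxρ hxσ hd hxd h hdσ)
    · exact Or.inr (F.eq_of_dirs hP hρ.1 hτ.1 (hsub hρ) (hsub hτ) hxρ hxτ (P.neg_mem hd) hxd'
        h hdτ)

theorem mem_star_ray (hσ : σ ∈ F.facets) (hx : x ∈ σ) :
    σ ∈ F.star 2 (PointedCone.hull ℝ {x}) :=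
  Fan.mem_star.2 ⟨hσ.1, hσ.2.1, Cone.hull_singleton_le hx⟩

/-- The star may contain further cones, possibly outside P. They have weight zero, and `hg` discards
them. -/
theorem sum_star_ray {A : Type*} [AddCommMonoid A] (hσ : σ ∈ F.facets) (hτ : τ ∈ F.facets)
    (hne : σ ≠ τ) (hxσ : x ∈ σ) (hxτ : x ∈ τ)
    (hall : ∀ ρ ∈ F.facets, x ∈ ρ → ρ = σ ∨ ρ = τ) {g : Cone n → A}
    (hg : ∀ ρ, F.weight ρ = 0 → g ρ = 0) :
    ∑ ρ ∈ F.star 2 (PointedCone.hull ℝ {x}), g ρ = g σ + g τ := by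
  classical
  rw [← Finset.sum_pair hne]
  symm
  refine Finset.sum_subset ?_ fun ρ hρ hρ' => ?_
  · intro ρ hρ
    rcases Finset.mem_insert.1 hρ with rfl | h
    · exact mem_star_ray hσ hxσ
    · rw [Finset.mem_singleton.1 h]
      exact mem_star_ray hτ hxτ
  · apply hg
    by_contra hw
    obtain ⟨h1, h2, h3⟩ := Fan.mem_star.1 hρ
    apply hρ'
    simpa using hall ρ ⟨h1, h2, hw⟩ (h3 (Cone.self_mem_hull x))

theorem minor_eq_zero_of_mem_linSpan {y : Fin n → ℝ}
    (hy : y ∈ Cone.linSpan (PointedCone.hull ℝ {x})) : minor i j x y = 0 := by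
  obtain ⟨t, rfl⟩ := Cone.mem_linSpan_hull_singleton.1 hy
  rw [map_smul, minor_self, smul_zero]

/-- u generates the lattice of σ modulo the ray. If u were on the line of x, so would be all lattice
points of σ, and σ would not be full. -/
theorem minor_primitiveNormal_ne_zero (hP : IsChart P i j) (hσ : σ.IsFull P) (hr : σ.IsRational)
    (hx : x ∈ P) (hx0 : x ≠ 0) {u : Fin n → ℤ}
    (hu : IsPrimitiveNormal σ (PointedCone.hull ℝ {x}) u) : minor i j x (latVec u) ≠ 0 := by
  obtain ⟨y, hy, hxy⟩ := hσ.exists_minor_ne_zero hP hx hx0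
  obtain ⟨z, hz, hxz⟩ := hr.exists_latVec_notMem (Q := LinearMap.ker (minor i j x))
    (fun h => hxy (by simpa using h hy))
  obtain ⟨c, hc⟩ := hu.generates z (Cone.mem_linSpan hz)
  have h1 := minor_eq_zero_of_mem_linSpan (i := i) (j := j) hc
  rw [latVec_sub, latVec_zsmul, map_sub, map_smul] at h1
  intro h0
  rw [h0, smul_zero, sub_zero] at h1
  exact hxz (by simpa using h1)

/-- A primitive normal vector points to the side of its facet. -/
theorem primitiveNormal_pos (hP : IsChart P i j) (hF : F.support = P)
    (hray : PointedCone.hull ℝ {x} ∈ F.cones) (hσ : σ ∈ F.facets) (hxσ : x ∈ σ) (hd : d ∈ P)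
    (hxd : minor i j x d ≠ 0) (hdσ : d ∈ σ.dirs x) {u : Fin n → ℤ}
    (hu : IsPrimitiveNormal σ (PointedCone.hull ℝ {x}) u) :
    0 < minor i j x (latVec u) / minor i j x d := by
  have hfull := isFull_of_support hP hF hσ
  have hx := hfull.1 hxσ
  have hx0 : x ≠ 0 := by
    rintro rfl
    simp [minor_apply] at hxd
  have hne := minor_primitiveNormal_ne_zero hP hfull (F.rational _ hσ.1) hx hx0 hu
  by_contra hneg
  have hb : minor i j x (latVec u) / minor i j x d < 0 :=
    lt_of_le_of_ne (not_lt.1 hneg) (div_ne_zero hne hxd)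
  have huP : latVec u ∈ P := by
    rw [← hfull.2]
    exact hu.mem_span
  have hc := hP.exists_coord hx hd hxd huP
  generalize minor i j x (latVec u) / minor i j x d = b at hc hb
  generalize minor i j (latVec u) d / minor i j x d = a at hc
  obtain ⟨t, ht, hut⟩ := hu.pointing
  obtain ⟨s, rfl⟩ := Cone.mem_linSpan_hull_singleton.1 ht
  -- With b < 0 the vector u, corrected by a multiple of x, would make -d a direction of σ as well.
  refine F.not_both_dirs hσ.1 hray hxσ hxd hdσ ?_
  have h1 := Cone.dirs_smul (Cone.dirs_add (Cone.dirs_of_mem hxσ hut)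
    (Cone.dirs_smul_self hxσ (-(a + s)))) (show 0 < -b⁻¹ by simpa using hb)
  convert h1 using 1
  rw [hc, show a • x + b • d + s • x + -(a + s) • x = b • d by module, smul_smul, neg_mul,
    inv_mul_cancel₀ hb.ne, neg_one_smul]

/-- Balancing at a ray: the two facets of a fan supported on a plane have the same weight. -/
theorem weight_eq_of_ray (hP : IsChart P i j) (hF : F.support = P)
    (hray : PointedCone.hull ℝ {x} ∈ F.cones) (hσ : σ ∈ F.facets) (hτ : τ ∈ F.facets)
    (hxσ : x ∈ σ) (hxτ : x ∈ τ) (hx0 : x ≠ 0) : F.weight σ = F.weight τ := by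
  have hx := subset_of_support hF hσ hxσ
  obtain ⟨d, hd, hxd⟩ := hP.exists_minor_ne_zero hx hx0
  obtain ⟨α, hα, β, hβ, hne, hxα, hxβ, hdα, hdβ, hall⟩ := exists_star_pair hP hF hray hx hd hxd
  suffices h : F.weight α = F.weight β by
    rcases hall σ hσ hxσ with rfl | rfl <;> rcases hall τ hτ hxτ with rfl | rfl <;> simp [h]
  obtain ⟨u, hu, hbal⟩ := F.balanced _ hray (by rw [Cone.dim_hull_singleton hx0])
  rw [sum_star_ray hα hβ hne hxα hxβ hall (fun ρ h => by rw [h, zero_smul])] at hbal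
  have huα := hu α (mem_star_ray hα hxα)
  have huβ := hu β (mem_star_ray hβ hxβ)
  have hαf := isFull_of_support hP hF hα
  have hβf := isFull_of_support hP hF hβ
  have hpα := primitiveNormal_pos hP hF hray hα hxα hd hxd hdα huα
  have hpβ := primitiveNormal_pos hP hF hray hβ hxβ (P.neg_mem hd)
    (by rwa [map_neg, neg_ne_zero]) hdβ huβ
  obtain ⟨c, hc⟩ := huα.generates (u β) (by rw [hαf.2, ← hβf.2]; exact huβ.mem_span)
  obtain ⟨c', hc'⟩ := huβ.generates (u α) (by rw [hβf.2, ← hαf.2]; exact huα.mem_span)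
  have e1 := minor_eq_zero_of_mem_linSpan (i := i) (j := j) hc
  have e2 := minor_eq_zero_of_mem_linSpan (i := i) (j := j) hc'
  have e3 := minor_eq_zero_of_mem_linSpan (i := i) (j := j) hbal
  simp only [latVec_sub, latVec_add, latVec_zsmul, latVec_nsmul, map_sub, map_add, map_smul,
    smul_eq_mul] at e1 e2 e3
  rw [map_neg, div_neg] at hpβ
  have hmα : minor i j x (latVec (u α)) ≠ 0 := fun h => by simp [h] at hpα
  -- Modulo the ray, the two normal vectors are the multiples c and c' of each other, so c is a
  -- unit. They point to opposite sides, so c = -1, and balancing compares the weights.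
  have hcc : (c : ℝ) * c' = 1 := by
    apply mul_left_cancel₀ hmα
    linear_combination -e2 - c' * e1
  have hcneg : (c : ℝ) < 0 := by
    have h1 : minor i j x (latVec (u β)) = c * minor i j x (latVec (u α)) := by linarith
    rw [h1, mul_div_assoc] at hpβ
    by_contra h
    have := mul_nonneg (not_lt.1 h) hpα.le
    linarith
  have hc1 : c = -1 := by
    have h1 : c * c' = 1 := by exact_mod_cast hcc
    have h2 : c < 0 := by exact_mod_cast hcneg
    rcases Int.eq_one_or_neg_one_of_mul_eq_one h1 with h | h <;> omega
  subst hc1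
  have : (F.weight α : ℝ) = F.weight β := by
    apply mul_left_cancel₀ hmα
    push_cast at e1
    linear_combination e3 - F.weight β * e1
  exact_mod_cast this

/-- The weights of a fan supported on a plane are constant. -/
theorem weight_eq (hP : IsChart P i j) (hF : F.support = P) (hσ : σ ∈ F.facets)
    (hτ : τ ∈ F.facets) : F.weight σ = F.weight τ := by
  by_contra hne
  -- The connected set P \ {0} is covered by two closed sets: the facets of the same weight as σ,
  -- and the others. They share a nonzero point. It spans a ray, where `weight_eq_of_ray` applies,
  -- or it is inner to a facet, which is then the only facet through it.
  have hrank : 1 < Module.rank ℝ P := Module.lt_rank_of_lt_finrank (by rw [hP.finrank]; norm_num)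
  have hconn := (isConnected_compl_singleton_of_one_lt_rank hrank (0 : P)).isPreconnected
  rw [isPreconnected_closed_iff] at hconn
  have hcl : ∀ p : Cone n → Prop,
      IsClosed {x : P | ∃ ρ ∈ F.facets, p ρ ∧ (x : Fin n → ℝ) ∈ ρ} := by
    intro p
    have : {x : P | ∃ ρ ∈ F.facets, p ρ ∧ (x : Fin n → ℝ) ∈ ρ} =
        ⋃ ρ ∈ {ρ | ρ ∈ F.facets ∧ p ρ}, Subtype.val ⁻¹' (ρ : Set (Fin n → ℝ)) := by
      ext x
      simp [and_assoc]
    rw [this]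
    exact Set.Finite.isClosed_biUnion (F.finite_facets.subset fun ρ h => h.1)
      fun ρ h => (isClosed_facet hP hF h.1).preimage continuous_subtype_val
  have hnonempty : ∀ ρ ∈ F.facets, ∃ x : P, x ∈ ({0}ᶜ : Set P) ∧ (x : Fin n → ℝ) ∈ ρ := by
    intro ρ hρ
    obtain ⟨x, hx, hx0⟩ := Cone.exists_mem_ne_zero (σ := ρ) (by rw [hρ.2.1]; norm_num)
    exact ⟨⟨x, subset_of_support hF hρ hx⟩, by simpa using hx0, hx⟩
  obtain ⟨x, hx0, ⟨α, hα, hwα, hxα⟩, β, hβ, hwβ, hxβ⟩ := hconn _ _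
    (hcl fun ρ => F.weight ρ = F.weight σ) (hcl fun ρ => F.weight ρ ≠ F.weight σ) (by
      intro x _
      obtain ⟨ρ, hρ, hxρ⟩ := exists_facet_of_mem hF x.2
      by_cases h : F.weight ρ = F.weight σ
      · exact Or.inl ⟨ρ, hρ, h, hxρ⟩
      · exact Or.inr ⟨ρ, hρ, h, hxρ⟩) (by
      obtain ⟨x, hx0, hx⟩ := hnonempty σ hσ
      exact ⟨x, hx0, σ, hσ, rfl, hx⟩) (by
      obtain ⟨x, hx0, hx⟩ := hnonempty τ hτ
      exact ⟨x, hx0, τ, hτ, Ne.symm hne, hx⟩)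
  have hx0' : (x : Fin n → ℝ) ≠ 0 := by simpa using hx0
  rcases F.ray_mem_or_isInner hP hα.1 (subset_of_support hF hα) hxα hx0' with h | h
  · exact hwβ ((weight_eq_of_ray hP hF h hβ hα hxβ hxα hx0').trans hwα)
  · have := F.eq_of_isInner hα.1 hβ.1 (subset_of_support hF hα) (subset_of_support hF hβ) h hxα hxβ
    subst this
    exact hwβ hwα

end TropicalFan

end

section

variable {n : ℕ} {P : Submodule ℝ (Fin n → ℝ)} {i j : Fin n}

/-! ### The lattice of a rational plane -/

section Lattice

/-- The lattice points of a linear subspace. -/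
def planeLattice (P : Submodule ℝ (Fin n → ℝ)) : AddSubgroup (Fin n → ℤ) where
  carrier := {z | latVec z ∈ P}
  add_mem' := by
    intro a b ha hb
    simpa [latVec_add] using P.add_mem ha hb
  zero_mem' := by simp [latVec_zero]
  neg_mem' := by
    intro a ha
    simpa [latVec_neg] using ha

theorem mem_planeLattice {z : Fin n → ℤ} : z ∈ planeLattice P ↔ latVec z ∈ P := Iff.rfl

theorem IsPrimitiveVec.ne_zero {r : Fin n → ℤ} (h : IsPrimitiveVec r) : r ≠ 0 := by
  rintro rfl
  simpa using h 0 0 (by simp)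

theorem IsPrimitiveVec.latVec_ne_zero {r : Fin n → ℤ} (h : IsPrimitiveVec r) : latVec r ≠ 0 :=
  fun h0 => h.ne_zero (latVec_eq_zero h0)

/-- A generator of the ideal of the entries divides r, so it is a unit by primitivity. -/
theorem IsPrimitiveVec.exists_bezout {r : Fin n → ℤ} (h : IsPrimitiveVec r) :
    ∃ c : Fin n → ℤ, ∑ k, c k * r k = 1 := by
  obtain ⟨d, hd⟩ := (IsPrincipalIdealRing.principal (Ideal.span (Set.range r))).principal
  rw [← Ideal.span] at hd
  have hdvd : ∀ k, d ∣ r k := fun k => by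
    rw [← Ideal.mem_span_singleton, ← hd]
    exact Ideal.subset_span ⟨k, rfl⟩
  choose z hz using hdvd
  have hu := h d z (funext hz)
  rw [Ideal.span_singleton_eq_top.2 hu] at hd
  have : (1 : ℤ) ∈ Ideal.span (Set.range r) := by rw [hd]; trivial
  exact Ideal.mem_span_range_iff_exists_fun.1 this

/-- Pairing both sides with Bézout coefficients of r exhibits t as an integer. -/
theorem IsPrimitiveVec.exists_zsmul {r z : Fin n → ℤ} (h : IsPrimitiveVec r) {t : ℝ}
    (hz : latVec z = t • latVec r) : ∃ k : ℤ, t = k ∧ z = k • r := by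
  obtain ⟨c, hc⟩ := h.exists_bezout
  have ht : t = ((∑ k, c k * z k : ℤ) : ℝ) := by
    have h1 : ∀ k, (z k : ℝ) = t * r k := fun k => by simpa [latVec] using congrFun hz k
    push_cast
    simp only [h1]
    have h2 : ((∑ k, c k * r k : ℤ) : ℝ) = 1 := by exact_mod_cast hc
    push_cast at h2
    calc t = t * ∑ k, (c k : ℝ) * r k := by rw [h2, mul_one]
      _ = _ := by
        rw [Finset.mul_sum]
        exact Finset.sum_congr rfl fun k _ => by ring
  refine ⟨_, ht, latVec_injective ?_⟩
  rw [hz, latVec_zsmul, ht]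

theorem IsPrimitiveVec.eq_of_pos_smul {r s : Fin n → ℤ} (hr : IsPrimitiveVec r)
    (hs : IsPrimitiveVec s) {t : ℝ} (ht : 0 ≤ t) (h : latVec s = t • latVec r) : s = r := by
  obtain ⟨k, hk, rfl⟩ := hr.exists_zsmul h
  have hu := hs k r rfl
  have h0 : 0 ≤ k := by
    rw [hk] at ht
    exact_mod_cast ht
  rcases Int.isUnit_iff.1 hu with rfl | rfl
  · simp
  · omega

theorem IsPrimitiveVec.hull_injective {r s : Fin n → ℤ} (hr : IsPrimitiveVec r)
    (hs : IsPrimitiveVec s)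
    (h : PointedCone.hull ℝ {latVec r} = PointedCone.hull ℝ {latVec s}) : r = s := by
  obtain ⟨t, ht, h⟩ := Cone.mem_hull_singleton.1 (h ▸ Cone.self_mem_hull (latVec r))
  exact hs.eq_of_pos_smul hr ht h

theorem IsBasisPair.isPrimitiveVec {r e : planeLattice P} (h : IsBasisPair r e) :
    IsPrimitiveVec (r : Fin n → ℤ) := by
  intro d z hz
  have hd : d ≠ 0 := by
    rintro rfl
    rw [zero_smul] at hz
    exact h.left_ne_zero (Subtype.ext hz)
  have hzP : z ∈ planeLattice P := by
    have h1 : latVec (d • z) ∈ P := hz ▸ r.2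
    rw [latVec_zsmul] at h1
    exact (P.smul_mem_iff (by exact_mod_cast hd)).1 h1
  obtain ⟨a, b, hab⟩ := h.gen ⟨z, hzP⟩
  have h1 : r = d • (⟨z, hzP⟩ : planeLattice P) := Subtype.ext hz
  have h2 := h.indep (d * a - 1) (d * b) (by
    have : (d * a - 1) • r + (d * b) • e = d • (a • r + b • e) - r := by module
    rw [this, ← hab, ← h1, sub_self])
  exact Int.isUnit_iff.2 (Int.eq_one_or_neg_one_of_mul_eq_one (show d * a = 1 by omega))

theorem minor_latVec (y z : Fin n → ℤ) :
    minor i j (latVec y) (latVec z) = ((y i * z j - y j * z i : ℤ) : ℝ) := by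
  rw [minor_apply]
  simp [latVec]

/-- The plane `P` is spanned by lattice vectors. -/
def IsRationalPlane (P : Submodule ℝ (Fin n → ℝ)) (i j : Fin n) : Prop :=
  ∃ y z : Fin n → ℤ, latVec y ∈ P ∧ latVec z ∈ P ∧ minor i j (latVec y) (latVec z) ≠ 0

/-- A lattice vector in a rational plane has a complement generating the lattice modulo the line
of that vector. -/
theorem exists_complement (hP : IsChart P i j) (hR : IsRationalPlane P i j) {y : Fin n → ℤ}
    (hy : latVec y ∈ P) (hy0 : latVec y ≠ 0) :
    ∃ e : Fin n → ℤ, latVec e ∈ P ∧ minor i j (latVec y) (latVec e) ≠ 0 ∧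
      ∀ z : Fin n → ℤ, latVec z ∈ P → ∃ c : ℤ, minor i j (latVec y) (latVec (z - c • e)) = 0 := by
  let f : planeLattice P →+ ℤ :=
    { toFun := fun z => y i * z.1 j - y j * z.1 i
      map_zero' := by simp
      map_add' := fun a b => by
        simp
        ring }
  have hf : ∀ z : planeLattice P, minor i j (latVec y) (latVec z.1) = f z := fun z =>
    minor_latVec y z.1
  -- The minors with y form a cyclic subgroup of ℤ. Choosing e over a generator makes every lattice
  -- vector a multiple of e modulo the line of y.
  obtain ⟨g, hg⟩ := Int.subgroup_cyclic f.range
  have hgm : g ∈ f.range := by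
    rw [hg]
    exact AddSubgroup.subset_closure rfl
  obtain ⟨e, he⟩ := hgm
  have hmul : ∀ z, ∃ c : ℤ, f z = c * f e := by
    intro z
    have : f z ∈ f.range := ⟨z, rfl⟩
    rw [hg, AddSubgroup.mem_closure_singleton] at this
    obtain ⟨c, hc⟩ := this
    exact ⟨c, by rw [he, ← hc, smul_eq_mul]⟩
  refine ⟨e, e.2, fun h0 => ?_, fun z hz => ?_⟩
  · have hfe : f e = 0 := by
      rw [hf] at h0
      exact_mod_cast h0
    have hall : ∀ z : planeLattice P, minor i j (latVec y) (latVec z.1) = 0 := fun z => by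
      obtain ⟨c, hc⟩ := hmul z
      rw [hf, hc, hfe]
      simp
    obtain ⟨a, b, ha, hb, hab⟩ := hR
    obtain ⟨s, hs⟩ := hP.exists_smul hy ha hy0 (hall ⟨a, ha⟩)
    obtain ⟨t, ht⟩ := hP.exists_smul hy hb hy0 (hall ⟨b, hb⟩)
    apply hab
    rw [hs, ht, map_smul, minor_swap, map_smul, minor_self]
    simp
  · obtain ⟨c, hc⟩ := hmul ⟨z, hz⟩
    refine ⟨c, ?_⟩
    have h1 := hf ⟨z, hz⟩
    simp only at h1
    rw [latVec_sub, latVec_zsmul, map_sub, map_smul, h1, hf, hc]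
    simp

/-- After subtracting a multiple of the complement e, a lattice vector lies on the line of r, where
primitivity makes it an integer multiple of r. -/
theorem exists_isBasisPair (hP : IsChart P i j) (hR : IsRationalPlane P i j)
    {r : planeLattice P} (hr : IsPrimitiveVec (r : Fin n → ℤ)) : ∃ e, IsBasisPair r e := by
  obtain ⟨e, heP, hre, hgen⟩ := exists_complement hP hR r.2 hr.latVec_ne_zero
  refine ⟨⟨e, heP⟩, fun a b hab => ?_, fun z => ?_⟩
  · have h1 : (a : ℝ) • latVec r.1 + (b : ℝ) • latVec e = 0 := by
      have := congrArg (fun z : planeLattice P => latVec z.1) hab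
      simpa only [AddSubgroup.coe_add, AddSubgroup.coe_zsmul, AddSubgroup.coe_zero, latVec_add,
        latVec_zsmul, latVec_zero] using this
    have h2 := congrArg (minor i j (latVec r.1)) h1
    rw [map_add, map_smul, map_smul, minor_self] at h2
    simp [hre] at h2
    subst h2
    simp [hr.latVec_ne_zero] at h1
    exact ⟨h1, rfl⟩
  · obtain ⟨c, hc⟩ := hgen z z.2
    obtain ⟨t, ht⟩ := hP.exists_smul r.2 ((planeLattice P).sub_mem z.2
      ((planeLattice P).zsmul_mem (show e ∈ planeLattice P from heP) c)) hr.latVec_ne_zero hc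
    obtain ⟨k, -, hk⟩ := hr.exists_zsmul ht
    refine ⟨k, c, Subtype.ext ?_⟩
    simp only [AddSubgroup.coe_add, AddSubgroup.coe_zsmul]
    rw [← hk]
    abel

theorem IsBasisPair.minor_ne_zero (hR : IsRationalPlane P i j)
    {r e : planeLattice P} (h : IsBasisPair r e) :
    minor i j (latVec (r : Fin n → ℤ)) (latVec (e : Fin n → ℤ)) ≠ 0 := by
  obtain ⟨y, z, hy, hz, hyz⟩ := hR
  obtain ⟨a, b, hab⟩ := h.gen ⟨y, hy⟩
  obtain ⟨c, d, hcd⟩ := h.gen ⟨z, hz⟩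
  have hy' : y = a • (r : Fin n → ℤ) + b • (e : Fin n → ℤ) := by
    simpa using congrArg Subtype.val hab
  have hz' : z = c • (r : Fin n → ℤ) + d • (e : Fin n → ℤ) := by
    simpa using congrArg Subtype.val hcd
  intro h0
  apply hyz
  rw [minor_apply] at h0 ⊢
  rw [hy', hz']
  simp only [latVec_add, latVec_zsmul, Pi.add_apply, Pi.smul_apply, smul_eq_mul]
  linear_combination ((a : ℝ) * d - b * c) * h0

theorem TropicalFan.isRationalPlane {F : TropicalFan n 2} (hP : IsChart P i j)
    (hF : F.support = P) : IsRationalPlane P i j := by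
  obtain ⟨σ, hσ, -⟩ := exists_facet_of_mem hF P.zero_mem
  have hfull := isFull_of_support hP hF hσ
  obtain ⟨S, hS, hS'⟩ := hfull.exists_generators (F.rational _ hσ.1) hP
  obtain ⟨s, hs, t, ht, hst, -⟩ := hS' 0 σ.zero_mem
  exact ⟨s, t, hfull.1 (hS s hs), hfull.1 (hS t ht), hst.ne'⟩

end Lattice

/-! ### One-dimensional cycles and the weights of their rays -/

section Rays

theorem mem_linSpan_bot {x : Fin n → ℝ} : x ∈ Cone.linSpan (⊥ : Cone n) ↔ x = 0 := by
  simp [Cone.linSpan]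

namespace IsPrimitiveNormal

variable {σ : Cone n} {u : Fin n → ℤ}

theorem mem_of_bot (hu : IsPrimitiveNormal σ ⊥ u) : latVec u ∈ σ := by
  obtain ⟨t, ht, h⟩ := hu.pointing
  rw [mem_linSpan_bot] at ht
  simpa [ht] using h

theorem exists_zsmul_of_bot (hu : IsPrimitiveNormal σ ⊥ u) {z : Fin n → ℤ}
    (hz : latVec z ∈ σ.linSpan) : ∃ c : ℤ, z = c • u := by
  obtain ⟨c, hc⟩ := hu.generates z hz
  rw [mem_linSpan_bot] at hc
  exact ⟨c, sub_eq_zero.1 (latVec_eq_zero hc)⟩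

theorem ne_zero_of_bot (hu : IsPrimitiveNormal σ ⊥ u) (hr : σ.IsRational) (hd : σ.dim = 1) :
    u ≠ 0 := by
  rintro rfl
  obtain ⟨x, hx, hx0⟩ := Cone.exists_mem_ne_zero (σ := σ) (by omega)
  obtain ⟨z, hz, hz0⟩ := hr.exists_latVec_notMem (Q := ⊥) (fun h => hx0 (by simpa using h hx))
  obtain ⟨c, rfl⟩ := hu.exists_zsmul_of_bot (Cone.mem_linSpan hz)
  simp [latVec_zero] at hz0

theorem isPrimitiveVec_of_bot (hu : IsPrimitiveNormal σ ⊥ u) (hr : σ.IsRational)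
    (hd : σ.dim = 1) : IsPrimitiveVec u := by
  have hu0 := hu.ne_zero_of_bot hr hd
  intro d z hz
  have hd0 : d ≠ 0 := by
    rintro rfl
    simp at hz
    exact hu0 hz
  have hzs : latVec z ∈ σ.linSpan := by
    have h1 := Cone.mem_linSpan hu.mem_of_bot
    rw [hz, latVec_zsmul] at h1
    exact (σ.linSpan.smul_mem_iff (by exact_mod_cast hd0)).1 h1
  obtain ⟨c, rfl⟩ := hu.exists_zsmul_of_bot hzs
  have h1 : (d * c - 1) • u = 0 := by
    rw [sub_smul, mul_smul, ← hz, one_smul, sub_self]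
  have h2 := (smul_eq_zero.1 h1).resolve_right hu0
  exact Int.isUnit_iff.2 (Int.eq_one_or_neg_one_of_mul_eq_one (show d * c = 1 by omega))

theorem eq_hull_of_bot (hu : IsPrimitiveNormal σ ⊥ u) (hr : σ.IsRational) (hd : σ.dim = 1)
    (hs : σ.IsStronglyConvex) : σ = PointedCone.hull ℝ {latVec u} :=
  Cone.eq_hull_singleton hd hs hu.mem_of_bot
    (hu.isPrimitiveVec_of_bot hr hd).latVec_ne_zero

end IsPrimitiveNormal

namespace TropicalFan

open Classical in
/-- The weight of the ray with primitive generator `r`. -/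
noncomputable def rayWeight (X : TropicalFan n 1) (r : Fin n → ℤ) : ℕ :=
  if IsPrimitiveVec r ∧ PointedCone.hull ℝ {latVec r} ∈ X.facets then
    X.weight (PointedCone.hull ℝ {latVec r}) else 0

theorem rayWeight_ne_zero {X : TropicalFan n 1} {r : Fin n → ℤ} (h : X.rayWeight r ≠ 0) :
    IsPrimitiveVec r ∧ PointedCone.hull ℝ {latVec r} ∈ X.facets := by
  by_contra hc
  exact h (if_neg hc)

theorem rayWeight_eq_weight {X : TropicalFan n 1} {r : Fin n → ℤ} (hr : IsPrimitiveVec r)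
    (h : PointedCone.hull ℝ {latVec r} ∈ X.cones) :
    X.rayWeight r = X.weight (PointedCone.hull ℝ {latVec r}) := by
  rw [rayWeight]
  split_ifs with hc
  · rfl
  · by_contra hne
    exact hc ⟨hr, h, Cone.dim_hull_singleton hr.latVec_ne_zero, Ne.symm hne⟩

theorem rayWeight_eq_zero {X : TropicalFan n 1} {r : Fin n → ℤ}
    (h : PointedCone.hull ℝ {latVec r} ∉ X.cones) : X.rayWeight r = 0 := by
  by_contra hne
  exact h (rayWeight_ne_zero hne).2.1

theorem facet_eq_of_mem {X Y : TropicalFan n 1} {σ τ : Cone n} (hσ : σ ∈ X.facets)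
    (hτ : τ ∈ Y.facets) {x : Fin n → ℝ} (hx0 : x ≠ 0) (hxσ : x ∈ σ) (hxτ : x ∈ τ) : σ = τ := by
  rw [Cone.eq_hull_singleton hσ.2.1 (X.stronglyConvex _ hσ.1) hxσ hx0,
    Cone.eq_hull_singleton hτ.2.1 (Y.stronglyConvex _ hτ.1) hxτ hx0]

/-- A ray cannot be subdivided: one-dimensional facets that share a nonzero point coincide. So
refinement affects only rays of weight zero. -/
theorem Refines.facets_eq {Z X : TropicalFan n 1} (h : Z.Refines X) :
    Z.facets = X.facets ∧ ∀ σ ∈ Z.facets, Z.weight σ = X.weight σ := by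
  have h1 : ∀ σ ∈ Z.facets, σ ∈ X.facets ∧ Z.weight σ = X.weight σ := by
    intro σ hσ
    obtain ⟨σ', hσ', hle, hw⟩ := h.2 σ hσ
    obtain ⟨x, hx, hx0⟩ := Cone.exists_mem_ne_zero (σ := σ) (by rw [hσ.2.1]; norm_num)
    rw [facet_eq_of_mem hσ hσ' hx0 hx (hle hx)] at hw ⊢
    exact ⟨hσ', hw⟩
  refine ⟨Set.Subset.antisymm (fun σ hσ => (h1 σ hσ).1) fun σ hσ => ?_, fun σ hσ => (h1 σ hσ).2⟩
  obtain ⟨x, hx, hx0⟩ := Cone.exists_mem_ne_zero (σ := σ) (by rw [hσ.2.1]; norm_num)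
  have hxX : x ∈ X.support := Set.mem_biUnion hσ hx
  rw [← h.1] at hxX
  simp only [support, Set.mem_iUnion] at hxX
  obtain ⟨τ, hτ, hxτ⟩ := hxX
  rwa [facet_eq_of_mem hσ hτ hx0 hx hxτ]

theorem Refines.rayWeight_eq {Z X : TropicalFan n 1} (h : Z.Refines X) :
    Z.rayWeight = X.rayWeight := by
  obtain ⟨h1, h2⟩ := h.facets_eq
  ext r
  rw [rayWeight, rayWeight, ← h1]
  split_ifs with hc
  · exact h2 _ hc.2
  · rfl

theorem finite_rayWeight (X : TropicalFan n 1) : (Function.support X.rayWeight).Finite := by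
  refine Set.Finite.of_finite_image (f := fun r => PointedCone.hull ℝ {latVec r})
    (X.finite_facets.subset ?_) ?_
  · rintro _ ⟨r, hr, rfl⟩
    exact (rayWeight_ne_zero hr).2
  · intro r hr s hs h
    exact (rayWeight_ne_zero hr).1.hull_injective (rayWeight_ne_zero hs).1 h

/-- Modulo ⊥ the primitive normal of a ray is its primitive generator. The right side therefore no
longer depends on the choice of u or on the rays of weight zero. -/
theorem sum_star_bot {X : TropicalFan n 1} {u : Cone n → Fin n → ℤ}
    (hu : ∀ σ ∈ X.star 1 ⊥, IsPrimitiveNormal σ ⊥ (u σ)) {A : Type*} [AddCommMonoid A]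
    (g : (Fin n → ℤ) → A) :
    ∑ σ ∈ X.star 1 ⊥, X.weight σ • g (u σ) =
      ∑ r ∈ X.finite_rayWeight.toFinset, X.rayWeight r • g r := by
  symm
  refine Finset.sum_of_injOn (fun r => PointedCone.hull ℝ {latVec r}) ?_ ?_ ?_ ?_
  · intro r hr s hs h
    simp only [Set.Finite.coe_toFinset, Function.mem_support] at hr hs
    exact (rayWeight_ne_zero hr).1.hull_injective (rayWeight_ne_zero hs).1 h
  · intro r hr
    simp only [Set.Finite.coe_toFinset, Function.mem_support] at hr
    obtain ⟨h1, h2⟩ := rayWeight_ne_zero hr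
    exact Fan.mem_star.2 ⟨h2.1, h2.2.1, bot_le⟩
  · intro σ hσ hnot
    by_cases hw : X.weight σ = 0
    · rw [hw, zero_smul]
    · obtain ⟨h1, h2, -⟩ := Fan.mem_star.1 hσ
      have hn := hu σ hσ
      have hp := hn.isPrimitiveVec_of_bot (X.rational _ h1) h2
      have he := hn.eq_hull_of_bot (X.rational _ h1) h2 (X.stronglyConvex _ h1)
      refine absurd ⟨u σ, ?_, he.symm⟩ hnot
      simp only [Set.Finite.coe_toFinset, Function.mem_support]
      rw [rayWeight_eq_weight hp (by rwa [← he]), ← he]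
      exact hw
  · intro r hr
    simp only [Set.Finite.mem_toFinset, Function.mem_support] at hr
    obtain ⟨h1, h2⟩ := rayWeight_ne_zero hr
    have hn := hu _ (Fan.mem_star.2 ⟨h2.1, h2.2.1, bot_le⟩)
    rw [rayWeight_eq_weight h1 h2.1,
      (hn.isPrimitiveVec_of_bot (X.rational _ h2.1) h2.2.1).hull_injective h1
      (hn.eq_hull_of_bot (X.rational _ h2.1) h2.2.1 (X.stronglyConvex _ h2.1)).symm]

theorem sum_rayWeight (X : TropicalFan n 1) :
    ∑ r ∈ X.finite_rayWeight.toFinset, X.rayWeight r • r = 0 := by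
  obtain ⟨u, hu, hbal⟩ := X.balanced ⊥ X.bot_mem (by rw [Cone.dim_bot])
  rw [mem_linSpan_bot, sum_star_bot hu (fun r => r)] at hbal
  exact latVec_eq_zero hbal

/-- The degree of the product of a one-dimensional cycle with a function. -/
theorem weight_bot_eq {F : TropicalFan n 1} {G : TropicalFan n 0} {S : (Fin n → ℝ) → ℝ}
    (h : IsFanProduct S F G) :
    (G.weight ⊥ : ℝ) = ∑ r ∈ F.finite_rayWeight.toFinset, (F.rayWeight r : ℝ) * S (latVec r) := by
  obtain ⟨-, φ, hφ, hw⟩ := h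
  obtain ⟨u, hu, hw⟩ := hw ⊥ F.bot_mem Cone.dim_bot
  -- `IsFanProduct` indexes the star by 0 + 1, which is 1 by definition.
  replace hu : ∀ σ ∈ F.star 1 ⊥, IsPrimitiveNormal σ ⊥ (u σ) := hu
  replace hw : (G.weight ⊥ : ℝ) = ∑ σ ∈ F.star 1 ⊥, φ σ (latVec (F.weight σ • u σ)) -
    φ ⊥ (latVec (∑ σ ∈ F.star 1 ⊥, F.weight σ • u σ)) := hw
  -- Balancing at the origin kills the correction term.
  rw [hw, sum_star_bot hu (fun r => r), sum_rayWeight, latVec_zero, map_zero, sub_zero]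
  simp only [← nsmul_eq_mul]
  rw [← sum_star_bot hu]
  refine Finset.sum_congr rfl fun σ hσ => ?_
  rw [latVec_nsmul, map_smul, hφ σ (Fan.mem_star.1 hσ).1 _ (hu σ hσ).mem_of_bot, nsmul_eq_mul,
    smul_eq_mul]

end TropicalFan

/-- The weights of the rays of a one-dimensional cycle, indexed by primitive generators. -/
noncomputable def Cycle.rayWeight (C : Cycle n 1) : (Fin n → ℤ) → ℕ :=
  Quot.lift TropicalFan.rayWeight (by
    rintro X Y ⟨Z, hX, hY⟩
    exact hX.rayWeight_eq.symm.trans hY.rayWeight_eq) C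

end Rays

end

/-! ### The product of a function with a weighted plane -/

section

variable {n : ℕ} {P : Submodule ℝ (Fin n → ℝ)} {i j : Fin n}

theorem IsBasisPair.neg_right {M : Type*} [AddCommGroup M] {r e : M} (h : IsBasisPair r e) :
    IsBasisPair r (-e) :=
  h.swap.neg_left.swap

namespace TropicalFan

variable {F : TropicalFan n 2} {G : TropicalFan n 1} {T : (Fin n → ℝ) → ℝ}

/-- The primitive normal vectors at a ray in terms of a lattice basis. -/
theorem primitiveNormal_eq (hP : IsChart P i j) (hF : F.support = P) {r e : planeLattice P}
    (hre : IsBasisPair r e) (hray : PointedCone.hull ℝ {latVec (r : Fin n → ℤ)} ∈ F.cones)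
    {σ : Cone n} (hσ : σ ∈ F.facets) (hrσ : latVec (r : Fin n → ℤ) ∈ σ)
    (he : latVec (e : Fin n → ℤ) ∈ σ.dirs (latVec (r : Fin n → ℤ))) {u : Fin n → ℤ}
    (hu : IsPrimitiveNormal σ (PointedCone.hull ℝ {latVec (r : Fin n → ℤ)}) u) :
    ∃ a : ℤ, u = a • (r : Fin n → ℤ) + e := by
  have hm := hre.minor_ne_zero (isRationalPlane hP hF)
  have hfull := isFull_of_support hP hF hσ
  have hpos := primitiveNormal_pos hP hF hray hσ hrσ e.2 hm he hu
  have huP : u ∈ planeLattice P := by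
    have := hu.mem_span
    rwa [hfull.2] at this
  obtain ⟨a, b, hab⟩ := hre.gen ⟨u, huP⟩
  have hab' : u = a • (r : Fin n → ℤ) + b • (e : Fin n → ℤ) := by
    simpa using congrArg Subtype.val hab
  obtain ⟨c, hc⟩ := hu.generates e (by rw [hfull.2]; exact e.2)
  have h1 := minor_eq_zero_of_mem_linSpan (i := i) (j := j) hc
  have h2 : minor i j (latVec (r : Fin n → ℤ)) (latVec u) =
      b * minor i j (latVec (r : Fin n → ℤ)) (latVec (e : Fin n → ℤ)) := by
    rw [hab', latVec_add, latVec_zsmul, latVec_zsmul, map_add, map_smul, map_smul, minor_self]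
    simp
  rw [h2, mul_div_assoc, div_self hm, mul_one] at hpos
  rw [latVec_sub, latVec_zsmul, map_sub, map_smul, h2, smul_eq_mul, ← mul_assoc,
    ← one_sub_mul] at h1
  have h3 := (mul_eq_zero.1 h1).resolve_right hm
  have h4 : b * c = 1 := by
    have : ((b * c : ℤ) : ℝ) = 1 := by
      push_cast
      linarith
    exact_mod_cast this
  have h5 : 0 < b := by exact_mod_cast hpos
  have h6 : b = 1 := by
    rcases Int.eq_one_or_neg_one_of_mul_eq_one h4 with h | h <;> omega
  exact ⟨a, by rw [hab', h6, one_smul]⟩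

/-- The rays of a product with a fan supported on `P` lie in `P`. -/
theorem mem_of_rayWeight_ne_zero (hF : F.support = P) (h : IsFanProduct T F G) {r : Fin n → ℤ}
    (hr : G.rayWeight r ≠ 0) : latVec r ∈ P := by
  obtain ⟨hp, hfac⟩ := rayWeight_ne_zero hr
  by_contra hrP
  obtain ⟨hcones, φ, hφ, hw⟩ := h
  have hray := ((hcones _).1 hfac.1).1
  obtain ⟨u, hu, hw⟩ := hw _ hray hfac.2.1
  -- All two-dimensional cones around a ray outside P have weight zero, so the product has weight
  -- zero there.
  have h0 : ∀ σ ∈ F.star (1 + 1) (PointedCone.hull ℝ {latVec r}), F.weight σ • u σ = 0 := by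
    intro σ hσ
    obtain ⟨h1, h2, h3⟩ := Fan.mem_star.1 hσ
    have : F.weight σ = 0 := by
      by_contra hne
      exact hrP (subset_of_support hF ⟨h1, h2, hne⟩ (h3 (Cone.self_mem_hull _)))
    rw [this, zero_smul]
  rw [Finset.sum_eq_zero h0, Finset.sum_eq_zero fun σ hσ => by
    rw [h0 σ hσ, latVec_zero, map_zero]] at hw
  rw [latVec_zero, map_zero, sub_zero] at hw
  exact hfac.2.2 (by exact_mod_cast hw)

/-- The weight of a ray of the product is the bend of `T` along that ray. -/
theorem rayWeight_eq_bend (hP : IsChart P i j) (hF : F.support = P) {ω : ℕ}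
    (hω : ∀ σ ∈ F.facets, F.weight σ = ω) (h : IsFanProduct T F G) {r e : planeLattice P}
    (hre : IsBasisPair r e) :
    ∃ N₀ : ℕ, ∀ N ≥ N₀, (G.rayWeight r : ℝ) =
      ω * (T ((N : ℝ) • latVec (r : Fin n → ℤ) + latVec (e : Fin n → ℤ)) +
        T ((N : ℝ) • latVec (r : Fin n → ℤ) - latVec (e : Fin n → ℤ)) -
        2 * T ((N : ℝ) • latVec (r : Fin n → ℤ))) := by
  have hp := hre.isPrimitiveVec
  have hm := hre.minor_ne_zero (isRationalPlane hP hF)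
  obtain ⟨hcones, φ, hφ, hw⟩ := h
  have hrP : latVec (r : Fin n → ℤ) ∈ P := r.2
  have heP : latVec (e : Fin n → ℤ) ∈ P := e.2
  have hlin : ∀ σ ∈ F.cones, latVec (r : Fin n → ℤ) ∈ σ → ∀ d, d ∈ σ.dirs (latVec r.1) →
      ∃ N₀ : ℕ, ∀ N ≥ N₀, T ((N : ℝ) • latVec r.1 + d) = N * T (latVec r.1) + φ σ d ∧
        T ((N : ℝ) • latVec r.1) = N * T (latVec r.1) := by
    intro σ hσ hr d hd
    obtain ⟨N₀, hN₀⟩ := Cone.smul_add_mem_of_dirs hr hd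
    refine ⟨N₀, fun N hN => ?_⟩
    rw [hφ σ hσ _ (hN₀ N hN), hφ σ hσ _ hr,
      hφ σ hσ _ (PointedCone.smul_mem σ (Nat.cast_nonneg N) hr), map_add, map_smul, smul_eq_mul]
    exact ⟨rfl, rfl⟩
  -- Either r spans a ray of F, with one facet on each side, or r is inner to a facet, where T is
  -- linear and both sides of the formula vanish.
  by_cases hray : PointedCone.hull ℝ {latVec r.1} ∈ F.cones
  · have hdim := Cone.dim_hull_singleton hp.latVec_ne_zero
    obtain ⟨σ, hσ, τ, hτ, hne, hrσ, hrτ, hdσ, hdτ, hall⟩ :=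
      exists_star_pair hP hF hray hrP heP hm
    obtain ⟨N₁, hN₁⟩ := hlin σ hσ.1 hrσ _ hdσ
    obtain ⟨N₂, hN₂⟩ := hlin τ hτ.1 hrτ _ hdτ
    refine ⟨max N₁ N₂, fun N hN => ?_⟩
    obtain ⟨h1, h3⟩ := hN₁ N ((le_max_left _ _).trans hN)
    obtain ⟨h2, -⟩ := hN₂ N ((le_max_right _ _).trans hN)
    rw [sub_eq_add_neg ((N : ℝ) • latVec r.1), h1, h2, h3]
    rw [rayWeight_eq_weight hp ((hcones _).2 ⟨hray, hdim.le⟩)]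
    obtain ⟨u, hu, hw⟩ := hw _ hray hdim
    replace hu : ∀ σ ∈ F.star 2 (PointedCone.hull ℝ {latVec r.1}),
      IsPrimitiveNormal σ (PointedCone.hull ℝ {latVec r.1}) (u σ) := hu
    replace hw : (G.weight (PointedCone.hull ℝ {latVec r.1}) : ℝ) =
      ∑ σ ∈ F.star 2 (PointedCone.hull ℝ {latVec r.1}), φ σ (latVec (F.weight σ • u σ)) -
      φ (PointedCone.hull ℝ {latVec r.1})
        (latVec (∑ σ ∈ F.star 2 (PointedCone.hull ℝ {latVec r.1}), F.weight σ • u σ)) := hw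
    rw [sum_star_ray hσ hτ hne hrσ hrτ hall (fun ρ h => by
        rw [h, zero_smul, latVec_zero, map_zero]),
      sum_star_ray hσ hτ hne hrσ hrτ hall (fun ρ h => by rw [h, zero_smul]), hω σ hσ, hω τ hτ] at hw
    obtain ⟨a, ha⟩ := primitiveNormal_eq hP hF hre hray hσ hrσ hdσ (hu σ (mem_star_ray hσ hrσ))
    obtain ⟨b, hb⟩ := primitiveNormal_eq hP hF hre.neg_right hray hτ hrτ
      (by simpa [latVec_neg] using hdτ) (hu τ (mem_star_ray hτ hrτ))
    have e1 := hφ σ hσ.1 _ hrσ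
    have e2 := hφ τ hτ.1 _ hrτ
    have e3 := hφ _ hray _ (Cone.self_mem_hull (latVec r.1))
    rw [hw, ha, hb]
    -- The normals are a r + e and b r - e. All linear extensions agree with T at r, so the
    -- multiples of r cancel against the correction term and only the values at ±e remain.
    have hsum : latVec (ω • (a • r.1 + e.1) + ω • (b • r.1 + (-e).1)) =
        ((ω : ℝ) * (a + b)) • latVec r.1 := by
      rw [latVec_add, latVec_nsmul, latVec_nsmul, latVec_add, latVec_add, latVec_zsmul,
        latVec_zsmul, AddSubgroup.coe_neg, latVec_neg]
      module
    rw [hsum, latVec_nsmul, latVec_nsmul, latVec_add, latVec_add, latVec_zsmul,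
        latVec_zsmul, AddSubgroup.coe_neg, latVec_neg]
    simp only [map_add, map_smul, map_neg, smul_eq_mul, ← e1, ← e2, ← e3]
    ring
  · obtain ⟨σ, hσ, hrσ⟩ := exists_facet_of_mem hF hrP
    have hin := (F.ray_mem_or_isInner hP hσ.1 (subset_of_support hF hσ) hrσ
      hp.latVec_ne_zero).resolve_left hray
    obtain ⟨N₁, hN₁⟩ := hlin σ hσ.1 hrσ _ (hin _ heP)
    obtain ⟨N₂, hN₂⟩ := hlin σ hσ.1 hrσ _ (hin _ (P.neg_mem heP))
    refine ⟨max N₁ N₂, fun N hN => ?_⟩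
    obtain ⟨h1, h3⟩ := hN₁ N ((le_max_left _ _).trans hN)
    obtain ⟨h2, -⟩ := hN₂ N ((le_max_right _ _).trans hN)
    rw [sub_eq_add_neg ((N : ℝ) • latVec r.1), h1, h2, h3,
      rayWeight_eq_zero (fun hc => hray ((hcones _).1 hc).1), map_neg]
    push_cast
    ring

/-- All facets of the fan, which is supported on `P`, have weight `ω`. -/
def IsPlane (F : TropicalFan n 2) (P : Submodule ℝ (Fin n → ℝ)) (ω : ℕ) : Prop :=
  F.support = P ∧ ∀ σ ∈ F.facets, F.weight σ = ω

theorem exists_isPlane (hP : IsChart P i j) (hF : F.support = P) : ∃ ω, F.IsPlane P ω := by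
  obtain ⟨σ, hσ, -⟩ := exists_facet_of_mem hF P.zero_mem
  exact ⟨F.weight σ, hF, fun τ hτ => weight_eq hP hF hτ hσ⟩

theorem Refines.isPlane_iff (hP : Module.finrank ℝ P = 2) {Z X : TropicalFan n 2}
    (h : Z.Refines X) {ω : ℕ} : Z.IsPlane P ω ↔ X.IsPlane P ω := by
  obtain ⟨i, j, hP⟩ := exists_isChart hP
  constructor
  · rintro ⟨h1, h2⟩
    have hX : X.support = P := h.1.symm.trans h1
    refine ⟨hX, fun τ hτ => ?_⟩
    obtain ⟨σ, hσ, -⟩ := exists_facet_of_mem h1 P.zero_mem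
    obtain ⟨σ', hσ', -, hw⟩ := h.2 σ hσ
    rw [weight_eq hP hX hτ hσ', ← hw, h2 σ hσ]
  · rintro ⟨h1, h2⟩
    refine ⟨h.1.trans h1, fun σ hσ => ?_⟩
    obtain ⟨σ', hσ', -, hw⟩ := h.2 σ hσ
    rw [hw, h2 σ' hσ']

/-- Equality of classes is the relation generated by `Equiv`. Each single refinement respects the
property, so it descends to the quotient. -/
theorem isPlane_iff_of_toCycle_eq (hP : Module.finrank ℝ P = 2) {X Y : TropicalFan n 2}
    (h : X.toCycle = Y.toCycle) {ω : ℕ} : X.IsPlane P ω ↔ Y.IsPlane P ω := by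
  have key : ∀ X Y : TropicalFan n 2, X.Equiv Y → X.IsPlane P ω = Y.IsPlane P ω := by
    rintro X Y ⟨Z, hX, hY⟩
    exact propext ((hX.isPlane_iff hP).symm.trans (hY.isPlane_iff hP))
  exact iff_of_eq (congrArg (Quot.lift (fun X : TropicalFan n 2 => X.IsPlane P ω) key) h)

end TropicalFan

end

section

variable {n : ℕ} {P : Submodule ℝ (Fin n → ℝ)} {i j : Fin n}

/-! ### Forms and tropical functions on the lattice of the plane -/

section Forms

/-- An integer linear form, restricted to the lattice of `P`. -/
def latForm (P : Submodule ℝ (Fin n → ℝ)) (l : Fin n → ℤ) : planeLattice P →+ ℤ where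
  toFun z := l ⬝ᵥ (z : Fin n → ℤ)
  map_zero' := by simp
  map_add' a b := by simp [dotProduct_add]

theorem latForm_apply (l : Fin n → ℤ) (z : planeLattice P) :
    latForm P l z = l ⬝ᵥ (z : Fin n → ℤ) := rfl

theorem intForm_latVec (l z : Fin n → ℤ) : intForm l (latVec z) = ((l ⬝ᵥ z : ℤ) : ℝ) := by
  simp [intForm, latVec, dotProduct]

/-- A tropical regular function, restricted to the lattice of `P`. -/
def latFun {k : ℕ} (P : Submodule ℝ (Fin n → ℝ)) (l : Fin (k + 1) → Fin n → ℤ)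
    (z : planeLattice P) : ℤ :=
  Finset.univ.sup' Finset.univ_nonempty fun a => latForm P (l a) z

theorem trFunction_latVec {k : ℕ} (l : Fin (k + 1) → Fin n → ℤ) (z : planeLattice P) :
    trFunction l (latVec (z : Fin n → ℤ)) = latFun P l z := by
  unfold trFunction latFun
  apply le_antisymm
  · refine Finset.sup'_le _ _ fun a _ => ?_
    rw [intForm_latVec]
    exact_mod_cast Finset.le_sup' (fun a => latForm P (l a) z) (Finset.mem_univ a)
  · obtain ⟨a, -, ha⟩ := Finset.exists_mem_eq_sup' Finset.univ_nonempty
      (fun a => latForm P (l a) z)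
    rw [ha, latForm_apply, ← intForm_latVec]
    exact Finset.le_sup' (fun a => intForm (l a) (latVec z.1)) (Finset.mem_univ a)

theorem isMaxForm_latFun {k : ℕ} (v : Fin k → Fin n → ℤ) :
    IsMaxForm (fun a => latForm P (Matrix.vecCons 0 v a)) (latFun P (Matrix.vecCons 0 v)) where
  zero := ⟨0, by
    ext z
    simp [latForm_apply]⟩
  le a z := Finset.le_sup' (fun a => latForm P (Matrix.vecCons 0 v a) z) (Finset.mem_univ a)
  attained z := by
    obtain ⟨a, -, ha⟩ := Finset.exists_mem_eq_sup' Finset.univ_nonempty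
      (fun a => latForm P (Matrix.vecCons 0 v a) z)
    exact ⟨a, ha⟩

theorem mem_smallVectors_of_isSmall {k m : ℕ} {v : Fin k → Fin n → ℤ} {w : Fin m → Fin n → ℤ}
    {r : planeLattice P} (h : IsSmall (fun a => latForm P (Matrix.vecCons 0 v a))
      (fun a => latForm P (Matrix.vecCons 0 w a)) r) : (r : Fin n → ℤ) ∈ smallVectors v w :=
  -- Index 0 carries the zero form.
  ⟨fun a => h.1 a.succ, fun a => h.2 a.succ⟩

/-- The n independent forms are the rows of a square matrix with nonzero determinant. It is
injective on ℤⁿ and maps the set into the finite cube {-1, 0, 1}ⁿ. -/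
theorem finite_smallVectors {k m : ℕ} (hkm : k + m = n) {v : Fin k → Fin n → ℤ}
    {w : Fin m → Fin n → ℤ} (hli : LinearIndependent ℤ (Sum.elim v w)) :
    (smallVectors v w).Finite := by
  let e : Fin n ≃ Fin k ⊕ Fin m := (finCongr hkm.symm).trans finSumFinEquiv.symm
  let A : Matrix (Fin n) (Fin n) ℤ := Matrix.of fun a => Sum.elim v w (e a)
  have hdet : A.det ≠ 0 := by
    intro h0
    obtain ⟨x, hx0, hx⟩ := Matrix.exists_vecMul_eq_zero_iff.2 h0
    have hA : LinearIndependent ℤ A.row := hli.comp e e.injective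
    rw [Matrix.vecMul_eq_sum] at hx
    exact hx0 (funext (Fintype.linearIndependent_iff.1 hA x hx))
  have hinj : Function.Injective A.mulVec := by
    intro x y hxy
    by_contra hne
    apply hdet
    exact Matrix.exists_mulVec_eq_zero_iff.1 ⟨x - y, sub_ne_zero.2 hne, by
      rw [Matrix.mulVec_sub, sub_eq_zero]
      exact hxy⟩
  refine ((Set.Finite.pi' (t := fun _ : Fin n => ({-1, 0, 1} : Set ℤ))
    fun _ => by simp).preimage hinj.injOn).subset ?_
  rintro r ⟨h1, h2⟩ a
  change Sum.elim v w (e a) ⬝ᵥ r ∈ _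
  rcases e a with b | b
  · exact h1 b
  · exact h2 b

end Forms

/-! ### Products of cycles as divisors on the lattice -/

section Weights

theorem Cycle.finite_rayWeight (C : Cycle n 1) : (Function.support C.rayWeight).Finite := by
  obtain ⟨X, rfl⟩ := Quot.exists_rep C
  exact X.finite_rayWeight

theorem TropicalFan.rayWeight_toCycle (X : TropicalFan n 1) :
    X.toCycle.rayWeight = X.rayWeight := rfl

/-- The weights of the rays of a one-dimensional cycle in `P`. -/
noncomputable def Cycle.latWeight (C : Cycle n 1) (P : Submodule ℝ (Fin n → ℝ)) :
    planeLattice P →₀ ℕ :=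
  Finsupp.ofSupportFinite (fun r => C.rayWeight r)
    (C.finite_rayWeight.preimage Subtype.val_injective.injOn)

theorem Cycle.latWeight_apply (C : Cycle n 1) (r : planeLattice P) :
    C.latWeight P r = C.rayWeight r := rfl

theorem sum_latWeight {X : TropicalFan n 1}
    (hX : ∀ r, X.rayWeight r ≠ 0 → latVec r ∈ P) {A : Type*} [AddCommMonoid A]
    (g : (Fin n → ℤ) → A) :
    ∑ r ∈ (X.toCycle.latWeight P).support, X.toCycle.latWeight P r • g r =
      ∑ r ∈ X.finite_rayWeight.toFinset, X.rayWeight r • g r := by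
  refine Finset.sum_of_injOn Subtype.val Subtype.val_injective.injOn ?_ ?_ ?_
  · intro r hr
    simpa [Cycle.latWeight_apply, TropicalFan.rayWeight_toCycle] using hr
  · intro r hr hnot
    have hr' : X.rayWeight r ≠ 0 := by simpa using hr
    refine absurd ⟨⟨r, hX r hr'⟩, ?_, rfl⟩ hnot
    simpa [Cycle.latWeight_apply, TropicalFan.rayWeight_toCycle] using hr'
  · intro r _
    rfl

variable {k : ℕ} {l : Fin (k + 1) → Fin n → ℤ} {L : Cycle n 2} {C C' : Cycle n 1}

/-- The cycle `L` is the plane `P` with weight `ω`. -/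
def Cycle.IsPlane (L : Cycle n 2) (P : Submodule ℝ (Fin n → ℝ)) (ω : ℕ) : Prop :=
  ∀ F : TropicalFan n 2, F.toCycle = L → F.IsPlane P ω

theorem Cycle.exists_isPlane (hP : Module.finrank ℝ P = 2) (h : L.support = P) :
    ∃ ω, L.IsPlane P ω := by
  obtain ⟨X, rfl⟩ := Quot.exists_rep L
  obtain ⟨i, j, hc⟩ := exists_isChart hP
  obtain ⟨ω, hω⟩ := TropicalFan.exists_isPlane (F := X) hc h
  exact ⟨ω, fun F hF => (TropicalFan.isPlane_iff_of_toCycle_eq hP hF).2 hω⟩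

theorem Cycle.IsPlane.isRationalPlane {ω : ℕ} (hL : L.IsPlane P ω) (hP : IsChart P i j) :
    IsRationalPlane P i j := by
  obtain ⟨X, rfl⟩ := Quot.exists_rep L
  exact TropicalFan.isRationalPlane hP (hL X rfl).1

theorem Cycle.rayWeight_primitive {r : Fin n → ℤ} (h : C.rayWeight r ≠ 0) : IsPrimitiveVec r := by
  obtain ⟨X, rfl⟩ := Quot.exists_rep C
  exact (TropicalFan.rayWeight_ne_zero h).1

theorem IsProduct.mem_of_rayWeight {ω : ℕ} {T : (Fin n → ℝ) → ℝ} (hL : L.IsPlane P ω)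
    (h : IsProduct T L C) {r : Fin n → ℤ} (hr : C.rayWeight r ≠ 0) : latVec r ∈ P := by
  obtain ⟨F, G, hF, rfl, hFG⟩ := h
  exact TropicalFan.mem_of_rayWeight_ne_zero (hL F hF).1 hFG hr

theorem IsProduct.isDivisor {ω : ℕ} (hP : IsChart P i j) (hL : L.IsPlane P ω)
    (h : IsProduct (trFunction l) L C) : IsDivisor (latFun P l) ω (C.latWeight P) := by
  have hR := hL.isRationalPlane hP
  have hmem := fun r => h.mem_of_rayWeight hL (r := r)
  obtain ⟨F, G, hF, rfl, hFG⟩ := h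
  refine ⟨fun r hr => exists_isBasisPair hP hR
      (Cycle.rayWeight_primitive (C := G.toCycle) (r := r) hr), ?_,
    fun r e hre => ?_⟩
  · apply Subtype.ext
    rw [AddSubgroup.val_finsetSum]
    exact (sum_latWeight hmem (fun r => r)).trans G.sum_rayWeight
  · obtain ⟨N₀, hN₀⟩ := TropicalFan.rayWeight_eq_bend hP (hL F hF).1 (hL F hF).2 hFG hre
    refine ⟨N₀, fun N hN => ?_⟩
    have h1 := hN₀ N hN
    rw [← latVec_nsmul, ← latVec_add, ← latVec_sub] at h1
    have e1 := trFunction_latVec l (N • r + e)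
    have e2 := trFunction_latVec l (N • r - e)
    have e3 := trFunction_latVec l (N • r)
    simp only [AddSubgroup.coe_add, AddSubgroup.coe_sub, AddSubgroup.coe_nsmul] at e1 e2 e3
    rw [e1, e2, e3] at h1
    exact_mod_cast h1

/-- `IsProduct` leaves the representing fan open; the bend formula determines each weight without
reference to it. -/
theorem IsProduct.latWeight_eq {ω : ℕ} (hP : IsChart P i j) (hL : L.IsPlane P ω)
    (h : IsProduct (trFunction l) L C) (h' : IsProduct (trFunction l) L C') :
    C.latWeight P = C'.latWeight P := by
  have hd := h.isDivisor hP hL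
  have hd' := h'.isDivisor hP hL
  ext r
  by_cases hr : C.latWeight P r = 0 ∧ C'.latWeight P r = 0
  · rw [hr.1, hr.2]
  · have : ∃ e, IsBasisPair r e := by
      by_cases h0 : C.latWeight P r = 0
      · exact hd'.prim r fun h1 => hr ⟨h0, h1⟩
      · exact hd.prim r h0
    obtain ⟨e, he⟩ := this
    obtain ⟨N, hN⟩ := hd.bend r e he
    obtain ⟨N', hN'⟩ := hd'.bend r e he
    have h1 := hN _ (le_max_left N N')
    have h2 := hN' _ (le_max_right N N')
    exact_mod_cast h1.trans h2.symm

theorem IsProduct.degree_eq {ω : ℕ} {T : (Fin n → ℝ) → ℝ} {D : Cycle n 0} (hL : L.IsPlane P ω)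
    (h : IsProduct T L C) (hD : IsProduct (trFunction l) C D) :
    (D.degree : ℤ) = ∑ r ∈ (C.latWeight P).support, (C.latWeight P r : ℤ) * latFun P l r := by
  have hmem := fun r => h.mem_of_rayWeight hL (r := r)
  obtain ⟨F, G, rfl, rfl, hFG⟩ := hD
  have h1 := TropicalFan.weight_bot_eq hFG
  have h2 := sum_latWeight (P := P) (X := F) hmem (fun r => trFunction l (latVec r))
  simp only [nsmul_eq_mul] at h2
  rw [← h2] at h1
  simp only [trFunction_latVec] at h1
  exact_mod_cast h1

end Weights

/-! ### Normal form of a one-dimensional cycle with unit weights -/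

section RayCycles

variable {q : ℕ} {r : Fin q → Fin n → ℤ}

open Classical in
/-- The subfan of a one-dimensional fan consisting of the origin and given rays, which contain all
rays of nonzero weight. -/
noncomputable def TropicalFan.restrictRays (X : TropicalFan n 1)
    (r : Fin q → Fin n → ℤ) (i₀ : Fin q)
    (hr : ∀ a, PointedCone.hull ℝ {latVec (r a)} ∈ X.facets)
    (hX : ∀ σ ∈ X.facets, ∃ a, σ = PointedCone.hull ℝ {latVec (r a)}) : TropicalFan n 1 where
  cones := X.cones.filter fun σ => σ = ⊥ ∨ ∃ a, σ = PointedCone.hull ℝ {latVec (r a)}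
  bot_mem := Finset.mem_filter.2 ⟨X.bot_mem, Or.inl rfl⟩
  rational σ hσ := X.rational σ (Finset.mem_filter.1 hσ).1
  stronglyConvex σ hσ := X.stronglyConvex σ (Finset.mem_filter.1 hσ).1
  face_mem σ hσ τ hτ := by
    obtain ⟨h1, h2⟩ := Finset.mem_filter.1 hσ
    refine Finset.mem_filter.2 ⟨X.face_mem σ h1 τ hτ, ?_⟩
    by_cases hτ0 : τ.dim = 0
    · exact Or.inl (Cone.eq_bot_of_dim hτ0)
    · obtain ⟨x, hx, hx0⟩ := Cone.exists_mem_ne_zero hτ0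
      rcases h2 with rfl | ⟨a, rfl⟩
      · exact absurd (by simpa using hτ.le hx) hx0
      · refine Or.inr ⟨a, ?_⟩
        rw [Cone.eq_hull_singleton (hr a).2.1 (X.stronglyConvex _ h1) (hτ.le hx) hx0]
        refine le_antisymm ?_ (Cone.hull_singleton_le hx)
        rw [← Cone.eq_hull_singleton (hr a).2.1 (X.stronglyConvex _ h1) (hτ.le hx) hx0]
        exact hτ.le
  inter_face σ hσ τ hτ :=
    X.inter_face σ (Finset.mem_filter.1 hσ).1 τ (Finset.mem_filter.1 hτ).1
  pure σ hσ := by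
    obtain ⟨h1, h2⟩ := Finset.mem_filter.1 hσ
    rcases h2 with rfl | ⟨a, rfl⟩
    -- The index i₀ serves purity: the origin has to lie in some ray.
    · exact ⟨_, Finset.mem_filter.2 ⟨(hr i₀).1, Or.inr ⟨i₀, rfl⟩⟩, bot_le, (hr i₀).2.1⟩
    · exact ⟨_, hσ, le_rfl, (hr a).2.1⟩
  weight := X.weight
  balanced τ hτ hd := by
    obtain rfl : τ = ⊥ := Cone.eq_bot_of_dim (by omega)
    obtain ⟨u, hu, hbal⟩ := X.balanced ⊥ X.bot_mem hd
    refine ⟨u, fun σ hσ => ?_, ?_⟩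
    · obtain ⟨h1, h2⟩ := Fan.mem_star.1 hσ
      exact hu σ (Fan.mem_star.2 ⟨(Finset.mem_filter.1 h1).1, h2⟩)
    · convert hbal using 2
      refine Finset.sum_subset (fun σ hσ => ?_) fun σ hσ hnot => ?_
      · obtain ⟨h1, h2⟩ := Fan.mem_star.1 hσ
        exact Fan.mem_star.2 ⟨(Finset.mem_filter.1 h1).1, h2⟩
      · obtain ⟨h1, h2, h3⟩ := Fan.mem_star.1 hσ
        by_cases hw : X.weight σ = 0
        · rw [hw, zero_smul]
        · obtain ⟨a, ha⟩ := hX σ ⟨h1, h2, hw⟩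
          exact absurd (Fan.mem_star.2 ⟨Finset.mem_filter.2 ⟨h1, Or.inr ⟨a, ha⟩⟩, h2, h3⟩) hnot

theorem TropicalFan.refines_of_facets_eq {X Y : TropicalFan n 1} (h : X.facets = Y.facets)
    (hw : ∀ σ ∈ X.facets, X.weight σ = Y.weight σ) : X.Refines Y :=
  ⟨by rw [support, support, h], fun σ hσ => ⟨σ, h ▸ hσ, le_rfl, hw σ hσ⟩⟩

/-- A one-dimensional cycle all of whose rays have weight one is represented by the fan with these
rays. -/
theorem isRayCycle_of_rayWeight {C : Cycle n 1} (i₀ : Fin q) (hinj : Function.Injective r)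
    (h1 : ∀ a, C.rayWeight (r a) = 1) (h2 : ∀ z, C.rayWeight z ≠ 0 → ∃ a, z = r a) :
    IsRayCycle C r := by
  obtain ⟨X, rfl⟩ := Quot.exists_rep C
  have hw : ∀ a, X.rayWeight (r a) = 1 := h1
  have hne : ∀ a, X.rayWeight (r a) ≠ 0 := fun a => by rw [hw]; norm_num
  have hr : ∀ a, PointedCone.hull ℝ {latVec (r a)} ∈ X.facets := fun a =>
    (TropicalFan.rayWeight_ne_zero (hne a)).2
  have hp : ∀ a, IsPrimitiveVec (r a) := fun a => (TropicalFan.rayWeight_ne_zero (hne a)).1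
  have hX : ∀ σ ∈ X.facets, ∃ a, σ = PointedCone.hull ℝ {latVec (r a)} := by
    intro σ hσ
    obtain ⟨u, hu, -⟩ := X.balanced ⊥ X.bot_mem (by rw [Cone.dim_bot])
    have hn := hu σ (Fan.mem_star.2 ⟨hσ.1, hσ.2.1, bot_le⟩)
    have he := hn.eq_hull_of_bot (X.rational _ hσ.1) hσ.2.1 (X.stronglyConvex _ hσ.1)
    obtain ⟨a, ha⟩ := h2 (u σ) (by
      change X.rayWeight (u σ) ≠ 0
      rw [TropicalFan.rayWeight_eq_weight (hn.isPrimitiveVec_of_bot (X.rational _ hσ.1) hσ.2.1)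
        (he ▸ hσ.1), ← he]
      exact hσ.2.2)
    exact ⟨a, by rw [← ha]; exact he⟩
  have hmem : ∀ σ, σ ∈ (X.restrictRays r i₀ hr hX).cones ↔ σ = ⊥ ∨
      ∃ a, σ = PointedCone.hull ℝ {latVec (r a)} := by
    classical
    intro σ
    refine ⟨fun h => (Finset.mem_filter.1 h).2, fun h => Finset.mem_filter.2 ⟨?_, h⟩⟩
    rcases h with rfl | ⟨a, rfl⟩
    · exact X.bot_mem
    · exact (hr a).1
  have hfac : (X.restrictRays r i₀ hr hX).facets = X.facets := by
    ext σ
    constructor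
    · rintro ⟨h, h', h''⟩
      rcases (hmem σ).1 h with rfl | ⟨a, rfl⟩
      · rw [Cone.dim_bot] at h'
        omega
      · exact hr a
    · rintro h
      exact ⟨(hmem σ).2 (Or.inr (hX σ h)), h.2.1, h.2.2⟩
  refine ⟨hinj, hp, X.restrictRays r i₀ hr hX, ?_, hmem, fun a => ?_⟩
  -- A representative may have additional rays of weight zero; dropping them does not change the
  -- class.
  · exact Quot.sound ⟨X.restrictRays r i₀ hr hX,
      TropicalFan.refines_of_facets_eq rfl fun _ _ => rfl,
      TropicalFan.refines_of_facets_eq hfac fun _ _ => rfl⟩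
  · change X.weight _ = 1
    rw [← TropicalFan.rayWeight_eq_weight (hp a) (hr a).1, hw]

end RayCycles

/-! ### From divisors back to lines and Bergman fans -/

section Conclusion

variable {L : Cycle n 2} {C : Cycle n 1} {T : (Fin n → ℝ) → ℝ}

theorem isRayCycle_of_hasUnitRays {ω q : ℕ} (hL : L.IsPlane P ω) (h : IsProduct T L C)
    {r : Fin q → planeLattice P} (i₀ : Fin q) (hinj : Function.Injective r)
    (hr : HasUnitRays (C.latWeight P) r) : IsRayCycle C fun a => (r a : Fin n → ℤ) := by
  refine isRayCycle_of_rayWeight i₀ (Subtype.val_injective.comp hinj) hr.1 fun z hz => ?_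
  obtain ⟨a, ha⟩ := hr.2 ⟨z, h.mem_of_rayWeight hL hz⟩ hz
  exact ⟨a, congrArg Subtype.val ha⟩

theorem isLine_of_hasUnitRays {ω : ℕ} (hL : L.IsPlane P ω) (h : IsProduct T L C)
    {ρ e : planeLattice P} (hb : IsBasisPair ρ e)
    (hr : HasUnitRays (C.latWeight P) ![ρ, -ρ]) : IsLine C (ρ : Fin n → ℤ) := by
  have hinj : Function.Injective ![ρ, -ρ] := by
    intro a b hab
    have := hb.ne_neg
    fin_cases a <;> fin_cases b <;> simp_all [eq_comm]
  have h1 := isRayCycle_of_hasUnitRays hL h 0 hinj hr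
  have h2 : (fun a => ((![ρ, -ρ] a : planeLattice P) : Fin n → ℤ)) = ![(ρ : Fin n → ℤ), -ρ] := by
    funext a
    fin_cases a <;> rfl
  rwa [h2] at h1

theorem realSpan_eq (hP : IsChart P i j) (hR : IsRationalPlane P i j) {q : ℕ}
    {r : Fin q → planeLattice P} {a b : Fin q} (hb : IsBasisPair (r a) (r b)) :
    realSpan (fun c => (r c : Fin n → ℤ)) = P := by
  apply le_antisymm
  · refine Submodule.span_le.2 ?_
    rintro _ ⟨c, rfl⟩
    exact (r c).2
  · exact hP.span_eq (r a).2 (r b).2 (hb.minor_ne_zero hR) (Submodule.subset_span ⟨a, rfl⟩)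
      (Submodule.subset_span ⟨b, rfl⟩)

theorem isBergmanFan_of_isSmallTripod {ω : ℕ} (hP : IsChart P i j) (hL : L.IsPlane P ω)
    (h : IsProduct T L C)
    {ι κ : Type*} {v : ι → planeLattice P →+ ℤ} {w : κ → planeLattice P →+ ℤ}
    {r : Fin 3 → planeLattice P} (hr : IsSmallTripod v w (C.latWeight P) r) :
    IsBergmanFan C fun a => (r a : Fin n → ℤ) := by
  obtain ⟨hb, hsum, hunit, -⟩ := hr
  have hinj : Function.Injective r := by
    have h12 : r 1 ≠ r 2 := by
      intro h
      have := hb.indep 1 (-1) (by rw [h]; module)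
      omega
    have h01 : r 0 ≠ r 1 := by
      intro h
      have := hb.indep 2 1 (by rw [← hsum, h]; module)
      omega
    have h02 : r 0 ≠ r 2 := by
      intro h
      have := hb.indep 1 2 (by rw [← hsum, h]; module)
      omega
    intro a b hab
    fin_cases a <;> fin_cases b <;> simp_all [eq_comm]
  refine ⟨isRayCycle_of_hasUnitRays hL h 0 hinj hunit, ?_, ?_, fun z hz => ?_⟩
  · rw [Fin.sum_univ_three]
    exact congrArg Subtype.val hsum
  · rw [LinearIndependent.pair_iff]
    intro s t hst
    exact hb.indep s t (Subtype.ext hst)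
  · have hz' : z ∈ planeLattice P := by
      have := realSpan_eq hP (hL.isRationalPlane hP) hb
      rw [mem_planeLattice, ← this]
      exact hz
    obtain ⟨s, t, hst⟩ := hb.gen ⟨z, hz'⟩
    exact ⟨s, t, congrArg Subtype.val hst⟩

end Conclusion

end

/-! ### Cells of a line arrangement in the plane -/

section

variable {n : ℕ} {P : Submodule ℝ (Fin n → ℝ)} {i j : Fin n} {S : Finset (Fin n → ℤ)}

/-- A finite symmetric set of lattice vectors spanning the plane `P`. -/
structure IsArrangement (P : Submodule ℝ (Fin n → ℝ)) (i j : Fin n) (S : Finset (Fin n → ℤ)) :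
    Prop where
  chart : IsChart P i j
  mem : ∀ s ∈ S, latVec s ∈ P
  symm : ∀ s ∈ S, -s ∈ S
  spans : ∃ s ∈ S, ∃ t ∈ S, minor i j (latVec s) (latVec t) ≠ 0

/-- The cone in `P` cut out by the half planes bounded by the lines of the vectors of `A`. -/
def halfPlanes (P : Submodule ℝ (Fin n → ℝ)) (i j : Fin n) (A : Finset (Fin n → ℤ)) : Cone n where
  carrier := {z | z ∈ P ∧ ∀ s ∈ A, 0 ≤ minor i j (latVec s) z}
  add_mem' := by
    rintro a b ⟨ha, ha'⟩ ⟨hb, hb'⟩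
    refine ⟨P.add_mem ha hb, fun s hs => ?_⟩
    rw [map_add]
    exact add_nonneg (ha' s hs) (hb' s hs)
  zero_mem' := ⟨P.zero_mem, fun s _ => by rw [map_zero]⟩
  smul_mem' := by
    rintro ⟨t, ht⟩ y ⟨hy, hy'⟩
    refine ⟨P.smul_mem t hy, fun s hs => ?_⟩
    change 0 ≤ minor i j (latVec s) (t • y)
    rw [map_smul]
    exact mul_nonneg ht (hy' s hs)

theorem mem_halfPlanes {A : Finset (Fin n → ℤ)} {z : Fin n → ℝ} :
    z ∈ halfPlanes P i j A ↔ z ∈ P ∧ ∀ s ∈ A, 0 ≤ minor i j (latVec s) z := Iff.rfl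

open Classical in
/-- The smallest cell of the arrangement containing `x`. -/
noncomputable def cell (P : Submodule ℝ (Fin n → ℝ)) (i j : Fin n) (S : Finset (Fin n → ℤ))
    (x : Fin n → ℝ) : Cone n :=
  halfPlanes P i j (S.filter fun s => 0 ≤ minor i j (latVec s) x)

theorem mem_cell {x z : Fin n → ℝ} : z ∈ cell P i j S x ↔
    z ∈ P ∧ ∀ s ∈ S, 0 ≤ minor i j (latVec s) x → 0 ≤ minor i j (latVec s) z := by
  simp [cell, mem_halfPlanes]

theorem self_mem_cell {x : Fin n → ℝ} (hx : x ∈ P) : x ∈ cell P i j S x :=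
  mem_cell.2 ⟨hx, fun _ _ h => h⟩

theorem cell_subset (x : Fin n → ℝ) : (cell P i j S x : Set (Fin n → ℝ)) ⊆ P :=
  fun _ hz => (mem_cell.1 hz).1

theorem cell_le {x y : Fin n → ℝ} (h : y ∈ cell P i j S x) :
    cell P i j S y ≤ cell P i j S x := fun _ hz =>
  mem_cell.2 ⟨(mem_cell.1 hz).1, fun s hs hx => (mem_cell.1 hz).2 s hs ((mem_cell.1 h).2 s hs hx)⟩

theorem finite_cells : {σ : Cone n | ∃ x ∈ P, σ = cell P i j S x}.Finite := by
  classical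
  refine (S.powerset.finite_toSet.image (halfPlanes P i j)).subset ?_
  rintro _ ⟨x, -, rfl⟩
  exact ⟨_, Finset.mem_coe.2 (Finset.mem_powerset.2 (Finset.filter_subset _ _)), rfl⟩

theorem minor_neg_latVec (s : Fin n → ℤ) (z : Fin n → ℝ) :
    minor i j (latVec (-s)) z = -minor i j (latVec s) z := by
  rw [latVec_neg, minor_apply, minor_apply]
  simp
  ring

theorem minor_latVec_neg (x : Fin n → ℝ) (s : Fin n → ℤ) :
    minor i j x (latVec (-s)) = -minor i j x (latVec s) := by
  rw [latVec_neg, map_neg]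

theorem eventually_sign (S : Finset (Fin n → ℤ)) (x d : Fin n → ℝ) :
    ∀ᶠ δ : ℝ in 𝓝[>] 0, ∀ s ∈ S, 0 < minor i j (latVec s) x →
      0 < minor i j (latVec s) (x + δ • d) := by
  refine Filter.Eventually.filter_mono nhdsWithin_le_nhds ?_
  rw [Filter.eventually_all_finset]
  intro s _
  by_cases h : 0 < minor i j (latVec s) x
  · have hc : Continuous fun δ : ℝ => minor i j (latVec s) (x + δ • d) := by
      simp only [map_add, map_smul]
      fun_prop
    have h2 := (continuousAt_const (y := (0 : ℝ)) (x := (0 : ℝ))).eventually_lt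
      (hc.continuousAt (x := (0 : ℝ))) (by simpa using h)
    filter_upwards [h2] with δ hδ _ using hδ
  · exact Filter.Eventually.of_forall fun _ hc => absurd hc h

theorem exists_sign (S : Finset (Fin n → ℤ)) (x d : Fin n → ℝ) :
    ∃ δ : ℝ, 0 < δ ∧ ∀ s ∈ S, 0 < minor i j (latVec s) x →
      0 < minor i j (latVec s) (x + δ • d) := by
  obtain ⟨δ, h1, h2⟩ := ((eventually_sign (i := i) (j := j) S x d).and
    self_mem_nhdsWithin).exists
  exact ⟨δ, h2, h1⟩

namespace IsArrangement

variable (h : IsArrangement P i j S) {x y z d : Fin n → ℝ} {s : Fin n → ℤ}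

include h

/-- As S is symmetric, -s imposes a condition too. In particular, forms that vanish at x vanish on
its whole cell. -/
theorem nonpos_of_mem_cell (hz : z ∈ cell P i j S x) (hs : s ∈ S)
    (hx : minor i j (latVec s) x ≤ 0) : minor i j (latVec s) z ≤ 0 := by
  have := (mem_cell.1 hz).2 (-s) (h.symm s hs) (by rw [minor_neg_latVec]; linarith)
  rw [minor_neg_latVec] at this
  linarith

theorem pos_of_mem_cell (hz : z ∈ cell P i j S x) (hs : s ∈ S)
    (hzs : 0 < minor i j (latVec s) z) : 0 < minor i j (latVec s) x := by
  by_contra hc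
  exact absurd (h.nonpos_of_mem_cell hz hs (not_lt.1 hc)) (not_le.2 hzs)

theorem eq_zero_of_minor (hz : z ∈ P) (h0 : ∀ s ∈ S, minor i j (latVec s) z = 0) : z = 0 := by
  obtain ⟨s, hs, t, ht, hst⟩ := h.spans
  have := h.chart.plucker (h.mem s hs) (h.mem t ht) hz
  rw [h0 s hs, minor_swap z, h0 t ht] at this
  simpa [hst] using this

theorem cell_zero : cell P i j S 0 = ⊥ := by
  rw [eq_bot_iff]
  intro z hz
  refine (Submodule.mem_bot _).2 (h.eq_zero_of_minor (mem_cell.1 hz).1 fun s hs => ?_)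
  exact le_antisymm (h.nonpos_of_mem_cell hz hs (by simp)) ((mem_cell.1 hz).2 s hs (by simp))

theorem isStronglyConvex (x : Fin n → ℝ) : (cell P i j S x).IsStronglyConvex := by
  intro z hz hz'
  refine h.eq_zero_of_minor (mem_cell.1 hz).1 fun s hs => ?_
  rcases le_total 0 (minor i j (latVec s) x) with hx | hx
  · have h1 := (mem_cell.1 hz).2 s hs hx
    have h2 := (mem_cell.1 hz').2 s hs hx
    rw [map_neg] at h2
    linarith
  · have h1 := h.nonpos_of_mem_cell hz hs hx
    have h2 := h.nonpos_of_mem_cell hz' hs hx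
    rw [map_neg] at h2
    linarith

/-- Each form has a weak sign on the cell of x. Let it be nonnegative at y and at a u + v. If it is
nonnegative at x, it is so at u. If it is nonpositive at x, then v contributes nothing positive, so
again u has a nonnegative value. -/
theorem inf_isFaceOf (x y : Fin n → ℝ) :
    (cell P i j S x ⊓ cell P i j S y).IsFaceOf (cell P i j S x) where
  le := inf_le_left
  mem_of_smul_add_mem := by
    rintro u v a hu hv ha ⟨-, huv⟩
    refine ⟨hu, mem_cell.2 ⟨(mem_cell.1 hu).1, fun s hs hy => ?_⟩⟩
    have h1 := (mem_cell.1 huv).2 s hs hy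
    rcases le_total 0 (minor i j (latVec s) x) with hx | hx
    · exact (mem_cell.1 hu).2 s hs hx
    · have h2 := h.nonpos_of_mem_cell hv hs hx
      rw [map_add, map_smul, smul_eq_mul] at h1
      by_contra hc
      nlinarith [mul_pos ha (neg_pos.2 (not_le.1 hc))]

/-- A point y of the face with as few vanishing forms as possible is relatively interior. Comparing
it with y + z, z in the face, shows that forms vanishing at y vanish on the face, so the face lies
in the cell of y. Conversely, for z in that cell, y - δ z stays in it for small δ, and the face
property yields z. -/
theorem exists_eq_cell_of_isFaceOf {τ : Cone n} (hτ : τ.IsFaceOf (cell P i j S x)) :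
    ∃ y ∈ P, τ = cell P i j S y := by
  classical
  obtain ⟨y, hy, hmin⟩ := exists_minimalFor_of_wellFoundedLT (fun y => y ∈ τ)
    (fun y => (S.filter fun s => minor i j (latVec s) y = 0).card) ⟨0, τ.zero_mem⟩
  have hyx := hτ.le hy
  have hyP := (mem_cell.1 hyx).1
  have hzero : ∀ z ∈ τ, ∀ s ∈ S, minor i j (latVec s) y = 0 → minor i j (latVec s) z = 0 := by
    intro z hz s hs hys
    have hzx := hτ.le hz
    have hsplit : ∀ t ∈ S, minor i j (latVec t) (y + z) = 0 →
        minor i j (latVec t) y = 0 ∧ minor i j (latVec t) z = 0 := by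
      intro t ht h0
      rw [map_add] at h0
      rcases le_total 0 (minor i j (latVec t) x) with hx | hx
      · have h1 := (mem_cell.1 hyx).2 t ht hx
        have h2 := (mem_cell.1 hzx).2 t ht hx
        constructor <;> linarith
      · have h1 := h.nonpos_of_mem_cell hyx ht hx
        have h2 := h.nonpos_of_mem_cell hzx ht hx
        constructor <;> linarith
    have hsub : (S.filter fun s => minor i j (latVec s) (y + z) = 0) ⊆
        S.filter fun s => minor i j (latVec s) y = 0 := fun t ht => by
      obtain ⟨h1, h2⟩ := Finset.mem_filter.1 ht
      exact Finset.mem_filter.2 ⟨h1, (hsplit t h1 h2).1⟩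
    have heq := Finset.eq_of_subset_of_card_le hsub
      (hmin (τ.add_mem hy hz) (Finset.card_le_card hsub))
    have hmem : s ∈ S.filter fun s => minor i j (latVec s) (y + z) = 0 := by
      rw [heq]
      exact Finset.mem_filter.2 ⟨hs, hys⟩
    exact (hsplit s hs (Finset.mem_filter.1 hmem).2).2
  refine ⟨y, hyP, le_antisymm (fun z hz => ?_) fun z hz => ?_⟩
  · have hzx := hτ.le hz
    refine mem_cell.2 ⟨(mem_cell.1 hzx).1, fun s hs hys => ?_⟩
    rcases le_total 0 (minor i j (latVec s) x) with hx | hx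
    · exact (mem_cell.1 hzx).2 s hs hx
    · have h1 := h.nonpos_of_mem_cell hyx hs hx
      exact (hzero z hz s hs (le_antisymm h1 hys)).ge
  · obtain ⟨δ, hδ, hsign⟩ := exists_sign (i := i) (j := j) S y (-z)
    have hmem : y + δ • -z ∈ cell P i j S y := by
      refine mem_cell.2 ⟨P.add_mem hyP (P.smul_mem _ (P.neg_mem (mem_cell.1 hz).1)),
        fun s hs hys => ?_⟩
      rcases eq_or_lt_of_le hys with h0 | h0
      · have h1 := h.nonpos_of_mem_cell hz hs h0.ge
        have h2 := (mem_cell.1 hz).2 s hs h0.le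
        rw [map_add, map_smul, map_neg, ← h0, le_antisymm h1 h2]
        simp
      · exact (hsign s hs h0).le
    refine hτ.mem_of_smul_add_mem (cell_le hyx hz) (cell_le hyx hmem) hδ ?_
    convert hy using 1
    module

open Classical in
/-- A point of a cell on the line of a vector of the arrangement. -/
theorem mem_hull_of_minor_eq_zero (hz : z ∈ cell P i j S x) (hs : s ∈ S) (hs0 : latVec s ≠ 0)
    (h0 : minor i j (latVec s) z = 0) : z ∈ PointedCone.hull ℝ
      (latVec '' ((S.filter fun t => latVec t ∈ cell P i j S x : Finset _) : Set (Fin n → ℤ))) := by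
  obtain ⟨c, rfl⟩ := h.chart.exists_smul (h.mem s hs) (mem_cell.1 hz).1 hs0 h0
  rcases lt_trichotomy c 0 with hc | hc | hc
  · have := PointedCone.smul_mem _ (inv_nonneg.2 (neg_nonneg.2 hc.le)) hz
    rw [smul_smul, inv_neg, neg_mul, inv_mul_cancel₀ hc.ne, neg_one_smul, ← latVec_neg] at this
    have h1 : c • latVec s = (-c) • latVec (-s) := by
      rw [latVec_neg, smul_neg, neg_smul, neg_neg]
    rw [h1]
    exact PointedCone.smul_mem _ (by linarith) (Submodule.subset_span
      ⟨-s, Finset.mem_coe.2 (Finset.mem_filter.2 ⟨h.symm s hs, this⟩), rfl⟩)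
  · rw [hc, zero_smul]
    exact Submodule.zero_mem _
  · have := PointedCone.smul_mem _ (inv_nonneg.2 hc.le) hz
    rw [smul_smul, inv_mul_cancel₀ hc.ne', one_smul] at this
    exact PointedCone.smul_mem _ hc.le (Submodule.subset_span
      ⟨s, Finset.mem_coe.2 (Finset.mem_filter.2 ⟨hs, this⟩), rfl⟩)

open Classical in
/-- Moving from an inner point of a cell in a transversal direction one hits a wall. -/
theorem exists_add_smul_mem_hull (hz : z ∈ cell P i j S x)
    (hgen : ∀ s ∈ S, latVec s ≠ 0 → minor i j (latVec s) z ≠ 0) (hd : d ∈ P)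
    (hex : ∃ s ∈ S, 0 < minor i j (latVec s) z ∧ minor i j (latVec s) d < 0) :
    ∃ t : ℝ, 0 < t ∧ z + t • d ∈ PointedCone.hull ℝ
      (latVec '' ((S.filter fun t => latVec t ∈ cell P i j S x : Finset _) : Set (Fin n → ℤ))) := by
  obtain ⟨s₀, hs₀, h1, h2⟩ := hex
  -- The least ratio is the time at which z + t d meets its first wall; until then no form changes
  -- sign.
  obtain ⟨s, hs, hmin⟩ := Finset.exists_min_image
    (S.filter fun s => 0 < minor i j (latVec s) z ∧ minor i j (latVec s) d < 0)
    (fun s => minor i j (latVec s) z / -minor i j (latVec s) d)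
    ⟨s₀, Finset.mem_filter.2 ⟨hs₀, h1, h2⟩⟩
  obtain ⟨hs, hsz, hsd⟩ := Finset.mem_filter.1 hs
  have hs0 : latVec s ≠ 0 := by
    intro h0
    rw [h0, minor_apply] at hsz
    simp at hsz
  have hpos : 0 < minor i j (latVec s) z / -minor i j (latVec s) d :=
    div_pos hsz (neg_pos.2 hsd)
  refine ⟨_, hpos, h.mem_hull_of_minor_eq_zero (cell_le hz (mem_cell.2
    ⟨P.add_mem (mem_cell.1 hz).1 (P.smul_mem _ hd), fun t ht htz => ?_⟩)) hs hs0 ?_⟩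
  · rcases eq_or_lt_of_le htz with h0 | h0
    · have ht0 : latVec t = 0 := by
        by_contra hne
        exact hgen t ht hne h0.symm
      rw [ht0, minor_apply]
      simp
    · rw [map_add, map_smul, smul_eq_mul]
      rcases le_or_gt 0 (minor i j (latVec t) d) with h3 | h3
      · have := mul_nonneg hpos.le h3
        linarith
      · have h4 := hmin t (Finset.mem_filter.2 ⟨ht, h0, h3⟩)
        rw [le_div_iff₀ (neg_pos.2 h3)] at h4
        linarith
  · rw [map_add, map_smul, smul_eq_mul]
    have := hsd.ne
    field_simp
    ring

/-- A point on a line of the arrangement is a multiple of a generator. From any other point one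
walks along ±d to the first walls, and the point lies between the two ends. -/
theorem isRational (x : Fin n → ℝ) : (cell P i j S x).IsRational := by
  classical
  refine ⟨S.filter fun t => latVec t ∈ cell P i j S x, le_antisymm (fun z hz => ?_) ?_⟩
  · by_cases hgen : ∀ s ∈ S, latVec s ≠ 0 → minor i j (latVec s) z ≠ 0
    · obtain ⟨a, ha, b, hb, hab⟩ := h.spans
      have habz : ∃ a ∈ S, ∃ b ∈ S, minor i j (latVec a) (latVec b) ≠ 0 ∧
          0 < minor i j (latVec a) z ∧ 0 < minor i j (latVec b) z := by
        have hpos : ∀ s ∈ S, latVec s ≠ 0 → ∃ s' ∈ S, (s' = s ∨ s' = -s) ∧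
            0 < minor i j (latVec s') z := by
          intro s hs hs0
          rcases lt_or_gt_of_ne (hgen s hs hs0) with hlt | hgt
          · exact ⟨-s, h.symm s hs, Or.inr rfl, by rw [minor_neg_latVec]; linarith⟩
          · exact ⟨s, hs, Or.inl rfl, hgt⟩
        obtain ⟨a', ha', haa, hpa⟩ := hpos a ha (fun h0 => by simp [h0, minor_apply] at hab)
        obtain ⟨b', hb', hbb, hpb⟩ := hpos b hb (fun h0 => by simp [h0, minor_apply] at hab)
        refine ⟨a', ha', b', hb', ?_, hpa, hpb⟩
        rcases haa with rfl | rfl <;> rcases hbb with rfl | rfl <;>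
          simpa [minor_neg_latVec, minor_latVec_neg] using hab
      obtain ⟨a, ha, b, hb, hab, hpa, hpb⟩ := habz
      -- The minors of a and of b with d = a + b are negatives of each other. Both forms are
      -- positive at z, so each of d and -d decreases one of them and runs into a wall.
      have hdP := P.add_mem (h.mem a ha) (h.mem b hb)
      have e1 : minor i j (latVec a) (latVec a + latVec b) = minor i j (latVec a) (latVec b) := by
        rw [map_add, minor_self, zero_add]
      have e2 : minor i j (latVec b) (latVec a + latVec b) = -minor i j (latVec a) (latVec b) := by
        rw [map_add, minor_self, add_zero, minor_swap]
      have hex : (∃ s ∈ S, 0 < minor i j (latVec s) z ∧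
          minor i j (latVec s) (latVec a + latVec b) < 0) ∧ (∃ s ∈ S, 0 < minor i j (latVec s) z ∧
          minor i j (latVec s) (-(latVec a + latVec b)) < 0) := by
        rcases lt_or_gt_of_ne hab with hlt | hgt
        · exact ⟨⟨a, ha, hpa, by rwa [e1]⟩, ⟨b, hb, hpb, by rw [map_neg, e2]; linarith⟩⟩
        · exact ⟨⟨b, hb, hpb, by rw [e2]; linarith⟩, ⟨a, ha, hpa, by rw [map_neg, e1]; linarith⟩⟩
      obtain ⟨t, ht, h1⟩ := h.exists_add_smul_mem_hull hz hgen hdP hex.1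
      obtain ⟨u, hu, h2⟩ := h.exists_add_smul_mem_hull hz hgen (P.neg_mem hdP) hex.2
      have h3 := Submodule.add_mem _ (PointedCone.smul_mem _
        (show 0 ≤ u / (t + u) by positivity) h1) (PointedCone.smul_mem _
        (show 0 ≤ t / (t + u) by positivity) h2)
      convert h3 using 1
      ext k
      simp
      field_simp
      ring
    · push Not at hgen
      obtain ⟨s, hs, hs0, hsz⟩ := hgen
      exact h.mem_hull_of_minor_eq_zero hz hs hs0 hsz
  · refine Submodule.span_le.2 ?_
    rintro _ ⟨t, ht, rfl⟩
    exact (Finset.mem_filter.1 (Finset.mem_coe.1 ht)).2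

/-- The cell of a generic point is full. -/
theorem isFull_of_generic (hx : x ∈ P)
    (hgen : ∀ s ∈ S, latVec s ≠ 0 → minor i j (latVec s) x ≠ 0) : (cell P i j S x).IsFull P := by
  have hx0 : x ≠ 0 := by
    rintro rfl
    obtain ⟨a, ha, b, -, hab⟩ := h.spans
    exact hgen a ha (fun h0 => by simp [h0, minor_apply] at hab) (by simp)
  obtain ⟨d, hd, hxd⟩ := h.chart.exists_minor_ne_zero hx hx0
  obtain ⟨δ, hδ, hsign⟩ := exists_sign (i := i) (j := j) S x d
  refine Cone.isFull_of_pair h.chart (cell_subset x) (self_mem_cell hx) (y := x + δ • d) ?_ ?_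
  · refine mem_cell.2 ⟨P.add_mem hx (P.smul_mem _ hd), fun s hs hsx => ?_⟩
    rcases eq_or_lt_of_le hsx with h0 | h0
    · have hs0 : latVec s = 0 := by
        by_contra hne
        exact hgen s hs hne h0.symm
      rw [hs0, minor_apply]
      simp
    · exact (hsign s hs h0).le
  · rw [map_add, map_smul, minor_self, zero_add]
    exact mul_ne_zero hδ.ne' hxd

theorem generic_of_isFull (hfull : (cell P i j S x).IsFull P) (hs : s ∈ S) (hs0 : latVec s ≠ 0) :
    minor i j (latVec s) x ≠ 0 := by
  intro h0
  obtain ⟨y, hy, hsy⟩ := hfull.exists_minor_ne_zero h.chart (h.mem s hs) hs0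
  exact hsy (le_antisymm (h.nonpos_of_mem_cell hy hs h0.le) ((mem_cell.1 hy).2 s hs h0.ge))

/-- On the line a + t b every nonzero s excludes at most one t, since a and b span P. -/
theorem exists_generic : ∃ g ∈ P, ∀ s ∈ S, latVec s ≠ 0 → minor i j (latVec s) g ≠ 0 := by
  obtain ⟨a, ha, b, hb, hab⟩ := h.spans
  have haP := h.mem a ha
  have hbP := h.mem b hb
  have hfin : (⋃ s ∈ {s | s ∈ S ∧ latVec s ≠ 0},
      {t : ℝ | minor i j (latVec s) (latVec a + t • latVec b) = 0}).Finite := by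
    refine Set.Finite.biUnion (S.finite_toSet.subset fun s hs => hs.1) fun s hs => ?_
    refine Set.Subsingleton.finite fun t ht t' ht' => ?_
    simp only [Set.mem_ofPred_eq, map_add, map_smul, smul_eq_mul] at ht ht'
    by_contra hne
    have h1 : minor i j (latVec s) (latVec b) = 0 := by
      have : (t - t') * minor i j (latVec s) (latVec b) = 0 := by linear_combination ht - ht'
      exact (mul_eq_zero.1 this).resolve_left (sub_ne_zero.2 hne)
    have h2 : minor i j (latVec s) (latVec a) = 0 := by
      rw [h1] at ht
      linarith
    apply hs.2
    have := h.chart.plucker haP hbP (h.mem s hs.1)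
    rw [h1, minor_swap (latVec a) (latVec s), h2] at this
    simpa [hab] using this
  obtain ⟨t, ht⟩ := hfin.infinite_compl.nonempty
  refine ⟨latVec a + t • latVec b, P.add_mem haP (P.smul_mem _ hbP), fun s hs hs0 h0 => ht ?_⟩
  exact Set.mem_biUnion (show s ∈ {s | s ∈ S ∧ latVec s ≠ 0} from ⟨hs, hs0⟩) h0

/-- Moving a little in a sufficiently general direction one enters a full cell. -/
theorem isFull_add_smul (hx : x ∈ P) (hd : d ∈ P) {δ : ℝ} (hδ : 0 < δ)
    (hsign : ∀ s ∈ S, 0 < minor i j (latVec s) x → 0 < minor i j (latVec s) (x + δ • d))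
    (hgen : ∀ s ∈ S, latVec s ≠ 0 → minor i j (latVec s) x = 0 → minor i j (latVec s) d ≠ 0) :
    cell P i j S x ≤ cell P i j S (x + δ • d) ∧ (cell P i j S (x + δ • d)).IsFull P := by
  have hneg : ∀ s ∈ S, minor i j (latVec s) x < 0 →
      minor i j (latVec s) (x + δ • d) < 0 := by
    intro s hs hsx
    have := hsign (-s) (h.symm s hs) (by rw [minor_neg_latVec]; linarith)
    rw [minor_neg_latVec] at this
    linarith
  refine ⟨cell_le (mem_cell.2 ⟨hx, fun s hs hsy => ?_⟩),
    h.isFull_of_generic (P.add_mem hx (P.smul_mem δ hd)) fun s hs hs0 => ?_⟩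
  · by_contra hc
    exact absurd (hneg s hs (not_le.1 hc)) (not_lt.2 hsy)
  · rcases lt_trichotomy (minor i j (latVec s) x) 0 with hlt | h0 | hgt
    · exact (hneg s hs hlt).ne
    · rw [map_add, h0, zero_add, map_smul]
      exact mul_ne_zero hδ.ne' (hgen s hs hs0 h0)
    · exact (hsign s hs hgt).ne'

theorem exists_isFull_ge (hx : x ∈ P) :
    ∃ y ∈ P, cell P i j S x ≤ cell P i j S y ∧ (cell P i j S y).IsFull P := by
  obtain ⟨g, hg, hgen⟩ := h.exists_generic
  obtain ⟨δ, hδ, hsign⟩ := exists_sign (i := i) (j := j) S x g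
  exact ⟨_, P.add_mem hx (P.smul_mem δ hg),
    h.isFull_add_smul hx hg hδ hsign fun s hs hs0 _ => hgen s hs hs0⟩

/-- A one-dimensional cell is the ray of a vector of the arrangement. -/
theorem exists_eq_hull_of_dim_one (hx : x ∈ P) (hd : (cell P i j S x).dim = 1) :
    ∃ s ∈ S, latVec s ≠ 0 ∧ cell P i j S x = PointedCone.hull ℝ {latVec s} := by
  have hnot : ∃ s ∈ S, latVec s ≠ 0 ∧ minor i j (latVec s) x = 0 := by
    by_contra! hc
    have := (h.isFull_of_generic hx hc).dim h.chart.finrank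
    omega
  obtain ⟨s, hs, hs0, h0⟩ := hnot
  have hx0 : x ≠ 0 := by
    rintro rfl
    rw [h.cell_zero, Cone.dim_bot] at hd
    omega
  have he := Cone.eq_hull_singleton hd (h.isStronglyConvex x) (self_mem_cell hx) hx0
  obtain ⟨c, hc⟩ := h.chart.exists_smul (h.mem s hs) hx hs0 h0
  have key : ∀ t : Fin n → ℤ, ∀ c : ℝ, 0 < c → x = c • latVec t → latVec t ≠ 0 →
      cell P i j S x = PointedCone.hull ℝ {latVec t} := by
    intro t c hc hxt ht0
    refine Cone.eq_hull_singleton hd (h.isStronglyConvex x) ?_ ht0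
    have := PointedCone.smul_mem _ (inv_nonneg.2 hc.le)
      (self_mem_cell (i := i) (j := j) (S := S) hx)
    rwa [hxt, smul_smul, inv_mul_cancel₀ hc.ne', one_smul, ← hxt] at this
  rcases lt_trichotomy c 0 with hlt | rfl | hgt
  · have hs0' : latVec (-s) ≠ 0 := by rwa [latVec_neg, neg_ne_zero]
    refine ⟨-s, h.symm s hs, hs0', key (-s) (-c) (by linarith) ?_ hs0'⟩
    rw [latVec_neg, smul_neg, neg_smul, neg_neg, hc]
  · rw [zero_smul] at hc
    exact absurd hc hx0
  · exact ⟨s, hs, hs0, key s c hgt hc hs0⟩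

/-- The cells adjacent to a ray. -/
theorem cell_eq_of_adjacent (hs : s ∈ S) (hs0 : latVec s ≠ 0)
    (hyP : y ∈ P) (hsy : latVec s ∈ cell P i j S y) (hd : d ∈ P)
    (hyd : 0 < minor i j (latVec s) y * minor i j (latVec s) d) {δ : ℝ} (hδ : 0 < δ)
    (hsign : ∀ t ∈ S, 0 < minor i j (latVec t) (latVec s) →
      0 < minor i j (latVec t) (latVec s + δ • d)) :
    cell P i j S y = cell P i j S (latVec s + δ • d) := by
  have hsP := h.mem s hs
  have hzP := P.add_mem hsP (P.smul_mem δ hd)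
  have hyz : 0 < minor i j (latVec s) y * minor i j (latVec s) (latVec s + δ • d) := by
    rw [map_add, minor_self, zero_add, map_smul, smul_eq_mul, mul_left_comm]
    exact mul_pos hδ hyd
  have h1 : ∀ t ∈ S, 0 < minor i j (latVec t) (latVec s) → 0 < minor i j (latVec t) y :=
    fun t ht h0 => h.pos_of_mem_cell hsy ht h0
  have key : ∀ a b : Fin n → ℝ, a ∈ P → b ∈ P →
      0 < minor i j (latVec s) a * minor i j (latVec s) b →
      (∀ t ∈ S, 0 < minor i j (latVec t) (latVec s) → 0 < minor i j (latVec t) a) →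
      (∀ t ∈ S, 0 < minor i j (latVec t) (latVec s) → 0 < minor i j (latVec t) b) →
      a ∈ cell P i j S b := by
    intro a b ha hb hab hta htb
    refine mem_cell.2 ⟨ha, fun t ht htb0 => ?_⟩
    rcases lt_trichotomy (minor i j (latVec t) (latVec s)) 0 with hlt | h0 | hgt
    · have := htb (-t) (h.symm t ht) (by rw [minor_neg_latVec]; linarith)
      rw [minor_neg_latVec] at this
      linarith
    -- Here t is a multiple of s, so its form is c times that of s, whose values at a and b have the
    -- same sign.
    · obtain ⟨c, hc⟩ := h.chart.exists_smul hsP (h.mem t ht) hs0 (by rw [minor_swap, h0, neg_zero])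
      have hm : ∀ u, minor i j (latVec t) u = c * minor i j (latVec s) u := by
        intro u
        rw [hc, minor_swap, map_smul, minor_swap u, smul_eq_mul]
        ring
      rw [hm] at htb0 ⊢
      have hb2 : 0 < minor i j (latVec s) b ^ 2 :=
        sq_pos_of_ne_zero (right_ne_zero_of_mul hab.ne')
      refine nonneg_of_mul_nonneg_left (b := minor i j (latVec s) b ^ 2) ?_ hb2
      linarith [mul_nonneg htb0 hab.le]
    · exact (hta t ht hgt).le
  exact le_antisymm (cell_le (key _ _ hyP hzP hyz h1 hsign))
    (cell_le (key _ _ hzP hyP (by rwa [mul_comm]) hsign h1))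

end IsArrangement

end

/-! ### The fan of the arrangement and common refinements -/

section

variable {n : ℕ} {P : Submodule ℝ (Fin n → ℝ)} {i j : Fin n} {S : Finset (Fin n → ℤ)}

namespace IsArrangement

variable (h : IsArrangement P i j S) {x y z d : Fin n → ℝ} {s : Fin n → ℤ}

include h

theorem isRationalPlane : IsRationalPlane P i j := by
  obtain ⟨a, ha, b, hb, hab⟩ := h.spans
  exact ⟨a, b, h.mem a ha, h.mem b hb, hab⟩

theorem mul_nonneg_of_mem_cell (hz : z ∈ cell P i j S x) (hs : s ∈ S) :
    0 ≤ minor i j (latVec s) z * minor i j (latVec s) x := by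
  rcases le_total 0 (minor i j (latVec s) x) with hx | hx
  · exact mul_nonneg ((mem_cell.1 hz).2 s hs hx) hx
  · exact mul_nonneg_of_nonpos_of_nonpos (h.nonpos_of_mem_cell hz hs hx) hx

/-- The full cell adjacent to a ray on a given side. -/
theorem exists_adjacent (hs : s ∈ S) (hs0 : latVec s ≠ 0) (hd : d ∈ P)
    (hsd : minor i j (latVec s) d ≠ 0) :
    ∃ δ : ℝ, 0 < δ ∧ (cell P i j S (latVec s + δ • d)).IsFull P ∧
      latVec s ∈ cell P i j S (latVec s + δ • d) ∧
      ∀ y ∈ P, latVec s ∈ cell P i j S y →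
        0 < minor i j (latVec s) y * minor i j (latVec s) d →
        cell P i j S y = cell P i j S (latVec s + δ • d) := by
  have hsP := h.mem s hs
  obtain ⟨δ, hδ, hsign⟩ := exists_sign (i := i) (j := j) S (latVec s) d
  obtain ⟨hle, hfull⟩ := h.isFull_add_smul hsP hd hδ hsign fun t ht ht0 h0 hc => by
    obtain ⟨c, hc'⟩ := h.chart.exists_smul hsP (h.mem t ht) hs0 (by rw [minor_swap, h0, neg_zero])
    rw [hc', minor_swap, map_smul, minor_swap, smul_eq_mul, neg_eq_zero, mul_neg, neg_eq_zero,
      mul_eq_zero, or_iff_left hsd] at hc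
    rw [hc', hc, zero_smul] at ht0
    exact ht0 rfl
  exact ⟨δ, hδ, hfull, hle (self_mem_cell hsP), fun y hy hsy hyd =>
    h.cell_eq_of_adjacent hs hs0 hy hsy hd hyd hδ hsign⟩

/-- The fan of all cells of the arrangement. -/
noncomputable def toFan : Fan n where
  cones := (finite_cells (P := P) (i := i) (j := j) (S := S)).toFinset
  bot_mem := (Set.Finite.mem_toFinset _).2 ⟨0, P.zero_mem, h.cell_zero.symm⟩
  rational σ hσ := by
    obtain ⟨x, -, rfl⟩ := (Set.Finite.mem_toFinset _).1 hσ
    exact h.isRational x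
  stronglyConvex σ hσ := by
    obtain ⟨x, -, rfl⟩ := (Set.Finite.mem_toFinset _).1 hσ
    exact h.isStronglyConvex x
  face_mem σ hσ τ hτ := by
    obtain ⟨x, -, rfl⟩ := (Set.Finite.mem_toFinset _).1 hσ
    exact (Set.Finite.mem_toFinset _).2 (h.exists_eq_cell_of_isFaceOf hτ)
  inter_face σ hσ τ hτ := by
    obtain ⟨x, -, rfl⟩ := (Set.Finite.mem_toFinset _).1 hσ
    obtain ⟨y, -, rfl⟩ := (Set.Finite.mem_toFinset _).1 hτ
    exact ⟨h.inf_isFaceOf x y, inf_comm (cell P i j S x) _ ▸ h.inf_isFaceOf y x⟩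

theorem mem_toFan {σ : Cone n} : σ ∈ h.toFan.cones ↔ ∃ x ∈ P, σ = cell P i j S x :=
  Set.Finite.mem_toFinset _

/-- The two cells adjacent to a ray. -/
theorem exists_star_eq (hs : s ∈ S) (hs0 : latVec s ≠ 0) (hd : d ∈ P)
    (hsd : minor i j (latVec s) d ≠ 0) :
    ∃ σ τ : Cone n, σ ≠ τ ∧ σ.IsFull P ∧ τ.IsFull P ∧
      (∃ t : ℝ, d + t • latVec s ∈ σ) ∧ (∃ t : ℝ, -d + t • latVec s ∈ τ) ∧
      ∀ ρ, ρ ∈ h.toFan.star 2 (PointedCone.hull ℝ {latVec s}) ↔ ρ = σ ∨ ρ = τ := by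
  have hsP := h.mem s hs
  obtain ⟨δ, hδ, hf, hm, hu⟩ := h.exists_adjacent hs hs0 hd hsd
  obtain ⟨ε, hε, hf', hm', hu'⟩ := h.exists_adjacent hs hs0 (P.neg_mem hd)
    (by rwa [map_neg, neg_ne_zero])
  have hxP := P.add_mem hsP (P.smul_mem δ hd)
  have hyP := P.add_mem hsP (P.smul_mem ε (P.neg_mem hd))
  have hscale : ∀ (u : Fin n → ℝ) (a : ℝ), 0 < a → u ∈ P →
      u + a⁻¹ • latVec s ∈ cell P i j S (latVec s + a • u) := fun u a ha huP => by
    have := PointedCone.smul_mem _ (inv_nonneg.2 ha.le) (self_mem_cell (i := i) (j := j) (S := S)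
      (P.add_mem hsP (P.smul_mem a huP)))
    rwa [smul_add, smul_smul, inv_mul_cancel₀ ha.ne', one_smul, add_comm (_ • _)] at this
  refine ⟨_, _, fun hc => ?_, hf, hf', ⟨_, hscale d δ hδ hd⟩, ⟨_, hscale (-d) ε hε (P.neg_mem hd)⟩,
    fun ρ => ⟨fun hρ => ?_, ?_⟩⟩
  · have h1 := h.mul_nonneg_of_mem_cell (hc ▸ self_mem_cell hxP) hs
    simp only [map_add, minor_self, zero_add, map_smul, map_neg, smul_eq_mul] at h1
    have h2 : 0 < δ * ε * minor i j (latVec s) d ^ 2 := by positivity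
    linarith
  · obtain ⟨h1, h2, h3⟩ := Fan.mem_star.1 hρ
    obtain ⟨y, hy, rfl⟩ := h.mem_toFan.1 h1
    have hfull := Cone.isFull_of_dim h.chart.finrank (cell_subset y) h2
    have hsy := h3 (Cone.self_mem_hull (latVec s))
    rcases lt_or_gt_of_ne (mul_ne_zero (h.generic_of_isFull hfull hs hs0) hsd) with hlt | hgt
    · exact Or.inr (hu' y hy hsy (by rw [map_neg]; linarith))
    · exact Or.inl (hu y hy hsy hgt)
  · rintro (rfl | rfl)
    · exact Fan.mem_star.2 ⟨h.mem_toFan.2 ⟨_, hxP, rfl⟩, hf.dim h.chart.finrank,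
        Cone.hull_singleton_le hm⟩
    · exact Fan.mem_star.2 ⟨h.mem_toFan.2 ⟨_, hyP, rfl⟩, hf'.dim h.chart.finrank,
        Cone.hull_singleton_le hm'⟩

theorem isPrimitiveNormal (hs : s ∈ S) (hs0 : latVec s ≠ 0) {e : Fin n → ℤ} (he : latVec e ∈ P)
    (hgen : ∀ z : Fin n → ℤ, latVec z ∈ P →
      ∃ c : ℤ, minor i j (latVec s) (latVec (z - c • e)) = 0)
    {σ : Cone n} (hσ : σ.IsFull P) (hdir : ∃ t : ℝ, latVec e + t • latVec s ∈ σ) :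
    IsPrimitiveNormal σ (PointedCone.hull ℝ {latVec s}) e where
  mem_span := by rwa [hσ.2]
  generates z hz := by
    rw [hσ.2] at hz
    obtain ⟨c, hc⟩ := hgen z hz
    refine ⟨c, ?_⟩
    have hP : latVec (z - c • e) ∈ P :=
      (planeLattice P).sub_mem (x := z) hz ((planeLattice P).zsmul_mem (x := e) he c)
    obtain ⟨a, ha⟩ := h.chart.exists_smul (h.mem s hs) hP hs0 hc
    exact Cone.mem_linSpan_hull_singleton.2 ⟨a, ha⟩
  pointing := by
    obtain ⟨t, ht⟩ := hdir
    exact ⟨t • latVec s, Cone.mem_linSpan_hull_singleton.2 ⟨t, rfl⟩, ht⟩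

/-- The fan of all cells of the arrangement, with constant weight. -/
noncomputable def toTropicalFan (ω : ℕ) : TropicalFan n 2 where
  toFan := h.toFan
  pure σ hσ := by
    obtain ⟨x, hx, rfl⟩ := h.mem_toFan.1 hσ
    obtain ⟨y, hy, hle, hf⟩ := h.exists_isFull_ge hx
    exact ⟨_, h.mem_toFan.2 ⟨y, hy, rfl⟩, hle, hf.dim h.chart.finrank⟩
  weight _ := ω
  balanced τ hτ hd := by
    classical
    obtain ⟨x, hx, rfl⟩ := h.mem_toFan.1 hτ
    obtain ⟨s, hs, hs0, heq⟩ := h.exists_eq_hull_of_dim_one hx (by omega)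
    rw [heq]
    obtain ⟨e, he, hse, hgen⟩ := exists_complement h.chart h.isRationalPlane (h.mem s hs) hs0
    obtain ⟨σ, τ, hne, hσ, hτ, hdσ, hdτ, hstar⟩ := h.exists_star_eq hs hs0 he hse
    have hst : h.toFan.star 2 (PointedCone.hull ℝ {latVec s}) = {σ, τ} := by
      ext ρ
      rw [hstar]
      simp
    -- The two facets at a ray have the opposite normals e and -e, so a constant weight is balanced.
    refine ⟨fun ρ => if ρ = σ then e else -e, fun ρ hρ => ?_, ?_⟩
    · rcases (hstar ρ).1 hρ with rfl | rfl
      · rw [show (fun ρ' => if ρ' = ρ then e else -e) ρ = e from if_pos rfl]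
        exact h.isPrimitiveNormal hs hs0 he hgen hσ hdσ
      · rw [show (fun ρ' => if ρ' = σ then e else -e) ρ = -e from if_neg hne.symm]
        refine h.isPrimitiveNormal hs hs0 (by rw [latVec_neg]; exact P.neg_mem he) (fun z hz => ?_)
          hτ (by rwa [latVec_neg])
        obtain ⟨c, hc⟩ := hgen z hz
        exact ⟨-c, by rwa [smul_neg, neg_smul, neg_neg]⟩
    · rw [hst, Finset.sum_pair hne]
      simp only [if_true, if_neg hne.symm]
      rw [smul_neg, add_neg_cancel, latVec_zero]
      exact Submodule.zero_mem _

theorem mem_facets_toTropicalFan {ω : ℕ} (hω : ω ≠ 0) {σ : Cone n} :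
    σ ∈ (h.toTropicalFan ω).facets ↔ σ.IsFull P ∧ ∃ x ∈ P, σ = cell P i j S x := by
  constructor
  · rintro ⟨h1, h2, -⟩
    obtain ⟨x, hx, rfl⟩ := h.mem_toFan.1 h1
    exact ⟨Cone.isFull_of_dim h.chart.finrank (cell_subset x) h2, x, hx, rfl⟩
  · rintro ⟨h1, h2⟩
    exact ⟨h.mem_toFan.2 h2, h1.dim h.chart.finrank, hω⟩

theorem support_toTropicalFan {ω : ℕ} (hω : ω ≠ 0) :
    (h.toTropicalFan ω).support = (P : Set (Fin n → ℝ)) := by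
  refine subset_antisymm (Set.iUnion₂_subset fun σ hσ => ?_) fun x hx => ?_
  · exact ((h.mem_facets_toTropicalFan hω).1 hσ).1.1
  · obtain ⟨y, hy, hle, hf⟩ := h.exists_isFull_ge hx
    exact Set.mem_biUnion ((h.mem_facets_toTropicalFan hω).2 ⟨hf, y, hy, rfl⟩)
      (hle (self_mem_cell hx))

/-- The fan of a sufficiently fine arrangement refines a given fan supported on the plane. -/
theorem refines {X : TropicalFan n 2} {ω : ℕ} (hω : ω ≠ 0) (hX : X.IsPlane P ω)
    (hS : ∀ σ ∈ X.facets, ∀ x ∈ σ, ∃ s ∈ S, ∃ t ∈ S, latVec s ∈ σ ∧ latVec t ∈ σ ∧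
      0 < minor i j (latVec s) (latVec t) ∧
        0 ≤ minor i j (latVec s) x ∧ 0 ≤ minor i j x (latVec t)) :
    (h.toTropicalFan ω).Refines X := by
  refine ⟨(h.support_toTropicalFan hω).trans hX.1.symm, fun σ hσ => ?_⟩
  obtain ⟨-, x, hx, rfl⟩ := (h.mem_facets_toTropicalFan hω).1 hσ
  obtain ⟨σ', hσ', hxσ⟩ := TropicalFan.exists_facet_of_mem hX.1 hx
  -- x lies between s and t. Both belong to the arrangement, so the whole cell of x stays between
  -- them, hence inside σ'.
  obtain ⟨s, hs, t, ht, hsσ, htσ, hst, h1, h2⟩ := hS σ' hσ' x hxσ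
  refine ⟨σ', hσ', fun z hz => ?_, (hX.2 σ' hσ').symm⟩
  refine h.chart.mem_cone hsσ htσ (h.mem s hs) (h.mem t ht) hst (cell_subset x hz)
    ((mem_cell.1 hz).2 s hs h1) ?_
  have := (mem_cell.1 hz).2 (-t) (h.symm t ht) (by rwa [minor_neg_latVec, ← minor_swap])
  rwa [minor_neg_latVec, ← minor_swap] at this

end IsArrangement

namespace TropicalFan

theorem exists_facet_generators {X : TropicalFan n 2} (hP : IsChart P i j) (hX : X.support = P) :
    ∃ A : Finset (Fin n → ℤ), (∀ s ∈ A, latVec s ∈ P) ∧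
      ∀ σ ∈ X.facets, ∀ x ∈ σ, ∃ s ∈ A, ∃ t ∈ A, latVec s ∈ σ ∧ latVec t ∈ σ ∧
        0 < minor i j (latVec s) (latVec t) ∧
          0 ≤ minor i j (latVec s) x ∧ 0 ≤ minor i j x (latVec t) := by
  classical
  choose! A hA hA' using fun σ (hσ : σ ∈ X.facets) =>
    (isFull_of_support hP hX hσ).exists_generators (X.rational σ hσ.1) hP
  refine ⟨X.finite_facets.toFinset.biUnion A, fun s hs => ?_, fun σ hσ x hx => ?_⟩
  · obtain ⟨σ, hσ, hs⟩ := Finset.mem_biUnion.1 hs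
    rw [Set.Finite.mem_toFinset] at hσ
    exact subset_of_support hX hσ (hA σ hσ s hs)
  · obtain ⟨s, hs, t, ht, h1⟩ := hA' σ hσ x hx
    have hmem := X.finite_facets.mem_toFinset.2 hσ
    exact ⟨s, Finset.mem_biUnion.2 ⟨σ, hmem, hs⟩, t, Finset.mem_biUnion.2 ⟨σ, hmem, ht⟩,
      hA σ hσ s hs, hA σ hσ t ht, h1⟩

theorem IsPlane.equiv (hP : IsChart P i j) {X Y : TropicalFan n 2} {ω : ℕ} (hX : X.IsPlane P ω)
    (hY : Y.IsPlane P ω) : X.Equiv Y := by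
  classical
  obtain ⟨A, hA, hA'⟩ := exists_facet_generators hP hX.1
  obtain ⟨B, hB, hB'⟩ := exists_facet_generators hP hY.1
  obtain ⟨σ, hσ, h0⟩ := exists_facet_of_mem hX.1 P.zero_mem
  have hω : ω ≠ 0 := hX.2 σ hσ ▸ hσ.2.2
  obtain ⟨s, hs, t, ht, -, -, hst, -⟩ := hA' σ hσ 0 h0
  have hmem : ∀ s ∈ A ∪ B, s ∈ (A ∪ B) ∪ (A ∪ B).image (-·) := fun s hs =>
    Finset.mem_union_left _ hs
  have hP' : ∀ s ∈ A ∪ B, latVec s ∈ P := fun s hs =>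
    (Finset.mem_union.1 hs).elim (hA s) (hB s)
  -- Generators of all facets of both fans, made symmetric: fine enough to refine X and Y at once.
  have h : IsArrangement P i j ((A ∪ B) ∪ (A ∪ B).image (-·)) :=
    { chart := hP
      mem := fun s hs => by
        rcases Finset.mem_union.1 hs with hs | hs
        · exact hP' s hs
        · obtain ⟨t, ht, rfl⟩ := Finset.mem_image.1 hs
          rw [latVec_neg]
          exact P.neg_mem (hP' t ht)
      symm := fun s hs => by
        rcases Finset.mem_union.1 hs with hs | hs
        · exact Finset.mem_union_right _ (Finset.mem_image_of_mem _ hs)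
        · obtain ⟨t, ht, rfl⟩ := Finset.mem_image.1 hs
          rw [neg_neg]
          exact hmem t ht
      spans := ⟨s, hmem s (Finset.mem_union_left _ hs), t, hmem t (Finset.mem_union_left _ ht),
        hst.ne'⟩ }
  refine ⟨h.toTropicalFan ω, h.refines hω hX fun σ hσ x hx => ?_,
    h.refines hω hY fun σ hσ x hx => ?_⟩
  · obtain ⟨s, hs, t, ht, h1⟩ := hA' σ hσ x hx
    exact ⟨s, hmem s (Finset.mem_union_left _ hs), t, hmem t (Finset.mem_union_left _ ht), h1⟩
  · obtain ⟨s, hs, t, ht, h1⟩ := hB' σ hσ x hx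
    exact ⟨s, hmem s (Finset.mem_union_right _ hs), t, hmem t (Finset.mem_union_right _ ht), h1⟩

end TropicalFan

/-- A cycle supported on a plane is determined by its weight. -/
theorem Cycle.IsPlane.eq {L L' : Cycle n 2} {ω : ℕ} (hP : Module.finrank ℝ P = 2)
    (hL : L.IsPlane P ω) (hL' : L'.IsPlane P ω) : L = L' := by
  obtain ⟨i, j, hP⟩ := exists_isChart hP
  induction L using Quot.inductionOn with
  | h X =>
    induction L' using Quot.inductionOn with
    | h Y => exact Quot.sound ((hL X rfl).equiv hP (hL' Y rfl))

end

/-! ### Weight one, classification and finiteness -/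

section

variable {n : ℕ} {P : Submodule ℝ (Fin n → ℝ)} {i j : Fin n}

section StronglyRegular

variable {p q ω d : ℕ} {l : Fin (p + 1) → Fin n → ℤ} {l' : Fin (q + 1) → Fin n → ℤ}
  {L : Cycle n 2} {C C' : Cycle n 1}

theorem IntersectionNumberEq.eq_sum (hP : IsChart P i j) (hL : L.IsPlane P ω)
    (h : IntersectionNumberEq (trFunction l) (trFunction l') L d)
    (hC : IsProduct (trFunction l') L C) :
    (d : ℤ) = ∑ r ∈ (C.latWeight P).support, (C.latWeight P r : ℤ) * latFun P l r := by
  obtain ⟨C', D, hC', hD, rfl⟩ := h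
  rw [hC.latWeight_eq hP hL hC']
  exact hC'.degree_eq hL hD

/-- A plane with an intersection number `1` has weight `1`. -/
theorem IntersectionNumberEq.weight_eq_one (hP : IsChart P i j) (hL : L.IsPlane P ω)
    (h : IntersectionNumberEq (trFunction l) (trFunction l') L 1) : ω = 1 := by
  obtain ⟨C, -, hC, -⟩ := id h
  have hsum := h.eq_sum hP hL hC
  -- Every ray weight of the product is ω times a bend, so ω divides the intersection number 1.
  have hdvd : ∀ r ∈ (C.latWeight P).support, (ω : ℤ) ∣ C.latWeight P r * latFun P l r := by
    intro r hr
    have hdiv := hC.isDivisor hP hL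
    obtain ⟨e, he⟩ := hdiv.prim r (Finsupp.mem_support_iff.1 hr)
    obtain ⟨N, hN⟩ := hdiv.bend r e he
    exact (Dvd.intro _ (hN N le_rfl).symm).mul_right _
  have h1 := Finset.dvd_sum hdvd
  rw [← hsum, Nat.cast_one] at h1
  exact Nat.dvd_one.1 (by exact_mod_cast h1)

theorem HasPlaneSupport.exists_isPlane (h : HasPlaneSupport L)
    (h1 : IntersectionNumberEq (trFunction l) (trFunction l') L 1) :
    ∃ P : Submodule ℝ (Fin n → ℝ), Module.finrank ℝ P = 2 ∧ L.support = P ∧ L.IsPlane P 1 := by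
  obtain ⟨P, hP, hLP⟩ := h
  obtain ⟨i, j, hchart⟩ := exists_isChart hP
  obtain ⟨ω, hL⟩ := Cycle.exists_isPlane hP hLP
  obtain rfl := h1.weight_eq_one hchart hL
  exact ⟨P, hP, hLP, hL⟩

end StronglyRegular

variable {k m : ℕ} {v : Fin k → Fin n → ℤ} {w : Fin m → Fin n → ℤ}

theorem IsStronglyRegular.classification {L : Cycle n 2} (hL : HasPlaneSupport L)
    (h : IsStronglyRegular (trFunction (Matrix.vecCons 0 v)) (trFunction (Matrix.vecCons 0 w)) L)
    {C₁ C₂ : Cycle n 1} (h₁ : IsProduct (trFunction (Matrix.vecCons 0 v)) L C₁)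
    (h₂ : IsProduct (trFunction (Matrix.vecCons 0 w)) L C₂) :
    (∃ ρ₁ ∈ smallVectors v w, ∃ ρ₂ ∈ smallVectors v w, IsLine C₁ ρ₁ ∧ IsLine C₂ ρ₂ ∧
      L.support = (realSpan ![ρ₁, ρ₂] : Set (Fin n → ℝ))) ∨
    (∃ r : Fin 3 → Fin n → ℤ, (∀ i, r i ∈ smallVectors v w) ∧
      (IsBergmanFan C₁ r ∨ IsBergmanFan C₂ r) ∧
      L.support = (realSpan r : Set (Fin n → ℝ))) := by
  obtain ⟨h12, ⟨d₁, hd₁, h11⟩, d₂, hd₂, h22⟩ := h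
  obtain ⟨P, hP, hLP, hL⟩ := hL.exists_isPlane h12
  obtain ⟨i, j, hP⟩ := exists_isChart hP
  have hR := hL.isRationalPlane hP
  have key := Tropical4.classification (isMaxForm_latFun v) (isMaxForm_latFun w)
    (h₁.isDivisor hP hL) (h₂.isDivisor hP hL) (by exact_mod_cast (h12.eq_sum hP hL h₂).symm)
    (by rw [← h11.eq_sum hP hL h₁]; exact_mod_cast hd₁)
    (by rw [← h22.eq_sum hP hL h₂]; exact_mod_cast hd₂)
  rcases key with ⟨ρ₁, ρ₂, hb, hs₁, hs₂, hu₁, hu₂⟩ | ⟨r, hr⟩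
  · refine Or.inl ⟨ρ₁, mem_smallVectors_of_isSmall hs₁, ρ₂, mem_smallVectors_of_isSmall hs₂,
      isLine_of_hasUnitRays hL h₁ hb hu₁, isLine_of_hasUnitRays hL h₂ hb.swap hu₂, ?_⟩
    have h1 := realSpan_eq hP hR (r := ![ρ₁, ρ₂]) (a := 0) (b := 1) hb
    have h2 : (fun c => ((![ρ₁, ρ₂] c : planeLattice P) : Fin n → ℤ)) =
        ![(ρ₁ : Fin n → ℤ), (ρ₂ : Fin n → ℤ)] := by
      funext c
      fin_cases c <;> rfl
    rw [← h2, h1, hLP]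
  · refine Or.inr ⟨fun a => r a, fun a => mem_smallVectors_of_isSmall (hr.elim (·.2.2.2 a)
      (·.2.2.2 a)), hr.imp (isBergmanFan_of_isSmallTripod hP hL h₁)
      (isBergmanFan_of_isSmallTripod hP hL h₂), ?_⟩
    rw [realSpan_eq hP hR (hr.elim (·.1) (·.1)), hLP]

/-- The supports are spans of two or three vectors from a finite set, and a cycle of weight one is
determined by its support. -/
theorem finite_isStronglyRegular (hkm : k + m = n)
    (hli : LinearIndependent ℤ (Sum.elim v w)) :
    {L : Cycle n 2 | HasPlaneSupport L ∧ IsStronglyRegular (trFunction (Matrix.vecCons 0 v))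
      (trFunction (Matrix.vecCons 0 w)) L}.Finite := by
  have hfin := finite_smallVectors hkm hli
  have hspan : ∀ q : ℕ, {A : Set (Fin n → ℝ) | ∃ r : Fin q → Fin n → ℤ,
      (∀ a, r a ∈ smallVectors v w) ∧ A = realSpan r}.Finite := fun q => by
    refine ((Set.Finite.pi' (t := fun _ : Fin q => smallVectors v w) fun _ => hfin).image
      fun r => (realSpan r : Set (Fin n → ℝ))).subset ?_
    rintro A ⟨r, hr, rfl⟩
    exact ⟨r, hr, rfl⟩
  refine Set.Finite.of_finite_image (f := Cycle.support) (((hspan 2).union (hspan 3)).subset ?_) ?_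
  · rintro _ ⟨L, ⟨hL, h⟩, rfl⟩
    obtain ⟨C₂, -, h₂, -⟩ := h.1
    obtain ⟨-, -, C₁, -, h₁, -⟩ := h.2.1
    rcases h.classification hL h₁ h₂ with ⟨ρ₁, hρ₁, ρ₂, hρ₂, -, -, hs⟩ | ⟨r, hr, -, hs⟩
    · exact Or.inl ⟨![ρ₁, ρ₂], by simp [Fin.forall_fin_two, hρ₁, hρ₂], hs⟩
    · exact Or.inr ⟨r, hr, hs⟩
  · rintro L ⟨hL, h, -⟩ L' ⟨hL', h', -⟩ (heq : L.support = L'.support)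
    obtain ⟨P, hP, hLP, hL⟩ := hL.exists_isPlane h
    obtain ⟨P', -, hLP', hL'⟩ := hL'.exists_isPlane h'
    obtain rfl : P = P' := SetLike.coe_injective (hLP.symm.trans (heq.trans hLP'))
    exact hL.eq hP hL'

end

end Tropical4

theorem theorem4p4 (n k m : ℕ) (hkm : k + m = n)
    (v : Fin k → Fin n → ℤ) (w : Fin m → Fin n → ℤ)
    (hli : LinearIndependent ℤ (Sum.elim v w))
    (T₁ T₂ : (Fin n → ℝ) → ℝ)
    (hT₁ : T₁ = Tropical4.trFunction (Matrix.vecCons 0 v))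
    (hT₂ : T₂ = Tropical4.trFunction (Matrix.vecCons 0 w)) :
    {L : Tropical4.Cycle n 2 |
      Tropical4.HasPlaneSupport L ∧ Tropical4.IsStronglyRegular T₁ T₂ L}.Finite ∧
    (Tropical4.smallVectors v w).Finite ∧
    ∀ L : Tropical4.Cycle n 2,
      Tropical4.HasPlaneSupport L → Tropical4.IsStronglyRegular T₁ T₂ L →
      ∀ C₁ C₂ : Tropical4.Cycle n 1,
        Tropical4.IsProduct T₁ L C₁ → Tropical4.IsProduct T₂ L C₂ →
        (∃ ρ₁ ∈ Tropical4.smallVectors v w, ∃ ρ₂ ∈ Tropical4.smallVectors v w,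
          Tropical4.IsLine C₁ ρ₁ ∧ Tropical4.IsLine C₂ ρ₂ ∧
          L.support = (Tropical4.realSpan ![ρ₁, ρ₂] : Set (Fin n → ℝ))) ∨
        (∃ r : Fin 3 → Fin n → ℤ, (∀ i, r i ∈ Tropical4.smallVectors v w) ∧
          (Tropical4.IsBergmanFan C₁ r ∨ Tropical4.IsBergmanFan C₂ r) ∧
          L.support = (Tropical4.realSpan r : Set (Fin n → ℝ))) := by
  subst hT₁ hT₂
  exact ⟨Tropical4.finite_isStronglyRegular hkm hli, Tropical4.finite_smallVectors hkm hli,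
    fun _ hL h _ _ h₁ h₂ => h.classification hL h₁ h₂⟩
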